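/- Let $n\in\{2,3\}$, $L>0$, and let $\mathfrak g$ be a finite-dimensional real Lie algebra with a scalar product satisfying $\langle[x,y],z\rangle=\langle x,[y,z]\rangle$ (the Lie algebra of a compact group), with an orthonormal basis $(b_P)$ and structure constants $f^{PQR}=\langle b_P,[b_Q,b_R]\rangle$. Connections and tangent vectors are $\mathfrak g$-valued one-forms $A=(A_1,\dots,A_n)$ on $\mathbb R^n$ with Schwartz components; $[X,Y]:=\sum_i[X_i,Y_i]$, and $X^P_i=\langle b_P,X_i\rangle$. **Inverse Laplacian.** For a connection $A$ let $\widehat\nabla_iu=\partial_iu+[A_i,u]$ and $\Delta_A=\sum_i\widehat\nabla_i\widehat\nabla_i$, so that $\Delta_0=\Delta$. Write $u=\Delta_A^{-1}h$ if $u$ is the smooth solution of $\Delta_Au=h$ such that $u(x)\to0$ as $|x|\to\infty$ if $n=3$, and $u(x)-\log(|x|/L)\,c\to0$ for some $c\in\mathfrak g$ if $n=2$. Call $\Delta_A$ invertible if such a $u$ exists and is unique for every Schwartz $h$. **Metric.** For a connection $\widehat A$ let $V_{\widehat A}=\{X:\ \sum_i(\partial_iX_i+[\widehat A_i,X_i])=0\}$.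 In the (generalized) Coulomb chart $a\mapsto\widehat A+a$, with $a\in V_{\widehat A}$ small, the orbit-space metric is $$\mathfrak G[a](X,Y)=\int_{\mathbb R^n}\sum_i\langle X_i,Y_i\rangle+\int_{\mathbb R^n}\langle[a,X],\Delta_{\widehat A+a}^{-1}[a,Y]\rangle,\qquad X,Y\in V_{\widehat A}.$$ **Curvature.** Let $\mathfrak D$ be given by $2\mathfrak G(Z,\mathfrak D_XY)=X\cdot\mathfrak G(Z,Y)+Y\cdot\mathfrak G(Z,X)-Z\cdot\mathfrak G(X,Y)$ for vector fields constant in the chart, $\mathcal R(Z,X)Y=\mathfrak D_Z\mathfrak D_XY-\mathfrak D_X\mathfrak D_ZY-\mathfrak D_{[Z,X]}Y$, and $\mathcal R(W,Z,X,Y)=\mathfrak G(W,\mathcal R(Z,X)Y)$. The metric is a weak one, so $\mathfrak D_XY$ is understood as the covector $\mathfrak G(\cdot,\mathfrak D_XY)$, with $\mathfrak G(W,\mathfrak D_Z\mathfrak D_XY)=Z\cdot\mathfrak G(W,\mathfrak D_XY)-\mathfrak G(\mathfrak D_ZW,\mathfrak D_XY)$, the last term being the inverse metric of the two covectors. The formal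 Ricci curvature is the formal trace of $\mathcal R$ over its first and third slots with the inverse metric $\mathfrak G^{-1}=\sum_ae_a\otimes e_a$, $(e_a)$ an orthonormal basis. The full trace diverges, so it is taken with an arbitrary finite tensor $\kappa=\sum_{a}c_a\,e_a\otimes e_a$ ($c_a\in\mathbb R$, $e_a\in V_{\widehat A}$) in place of $\mathfrak G^{-1}$: $\mathcal Ric_\kappa(X,Y)=\sum_ac_a\,\mathcal R(e_a,X,e_a,Y)$. Then the following holds. (1) $\Delta$ is invertible, and $\Delta^{-1}h(x)=\int\Delta^{-1}(x,x')h(x')\,dx'$ for Schwartz $h$, with $\Delta^{-1}(x,x')=\frac1{2\pi}\log(|x-x'|/L)$ for $n=2$ and $\Delta^{-1}(x,x')=-\frac1{4\pi|x-x'|}$ for $n=3$. If $n=3$, then $\Delta_{\widehat A}$ is invertible for every $\widehat A$. (2) Let $\widehat A$ be any connection with $\Delta_{\widehat A}$ invertible. Then $\Delta_A$ is invertible for all $A$ in a neighbourhood of $\widehat A$ (in the Schwartz topology), $(s,t)\mapsto\mathfrak G[sP+tQ](X,Y)$ is $C^2$ near $(0,0)$ for all $P,Q,X,Y\in V_{\widehat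 A}$, and at $\widehat A$ (that is, at $a=0$), for all $W,Z,X,Y,e_a\in V_{\widehat A}$ and with $\langle\cdot,\cdot\rangle$ the $L^2$ product, $$\mathcal R(W,Z,X,Y)=-2\langle[Y,W],\Delta_{\widehat A}^{-1}[X,Z]\rangle-\langle[Z,W],\Delta_{\widehat A}^{-1}[X,Y]\rangle+\langle[X,W],\Delta_{\widehat A}^{-1}[Z,Y]\rangle,$$ $$\mathcal Ric_\kappa(X,Y)=3\sum_ac_a\langle[X,e_a],\Delta_{\widehat A}^{-1}[Y,e_a]\rangle,$$ and if $X,Y$ are orthonormal, the sectional curvature $\mathcal K_{X,Y}=\mathfrak G(\mathcal R(X,Y)Y,X)$ is $$\mathcal K_{X,Y}=-3\langle[X,Y],\Delta_{\widehat A}^{-1}[X,Y]\rangle=3\langle[X,Y],(-\Delta_{\widehat A})^{-1}[X,Y]\rangle.$$ (3) At $\widehat A=0$, in components, with $\kappa^{PQ}_{ij}(x,x')=\sum_ac_a(e_a)^P_i(x)(e_a)^Q_j(x')$ and summation over repeated indices, $$\mathcal Ric_\kappa(X,Y)=3\int\!\!\int f^{VPR}X^R_i(x)\,\bigl(\Delta^{-1}(x,x')\,\kappa^{PQ}_{ij}(x,x')\bigr)\,f^{VQU}Y^U_j(x')\,dx'\,dx.$$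 This is the formal identity $\mathcal Ric(X,Y)=3f^{VPR}X^R_i(x)\,\mathrm{tr}\,\Delta^{-1}(x,x')f^{VQU}Y^U_j(x')$, in which $\mathrm{tr}$ replaces $\kappa^{PQ}_{ij}(x,x')$ by the formal kernel $\delta^{PQ}\delta_{ij}\delta(x-x')$ of $\mathfrak G^{-1}$. -/

import Mathlib

open scoped SchwartzMap ContDiff Topology

noncomputable section

/-! ## The Lie algebra of a compact group -/

/-- A real Lie algebra whose underlying vector space carries an adjoint-invariant (positive
definite) scalar product, i.e. the Lie algebra of a compact Lie group. (Mathlib's `LieRing` cannot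
be combined with `NormedAddCommGroup` without duplicating the addition, so the bracket is added to
the normed structure here, with all its laws.) -/
class AdInvariantLieAlgebra (𝔤 : Type*) [NormedAddCommGroup 𝔤] [InnerProductSpace ℝ 𝔤]
    extends Bracket 𝔤 𝔤 where
  add_bracket : ∀ x y z : 𝔤, ⁅x + y, z⁆ = ⁅x, z⁆ + ⁅y, z⁆
  bracket_add : ∀ x y z : 𝔤, ⁅x, y + z⁆ = ⁅x, y⁆ + ⁅x, z⁆
  smul_bracket : ∀ (r : ℝ) (x y : 𝔤), ⁅r • x, y⁆ = r • ⁅x, y⁆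
  bracket_smul : ∀ (r : ℝ) (x y : 𝔤), ⁅x, r • y⁆ = r • ⁅x, y⁆
  bracket_self : ∀ x : 𝔤, ⁅x, x⁆ = 0
  jacobi : ∀ x y z : 𝔤, ⁅x, ⁅y, z⁆⁆ = ⁅⁅x, y⁆, z⁆ + ⁅y, ⁅x, z⁆⁆
  inner_bracket : ∀ x y z : 𝔤, inner ℝ ⁅x, y⁆ z = inner ℝ x ⁅y, z⁆

namespace YangMills

/-- Physical space `ℝⁿ`. -/
abbrev Space (n : ℕ) : Type := EuclideanSpace ℝ (Fin n)

/-- Spatial `𝔤`-valued one-forms `A = (A₁, …, Aₙ)` with Schwartz components. They serve both as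
connections and as tangent vectors to the (affine) space of connections. -/
abbrev Conn (n : ℕ) (𝔤 : Type*) [NormedAddCommGroup 𝔤] [InnerProductSpace ℝ 𝔤] : Type _ :=
  Fin n → 𝓢(Space n, 𝔤)

variable {n : ℕ} {𝔤 : Type*} [NormedAddCommGroup 𝔤] [InnerProductSpace ℝ 𝔤]

/-- The partial derivative `∂ᵢ u`. -/
def pd (i : Fin n) (u : Space n → 𝔤) (x : Space n) : 𝔤 :=
  fderiv ℝ u x (EuclideanSpace.single i 1)

variable [AdInvariantLieAlgebra 𝔤]

/-- The gauge-covariant derivative `∂ᵢ u + [Aᵢ, u]`. -/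
def covD (A : Conn n 𝔤) (i : Fin n) (u : Space n → 𝔤) (x : Space n) : 𝔤 :=
  pd i u x + ⁅A i x, u x⁆

/-- The gauge-covariant Laplacian `Δ_A u = ∑ᵢ ∇̂ᵢ ∇̂ᵢ u`. For `A = 0` it is `∑ᵢ ∂ᵢ ∂ᵢ u`. -/
def covLap (A : Conn n 𝔤) (u : Space n → 𝔤) (x : Space n) : 𝔤 :=
  ∑ i, covD A i (covD A i u) x

/-- The gauge-covariant divergence `∑ᵢ (∂ᵢ Xᵢ + [Aᵢ, Xᵢ])`. -/
def covDiv (A X : Conn n 𝔤) (x : Space n) : 𝔤 :=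
  ∑ i, covD A i (X i) x

/-- The contracted bracket `[X, Y] = ∑ᵢ [Xᵢ, Yᵢ]`. -/
def brk (X Y : Conn n 𝔤) (x : Space n) : 𝔤 :=
  ∑ i, ⁅X i x, Y i x⁆

/-! ## The inverse of the (covariant) Laplacian -/

/-- The fundamental solution of the Laplacian of `ℝⁿ`, `n = 2, 3`: `log (|x| / L) / (2π)` with a
fixed reference length `L` for `n = 2`, and `-1 / (4π |x|)` for `n = 3`. -/
def newton (L : ℝ) (x : Space n) : ℝ :=
  if n = 2 then Real.log (‖x‖ / L) / (2 * Real.pi) else -1 / (4 * Real.pi * ‖x‖)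

/-- The behaviour at infinity of potentials of the kernel `newton L`: `u` tends to `0` if `n = 3`;
`u` is asymptotic to a constant vector times `log (|x| / L)`, with no constant term left over, if
`n = 2`. -/
def GreenAsymptotics (L : ℝ) (u : Space n → 𝔤) : Prop :=
  if n = 2 then
    ∃ c : 𝔤, Filter.Tendsto (fun x => u x - Real.log (‖x‖ / L) • c)
      (Filter.cocompact (Space n)) (𝓝 0)
  else Filter.Tendsto u (Filter.cocompact (Space n)) (𝓝 0)

/-- `u = Δ_A⁻¹ f`: `u` is a smooth solution of `Δ_A u = f` with the behaviour at infinity of the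
potentials of the flat Green function. -/
def IsGreenSolution (L : ℝ) (A : Conn n 𝔤) (f u : Space n → 𝔤) : Prop :=
  ContDiff ℝ ∞ u ∧ (∀ x, covLap A u x = f x) ∧ GreenAsymptotics L u

/-- `Δ_A` is invertible: `Δ_A⁻¹ f` exists and is unique for every Schwartz function `f`. -/
def LapInvertible (L : ℝ) (A : Conn n 𝔤) : Prop :=
  ∀ f : 𝓢(Space n, 𝔤), ∃! u : Space n → 𝔤, IsGreenSolution L A f u

open Classical in
/-- The function `Δ_A⁻¹ f` (with value `0` if it does not exist). -/
def invLap (L : ℝ) (A : Conn n 𝔤) (f : Space n → 𝔤) : Space n → 𝔤 :=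
  if h : ∃ u, IsGreenSolution L A f u then h.choose else 0

/-- The pairing `⟨f, Δ_A⁻¹ h⟩` in `L²(ℝⁿ, 𝔤)`. -/
def greenPairing (L : ℝ) (A : Conn n 𝔤) (f h : Space n → 𝔤) : ℝ :=
  ∫ x, inner ℝ (f x) (invLap L A h x)

/-! ## The metric of the orbit space in a Coulomb chart -/

/-- The `L²` scalar product of two one-forms. -/
def innerL2 (X Y : Conn n 𝔤) : ℝ :=
  ∫ x, ∑ i, inner ℝ (X i x) (Y i x)

/-- The metric of the orbit space, evaluated on tangent vectors `X, Y` at a connection `A`: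
`⟨X, Y⟩ + ⟨div_A X, Δ_A⁻¹ div_A Y⟩`, the `L²` product of the horizontal parts
`X - ∇̂ Δ_A⁻¹ div_A X` and `Y - ∇̂ Δ_A⁻¹ div_A Y` (boundary terms at infinity dropped). See `orbitMetric_eq_of_coulomb` for its form in
Coulomb coordinates. -/
def orbitMetric (L : ℝ) (A X Y : Conn n 𝔤) : ℝ :=
  innerL2 X Y + greenPairing L A (covDiv A X) (covDiv A Y)

lemma covD_add (A : Conn n 𝔤) (i : Fin n) (u v : 𝓢(Space n, 𝔤)) (x : Space n) :
    covD A i (u + v : 𝓢(Space n, 𝔤)) x = covD A i u x + covD A i v x := by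
  have h : fderiv ℝ (u + v : 𝓢(Space n, 𝔤)) x = fderiv ℝ u x + fderiv ℝ v x :=
    fderiv_add u.differentiableAt v.differentiableAt
  simp only [covD, pd, h, add_apply,
    AdInvariantLieAlgebra.bracket_add]
  abel

lemma covD_smul (A : Conn n 𝔤) (i : Fin n) (r : ℝ) (u : 𝓢(Space n, 𝔤)) (x : Space n) :
    covD A i (r • u : 𝓢(Space n, 𝔤)) x = r • covD A i u x := by
  have h : fderiv ℝ (r • u : 𝓢(Space n, 𝔤)) x = r • fderiv ℝ u x :=
    fderiv_const_smul u.differentiableAt r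
  simp only [covD, pd, h, smul_apply,
    AdInvariantLieAlgebra.bracket_smul, smul_add]

/-- The space of one-forms `X` with `∑ᵢ (∂ᵢ Xᵢ + [Âᵢ, Xᵢ]) = 0`. The generalized Coulomb chart based
at `Â` is `a ↦ Â + a` with `a` (small) in this space, which is also the tangent space at each point
of the chart; `Â = 0` gives the ordinary Coulomb condition `∑ᵢ ∂ᵢ aᵢ = 0`. -/
def coulombSlice (A₀ : Conn n 𝔤) : Submodule ℝ (Conn n 𝔤) where
  carrier := {X | ∀ x, covDiv A₀ X x = 0}
  add_mem' := by
    intro X Y hX hY x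
    have h1 := hX x
    have h2 := hY x
    simp only [covDiv] at h1 h2 ⊢
    simp only [Pi.add_apply, covD_add, Finset.sum_add_distrib, h1, h2, add_zero]
  zero_mem' := by
    intro x
    have h : ∀ i, covD A₀ i ((0 : Conn n 𝔤) i) x = 0 := by
      intro i
      have := covD_smul A₀ i 0 (0 : 𝓢(Space n, 𝔤)) x
      simpa using this
    simp only [covDiv, h, Finset.sum_const_zero]
  smul_mem' := by
    intro r X hX x
    have h1 := hX x
    simp only [covDiv] at h1 ⊢
    simp only [Pi.smul_apply, covD_smul, ← Finset.smul_sum, h1, smul_zero]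

/-- The metric `𝔊` of the orbit space in the generalized Coulomb chart based at `Â`: the scalar
product of the tangent vectors `X, Y` at the point with coordinate `a`. -/
def coulombMetric (L : ℝ) (A₀ : Conn n 𝔤) (a X Y : coulombSlice A₀) : ℝ :=
  orbitMetric L (A₀ + (a : Conn n 𝔤)) X Y

lemma covDiv_eq_brk (A₀ : Conn n 𝔤) (a X : coulombSlice A₀) :
    covDiv (A₀ + a : Conn n 𝔤) (X : Conn n 𝔤) = brk (a : Conn n 𝔤) X := by
  funext x
  have h : covDiv A₀ (X : Conn n 𝔤) x = 0 := X.2 x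
  have h2 : covDiv (A₀ + a : Conn n 𝔤) (X : Conn n 𝔤) x
      = covDiv A₀ (X : Conn n 𝔤) x + brk (a : Conn n 𝔤) X x := by
    simp only [covDiv, brk, covD, Pi.add_apply, add_apply,
      AdInvariantLieAlgebra.add_bracket, ← Finset.sum_add_distrib]
    exact Finset.sum_congr rfl fun i _ => (add_assoc _ _ _).symm
  rw [h2, h, zero_add]

/-- In Coulomb coordinates `𝔊[a](X, Y) = ⟨X, Y⟩ + ⟨[a, X], Δ_{Â + a}⁻¹ [a, Y]⟩`. -/
lemma orbitMetric_eq_of_coulomb (L : ℝ) (A₀ : Conn n 𝔤) (a X Y : coulombSlice A₀) :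
    coulombMetric L A₀ a X Y
      = innerL2 (X : Conn n 𝔤) Y
        + greenPairing L (A₀ + (a : Conn n 𝔤)) (brk (a : Conn n 𝔤) X) (brk (a : Conn n 𝔤) Y) := by
  rw [coulombMetric, orbitMetric, covDiv_eq_brk, covDiv_eq_brk]

/-! ## Curvature of a (weak) Riemannian metric in a chart

`V` is the model vector space of the chart and `g p X Y` the scalar product, at the point `p`, of
the tangent vectors `X, Y`. Tangent vectors are extended to vector fields that are constant in the
chart; such fields commute. -/

section Curvature

variable {V : Type*} [AddCommGroup V] [Module ℝ V]

/-- The directional derivative `(v · F)(p)`. -/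
def dirDeriv (F : V → ℝ) (p v : V) : ℝ :=
  deriv (fun t : ℝ => F (p + t • v)) 0

/-- The Levi-Civita derivative `D_X Y` of constant fields, as a covector:
`𝔊(Z, D_X Y) = (X · 𝔊(Z, Y) + Y · 𝔊(Z, X) - Z · 𝔊(X, Y)) / 2`. -/
def koszul (g : V → V → V → ℝ) (p X Y Z : V) : ℝ :=
  (dirDeriv (fun q => g q Z Y) p X + dirDeriv (fun q => g q Z X) p Y
    - dirDeriv (fun q => g q X Y) p Z) / 2

/-- The square of the dual norm of a covector, for the inner product `g p`. -/
def conormSq (g : V → V → V → ℝ) (p : V) (l : V → ℝ) : ℝ :=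
  sSup (Set.range fun Z : V => 2 * l Z - g p Z Z)

/-- The inverse metric: the scalar product of two covectors. If `l = 𝔊(ξ, ·)` and `m = 𝔊(η, ·)`, it
equals `𝔊(ξ, η)`; in general it is the scalar product of the vectors of the metric completion of
the tangent space that represent `l` and `m`. -/
def cometric (g : V → V → V → ℝ) (p : V) (l m : V → ℝ) : ℝ :=
  (conormSq g p (fun Z => l Z + m Z) - conormSq g p (fun Z => l Z - m Z)) / 4

/-- The Riemann tensor `R(W, Z, X, Y) = 𝔊(W, R(Z, X) Y)` with
`R(Z, X) Y = D_Z D_X Y - D_X D_Z Y - D_[Z, X] Y`, on constant fields. Since `D` is metric,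
`𝔊(W, D_Z D_X Y) = Z · 𝔊(W, D_X Y) - 𝔊(D_Z W, D_X Y)`. -/
def riemann (g : V → V → V → ℝ) (p W Z X Y : V) : ℝ :=
  (dirDeriv (fun q => koszul g q X Y W) p Z - cometric g p (koszul g p Z W) (koszul g p X Y))
  - (dirDeriv (fun q => koszul g q Z Y W) p X - cometric g p (koszul g p X W) (koszul g p Z Y))

/-- The sectional curvature `𝔊(R(X, Y) Y, X)` of the plane spanned by orthonormal `X, Y`. -/
def sectional (g : V → V → V → ℝ) (p X Y : V) : ℝ :=
  riemann g p X X Y Y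

/-- The contraction of the first and third slots of the Riemann tensor with the tensor
`∑ₐ cₐ eₐ ⊗ eₐ`. The formal Ricci curvature is the contraction with the inverse metric, i.e. with
`∑ₐ eₐ ⊗ eₐ` for an orthonormal basis `(eₐ)` of the tangent space. -/
def ricciTrace (g : V → V → V → ℝ) (p : V) {m : ℕ} (c : Fin m → ℝ) (e : Fin m → V) (X Y : V) : ℝ :=
  ∑ k, c k * riemann g p (e k) X (e k) Y

end Curvature

/-! ## Components in a basis of the Lie algebra -/

/-- The structure constants, `[v, w]^P = ∑_{Q, R} f^{PQR} v^Q w^R`. -/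
def structConst {d : ℕ} (b : OrthonormalBasis (Fin d) ℝ 𝔤) (P Q R : Fin d) : ℝ :=
  inner ℝ (b P) ⁅b Q, b R⁆

/-- The component `X^P_i(x)`. -/
def comp {d : ℕ} (b : OrthonormalBasis (Fin d) ℝ 𝔤) (X : Conn n 𝔤) (P : Fin d) (i : Fin n)
    (x : Space n) : ℝ :=
  inner ℝ (b P) (X i x)

/-- The integral kernel `∑ₐ cₐ (eₐ)^P_i(x) (eₐ)^Q_j(y)` of the tensor `∑ₐ cₐ eₐ ⊗ eₐ`. -/
def tensorKernel {d m : ℕ} (b : OrthonormalBasis (Fin d) ℝ 𝔤) (c : Fin m → ℝ)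
    (e : Fin m → Conn n 𝔤) (P Q : Fin d) (i j : Fin n) (x y : Space n) : ℝ :=
  ∑ k, c k * comp b (e k) P i x * comp b (e k) Q j y

end YangMills

end

open YangMills

open scoped SchwartzMap ContDiff Topology

noncomputable section

open MeasureTheory Filter Set

set_option linter.unusedSectionVars false
set_option maxSynthPendingDepth 3

namespace YangMills

/-! In the chart the metric is `⟨X, Y⟩ + K_a([a, X], [a, Y])` with `K_a = ⟨·, Δ_{Â+a}⁻¹ ·⟩`, so the
correction to the `L²` product is quadratic in `a`. At `a = 0` all first derivatives of the metric
vanish, hence so do the Levi-Civita covectors, and the second derivative in the directions `Z`, `P`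
is `K_0([Z, X], [P, Y]) + K_0([P, X], [Z, Y])`: derivatives of `K` never enter. The Riemann tensor
is a combination of such terms, simplified by the skewness of the contracted bracket and the
symmetry of `K_0`; the Ricci trace and the sectional curvature are specializations. This algebra is
carried by `IsBracketMetric`, `IsBracketMetric.dirDeriv_eq` and `IsBracketMetric.riemann_eq`. It
asks of the analysis that `K_a` exist for `a` near `0` along planes, that it be `C²` there, and that
`K_0` be symmetric.

The analysis turns `Δ_A u = h` into `u + ∑ₒ kerₒ * (σₒ u) = N * h`, where `N` is the Newton kernel,
the kernels are `N` and its partial derivatives, and the coefficients `σ` are Schwartz and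
polynomial in `A`. The passage from the differential to the integral equation is a Liouville theorem
for weakly harmonic functions of growth `o(|x|)` (`WeaklyHarmonic.eq_const`,
`IsGreenSolution.integral_equation`); the converse is elliptic regularity
(`iterReg_of_integral_equation`, `regularity_of_integral_equation`). On bounded continuous
functions, after division by `wt⁶`, the equation reads `(1 + T_A) φ = φ_h` with `T_A` compact by
Arzelà–Ascoli (`isCompactOperator_kerOp`).

By the Fredholm alternative `Δ_A` is invertible exactly when `1 + T_A` is a unit
(`lapInvertible_iff`). Units form an open set and inversion is smooth on it, which gives stability
of invertibility and `C²` dependence (`eventually_lapInvertible`, `contDiffAt_greenForm`). For `A =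
0` one has `T_A = 0` and the solution is `N * h`. For `n = 3` injectivity follows from the maximum
principle, since `|u|²` is subharmonic for `Δ_A u = 0` (`lapInvertible_of_three`). Symmetry of the
pairing (`greenPairing_symm`) comes from the evenness of `N` through Fubini, plus a divergence with
Schwartz coefficients, so no boundary terms at infinity have to be estimated. -/

/-! ## Weights, kernels and potentials -/

/-- The polynomial weight `1 + |x|²`. -/
def wt {n : ℕ} (x : Space n) : ℝ := 1 + ‖x‖ ^ 2

section Weight
variable {n : ℕ}

lemma one_le_wt (x : Space n) : 1 ≤ wt x := by unfold wt; nlinarith [sq_nonneg ‖x‖]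

lemma wt_pos (x : Space n) : 0 < wt x := lt_of_lt_of_le one_pos (one_le_wt x)

/-- An inequality of Peetre type: it trades decay in `x - y` for decay in `y`, at the price of a
power of `wt x`. -/
lemma wt_le_mul (x y : Space n) : wt y ≤ 2 * wt (x - y) * wt x := by
  have h : ‖y‖ ≤ ‖x - y‖ + ‖x‖ := by
    have := norm_sub_le x (x - y)
    simp only [sub_sub_cancel] at this
    linarith
  have h0 := norm_nonneg y
  have h1 : ‖y‖ ^ 2 ≤ (‖x - y‖ + ‖x‖) ^ 2 := by gcongr
  unfold wt
  nlinarith [sq_nonneg (‖x - y‖ - ‖x‖), mul_nonneg (sq_nonneg ‖x - y‖) (sq_nonneg ‖x‖)]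

lemma continuous_wt : Continuous (wt : Space n → ℝ) := by
  unfold wt; fun_prop

lemma wt_neg (x : Space n) : wt (-x) = wt x := by simp [wt]

lemma hasTemperateGrowth_wt_pow (k : ℕ) :
    Function.HasTemperateGrowth (fun x : Space n => wt x ^ k) := by
  unfold wt; fun_prop

/-- The envelope `|x|^(1/2 - n) + 1 + |x|` of the kernels. -/
def env {n : ℕ} (x : Space n) : ℝ := ‖x‖ ^ ((1 : ℝ) / 2 - n) + 1 + ‖x‖

lemma one_le_env (x : Space n) : 1 ≤ env x := by
  unfold env
  have := Real.rpow_nonneg (norm_nonneg x) ((1 : ℝ) / 2 - n)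
  linarith [norm_nonneg x]

lemma env_pos (x : Space n) : 0 < env x := lt_of_lt_of_le one_pos (one_le_env x)

lemma env_neg (x : Space n) : env (-x) = env x := by simp [env]

/-- In polar coordinates the singular part becomes `r^(-1/2)` at the origin, and the third power of
the weight leaves a multiple of `1 / (1 + r²)` at infinity. -/
lemma integrable_env_div_wt (hn : n = 2 ∨ n = 3) :
    Integrable (fun x : Space n => env x / wt x ^ 3) := by
  have hnt : Nontrivial (Space n) := by
    have : 0 < n := by omega
    have : Nonempty (Fin n) := ⟨⟨0, this⟩⟩
    infer_instance
  have key := (integrable_fun_norm_addHaar (E := Space n) volume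
    (f := fun r : ℝ => (r ^ ((1 : ℝ) / 2 - n) + 1 + r) / (1 + r ^ 2) ^ 3)).2 ?_
  · exact key
  have hdim : Module.finrank ℝ (Space n) = n := by simp
  rw [hdim]
  have hmeas : Measurable (fun y : ℝ =>
      y ^ (n - 1) • ((y ^ ((1 : ℝ) / 2 - n) + 1 + y) / (1 + y ^ 2) ^ 3)) := by fun_prop
  have hform : ∀ y : ℝ, 0 < y →
      y ^ (n - 1) * (y ^ ((1 : ℝ) / 2 - n)) = y ^ (-(1 : ℝ) / 2) := by
    intro y hy
    rw [← Real.rpow_natCast, ← Real.rpow_add hy]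
    congr 1
    rcases hn with rfl | rfl <;> norm_num
  have hb : ∀ y : ℝ, 0 < y →
      ‖y ^ (n - 1) • ((y ^ ((1 : ℝ) / 2 - n) + 1 + y) / (1 + y ^ 2) ^ 3)‖
        = (y ^ (-(1 : ℝ) / 2) + y ^ (n - 1) * (1 + y)) / (1 + y ^ 2) ^ 3 := by
    intro y hy
    rw [smul_eq_mul, Real.norm_of_nonneg (by positivity), ← hform y hy]
    ring
  have hp : ∀ y : ℝ, 0 < y → y ^ (n - 1) * (1 + y) ≤ 2 * (1 + y ^ 2) ^ 2 := by
    intro y hy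
    rcases hn with rfl | rfl
    · norm_num
      nlinarith [sq_nonneg (y - 1), sq_nonneg y, sq_nonneg (y ^ 2)]
    · norm_num
      nlinarith [sq_nonneg (y - 1), sq_nonneg y, sq_nonneg (y ^ 2), sq_nonneg (y ^ 2 - y)]
  rw [← Ioc_union_Ioi_eq_Ioi (zero_le_one (α := ℝ))]
  refine IntegrableOn.union ?_ ?_
  · have h1 : IntegrableOn (fun y : ℝ => y ^ (-(1 : ℝ) / 2) + 2) (Ioc 0 1) := by
      have h := (intervalIntegral.intervalIntegrable_rpow' (a := 0) (b := 1)
        (r := -(1 : ℝ) / 2) (by norm_num))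
      rw [intervalIntegrable_iff_integrableOn_Ioc_of_le zero_le_one] at h
      exact h.add (integrableOn_const (by simp))
    refine Integrable.mono' h1 hmeas.aestronglyMeasurable ?_
    filter_upwards [ae_restrict_mem measurableSet_Ioc] with y hy
    rw [hb y hy.1, div_le_iff₀ (by positivity)]
    have h2 := hp y hy.1
    have h3 : 0 < y ^ (-(1 : ℝ) / 2) := Real.rpow_pos_of_pos hy.1 _
    have h4 : (1 : ℝ) ≤ 1 + y ^ 2 := by nlinarith [sq_nonneg y]
    have h5 : (1 + y ^ 2) ^ 2 ≤ (1 + y ^ 2) ^ 3 := pow_le_pow_right₀ h4 (by norm_num)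
    have h6 : (1 : ℝ) ≤ (1 + y ^ 2) ^ 3 := one_le_pow₀ h4
    nlinarith
  · have h1 : IntegrableOn (fun y : ℝ => 3 * (1 + y ^ 2)⁻¹) (Ioi 1) :=
      (integrable_inv_one_add_sq.const_mul 3).integrableOn
    refine Integrable.mono' h1 hmeas.aestronglyMeasurable ?_
    filter_upwards [ae_restrict_mem measurableSet_Ioi] with y hy
    have hy' : (1 : ℝ) < y := hy
    have hy0 : 0 < y := by linarith
    rw [hb y hy0, div_le_iff₀ (by positivity)]
    have h2 := hp y hy0
    have h3 : y ^ (-(1 : ℝ) / 2) ≤ 1 := Real.rpow_le_one_of_one_le_of_nonpos hy'.le (by norm_num)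
    have h4 : (1 : ℝ) ≤ 1 + y ^ 2 := by nlinarith [sq_nonneg y]
    have h6 : (1 : ℝ) ≤ (1 + y ^ 2) ^ 2 := one_le_pow₀ h4
    have : 3 * (1 + y ^ 2)⁻¹ * (1 + y ^ 2) ^ 3 = 3 * (1 + y ^ 2) ^ 2 := by
      field_simp
    rw [this]
    linarith

lemma integrable_inv_wt_sq (hn : n = 2 ∨ n = 3) :
    Integrable (fun x : Space n => 1 / wt x ^ 2) := by
  have h := integrable_rpow_neg_one_add_norm_sq (E := Space n) (μ := volume) (r := 4) (by
    rcases hn with rfl | rfl <;> simp <;> norm_num)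
  refine h.congr (Eventually.of_forall fun x => ?_)
  have : (0 : ℝ) ≤ 1 + ‖x‖ ^ 2 := by positivity
  simp only [wt]
  rw [show (-4 / 2 : ℝ) = -((2 : ℕ) : ℝ) by norm_num, Real.rpow_neg this, Real.rpow_natCast, one_div]

/-- `∫ (|x|^(1/2 - n) + 1 + |x|) / (1 + |x|²)³`. -/
def envMass (n : ℕ) : ℝ := ∫ x : Space n, env x / wt x ^ 3

lemma envMass_nonneg : 0 ≤ envMass n :=
  integral_nonneg fun x => div_nonneg (env_pos x).le (pow_nonneg (wt_pos x).le _)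

end Weight

/-- Measurable kernels bounded by `C` times the envelope. -/
structure KerBound {n : ℕ} (κ : Space n → ℝ) (C : ℝ) : Prop where
  meas : Measurable κ
  nonneg : 0 ≤ C
  bound : ∀ x, x ≠ 0 → |κ x| ≤ C * env x

/-- Continuous functions of decay `M (1 + |x|²)⁻⁵`. -/
structure DecayBound {n : ℕ} {F : Type*} [NormedAddCommGroup F] (f : Space n → F) (M : ℝ) :
    Prop where
  cont : Continuous f
  bound : ∀ x, ‖f x‖ ≤ M / wt x ^ 5

/-- The potential `∫ κ(y) f(x - y) dy`. -/
def pot {n : ℕ} {F : Type*} [NormedAddCommGroup F] [NormedSpace ℝ F] (κ : Space n → ℝ)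
    (f : Space n → F) (x : Space n) : F :=
  ∫ y, κ y • f (x - y)

section Pot

variable {n : ℕ} {F : Type*} [NormedAddCommGroup F] [NormedSpace ℝ F]
  {G : Type*} [NormedAddCommGroup G] [NormedSpace ℝ G]
  {H : Type*} [NormedAddCommGroup H] [NormedSpace ℝ H]
  {κ κ' : Space n → ℝ} {C C' M M' : ℝ} {f g : Space n → F}

lemma KerBound.sub (h : KerBound κ C) (h' : KerBound κ' C') :
    KerBound (fun x => κ x - κ' x) (C + C') where
  meas := h.meas.sub h'.meas
  nonneg := add_nonneg h.nonneg h'.nonneg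
  bound x hx := by
    rw [add_mul]
    exact (abs_sub _ _).trans (add_le_add (h.bound x hx) (h'.bound x hx))

lemma KerBound.comp_neg (h : KerBound κ C) : KerBound (fun x => κ (-x)) C where
  meas := h.meas.comp measurable_neg
  nonneg := h.nonneg
  bound x hx := by
    rw [← env_neg x]
    exact h.bound (-x) (neg_ne_zero.2 hx)

lemma DecayBound.nonneg (h : DecayBound f M) : 0 ≤ M := by
  have := (norm_nonneg _).trans (h.bound 0)
  simpa [wt] using this

lemma DecayBound.bound_const (h : DecayBound f M) (x : Space n) : ‖f x‖ ≤ M :=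
  (h.bound x).trans (div_le_self h.nonneg (one_le_pow₀ (one_le_wt x)))

lemma DecayBound.mono (h : DecayBound f M) (hM : M ≤ M') : DecayBound f M' :=
  ⟨h.cont, fun x => (h.bound x).trans (by have := wt_pos x; gcongr)⟩

lemma DecayBound.add (h : DecayBound f M) (h' : DecayBound g M') :
    DecayBound (fun x => f x + g x) (M + M') :=
  ⟨h.cont.add h'.cont, fun x => by
    rw [add_div]; exact (norm_add_le _ _).trans (add_le_add (h.bound x) (h'.bound x))⟩

lemma DecayBound.neg (h : DecayBound f M) : DecayBound (fun x => -f x) M :=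
  ⟨h.cont.neg, fun x => by rw [norm_neg]; exact h.bound x⟩

lemma DecayBound.sum {ι : Type*} {s : Finset ι} {f : ι → Space n → F} {M : ι → ℝ}
    (h : ∀ i ∈ s, DecayBound (f i) (M i)) :
    DecayBound (fun x => ∑ i ∈ s, f i x) (∑ i ∈ s, M i) :=
  ⟨continuous_finsetSum _ fun i hi => (h i hi).cont, fun x => by
    rw [Finset.sum_div]
    exact (norm_sum_le _ _).trans (Finset.sum_le_sum fun i hi => (h i hi).bound x)⟩

lemma exists_decayBound_of_schwartz (f : 𝓢(Space n, F)) : ∃ M, DecayBound f M := by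
  set g := SchwartzMap.smulLeftCLM F (fun x : Space n => wt x ^ 5) f
  refine ⟨SchwartzMap.seminorm ℝ 0 0 g, f.continuous, fun x => ?_⟩
  rw [le_div_iff₀ (pow_pos (wt_pos x) _)]
  have h := SchwartzMap.norm_le_seminorm ℝ g x
  rw [SchwartzMap.smulLeftCLM_apply_apply (hasTemperateGrowth_wt_pow 5), norm_smul,
    Real.norm_of_nonneg (pow_nonneg (wt_pos x).le _)] at h
  linarith

lemma DecayBound.integrable (hn : n = 2 ∨ n = 3) (hf : DecayBound f M) : Integrable f := by
  refine Integrable.mono' ((integrable_inv_wt_sq hn).const_mul M) hf.cont.aestronglyMeasurable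
    (Eventually.of_forall fun x => (hf.bound x).trans ?_)
  rw [mul_one_div]
  have := one_le_wt x
  have := hf.nonneg
  have : wt x ^ 2 ≤ wt x ^ 5 := pow_le_pow_right₀ ‹_› (by norm_num)
  have := wt_pos x
  gcongr

/-- By `wt_le_mul`, `wt (x - y)⁻⁵ ≤ 32 wt x⁵ / wt y⁵`; two of the five powers of `wt y` are given
away. The result is one integrable majorant in `y` with a locally bounded factor in `x`, which
serves every dominated convergence argument below. -/
lemma norm_kernel_smul_le (hκ : KerBound κ C) (hf : DecayBound f M) (x : Space n) {y : Space n}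
    (hy : y ≠ 0) :
    ‖κ y • f (x - y)‖ ≤ 32 * C * M * wt x ^ 5 * (env y / wt y ^ 3) := by
  rw [norm_smul, Real.norm_eq_abs]
  have h1 := hκ.bound y hy
  have h2 := hf.bound (x - y)
  have h3 := wt_pos (x - y)
  have h4 := wt_pos y
  have h5 := wt_pos x
  have h6 := hκ.nonneg
  have h7 := hf.nonneg
  have h8 := env_pos y
  have h9 : wt y ^ 5 ≤ (2 * wt (x - y) * wt x) ^ 5 := by
    gcongr; exact wt_le_mul x y
  have h10 : wt y ^ 3 ≤ wt y ^ 5 := pow_le_pow_right₀ (one_le_wt y) (by norm_num)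
  have h11 : 1 / wt (x - y) ^ 5 ≤ 32 * wt x ^ 5 / wt y ^ 3 := by
    rw [div_le_div_iff₀ (by positivity) (by positivity)]
    calc 1 * wt y ^ 3 ≤ wt y ^ 5 := by linarith
      _ ≤ _ := h9
      _ = _ := by ring
  calc |κ y| * ‖f (x - y)‖ ≤ (C * env y) * (M / wt (x - y) ^ 5) := by gcongr
    _ = (C * env y) * (M * (1 / wt (x - y) ^ 5)) := by ring
    _ ≤ (C * env y) * (M * (32 * wt x ^ 5 / wt y ^ 3)) := by gcongr
    _ = _ := by ring

lemma ae_ne_zero (hn : n = 2 ∨ n = 3) : ∀ᵐ y : Space n, y ≠ 0 := by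
  have : Nonempty (Fin n) := ⟨⟨0, by omega⟩⟩
  have : Nontrivial (Space n) := inferInstance
  exact compl_mem_ae_iff.2 (measure_singleton 0)

lemma integrable_pot (hn : n = 2 ∨ n = 3) (hκ : KerBound κ C) (hf : DecayBound f M)
    (x : Space n) : Integrable (fun y => κ y • f (x - y)) := by
  refine Integrable.mono' ((integrable_env_div_wt hn).const_mul (32 * C * M * wt x ^ 5)) ?_ ?_
  · exact hκ.meas.aestronglyMeasurable.smul
      (hf.cont.comp (continuous_const.sub continuous_id)).aestronglyMeasurable
  · filter_upwards [ae_ne_zero hn] with y hy using norm_kernel_smul_le hκ hf x hy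

lemma norm_pot_le (hn : n = 2 ∨ n = 3) (hκ : KerBound κ C) (hf : DecayBound f M)
    (x : Space n) : ‖pot κ f x‖ ≤ 32 * envMass n * C * M * wt x ^ 5 := by
  calc ‖pot κ f x‖ ≤ ∫ y, 32 * C * M * wt x ^ 5 * (env y / wt y ^ 3) := by
        refine norm_integral_le_of_norm_le ((integrable_env_div_wt hn).const_mul _) ?_
        filter_upwards [ae_ne_zero hn] with y hy using norm_kernel_smul_le hκ hf x hy
    _ = _ := by rw [integral_const_mul, envMass]; ring

lemma wt_le_of_norm_le {R : ℝ} {x : Space n} (h : ‖x‖ ≤ R) : wt x ≤ 1 + R ^ 2 := by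
  unfold wt
  have := norm_nonneg x
  gcongr

lemma continuous_pot (hn : n = 2 ∨ n = 3) (hκ : KerBound κ C) (hf : DecayBound f M) :
    Continuous (pot κ f) := by
  rw [continuous_iff_continuousAt]
  intro x₀
  refine continuousAt_of_dominated
    (bound := fun y => 32 * C * M * (1 + (‖x₀‖ + 1) ^ 2) ^ 5 * (env y / wt y ^ 3)) ?_ ?_
    ((integrable_env_div_wt hn).const_mul _) ?_
  · exact Eventually.of_forall fun x => (integrable_pot hn hκ hf x).aestronglyMeasurable
  · filter_upwards [Metric.ball_mem_nhds x₀ one_pos] with x hx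
    filter_upwards [ae_ne_zero hn] with y hy
    refine (norm_kernel_smul_le hκ hf x hy).trans ?_
    have h1 : ‖x‖ ≤ ‖x₀‖ + 1 := by
      have := norm_sub_norm_le x x₀
      rw [mem_ball_iff_norm] at hx
      linarith
    have := wt_le_of_norm_le h1
    have := hκ.nonneg
    have := hf.nonneg
    have := wt_pos x
    have := wt_pos y
    have := env_pos y
    gcongr
  · exact Eventually.of_forall fun y =>
      (continuous_const.smul (hf.cont.comp (continuous_id.sub continuous_const))).continuousAt

lemma pot_eq_integral_sub (κ : Space n → ℝ) (f : Space n → F) (x : Space n) :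
    pot κ f x = ∫ y, κ (x - y) • f y := by
  rw [pot, ← integral_sub_left_eq_self (fun y => κ y • f (x - y)) volume x]
  simp

lemma integrable_pot' (hn : n = 2 ∨ n = 3) (hκ : KerBound κ C) (hf : DecayBound f M)
    (x : Space n) : Integrable (fun y => κ (x - y) • f y) := by
  have := (integrable_pot hn hκ hf x).comp_sub_left x
  simpa using this

/-- The kernel may be singular, so the derivative is put on the density. -/
lemma hasFDerivAt_pot (hn : n = 2 ∨ n = 3) (hκ : KerBound κ C) (hf : DecayBound f M)
    (hd : Differentiable ℝ f) (hf' : DecayBound (fderiv ℝ f) M') (x : Space n) :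
    HasFDerivAt (pot κ f) (pot κ (fderiv ℝ f) x) x := by
  refine hasFDerivAt_integral_of_dominated_of_fderiv_le (𝕜 := ℝ)
    (bound := fun y => 32 * C * M' * (1 + (‖x‖ + 1) ^ 2) ^ 5 * (env y / wt y ^ 3))
    (F' := fun x y => κ y • fderiv ℝ f (x - y))
    (Metric.ball_mem_nhds x one_pos) ?_ (integrable_pot hn hκ hf x)
    (integrable_pot hn hκ hf' x).aestronglyMeasurable ?_
    ((integrable_env_div_wt hn).const_mul _) ?_
  · exact Eventually.of_forall fun x => (integrable_pot hn hκ hf x).aestronglyMeasurable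
  · filter_upwards [ae_ne_zero hn] with y hy x' hx'
    refine (norm_kernel_smul_le hκ hf' x' hy).trans ?_
    have h1 : ‖x'‖ ≤ ‖x‖ + 1 := by
      have := norm_sub_norm_le x' x
      rw [mem_ball_iff_norm] at hx'
      linarith
    have := wt_le_of_norm_le h1
    have := hκ.nonneg
    have := hf'.nonneg
    have := wt_pos x'
    have := wt_pos y
    have := env_pos y
    gcongr
  · refine Eventually.of_forall fun y x' _ => ?_
    have := (hd (x' - y)).hasFDerivAt.comp x' ((hasFDerivAt_id x').sub_const y)
    simpa using! this.const_smul (κ y)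

lemma pot_clm [CompleteSpace F] [CompleteSpace G] (hn : n = 2 ∨ n = 3) (hκ : KerBound κ C)
    (hf : DecayBound f M)
    (L : F →L[ℝ] G) (x : Space n) : pot κ (fun y => L (f y)) x = L (pot κ f x) := by
  rw [pot, pot, ← L.integral_comp_comm (integrable_pot hn hκ hf x)]
  simp

lemma pot_add (hn : n = 2 ∨ n = 3) (hκ : KerBound κ C) (hf : DecayBound f M)
    (hg : DecayBound g M') (x : Space n) :
    pot κ (fun y => f y + g y) x = pot κ f x + pot κ g x := by
  simp only [pot, smul_add]
  exact integral_add (integrable_pot hn hκ hf x) (integrable_pot hn hκ hg x)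

lemma pot_neg (κ : Space n → ℝ) (f : Space n → F) (x : Space n) :
    pot κ (fun y => -f y) x = -pot κ f x := by
  simp only [pot, smul_neg, integral_neg]

lemma pot_const_smul (κ : Space n → ℝ) (f : Space n → F) (c : ℝ) (x : Space n) :
    pot κ (fun y => c • f y) x = c • pot κ f x := by
  simp only [pot, smul_comm _ c, integral_smul]

lemma pot_sum {ι : Type*} {s : Finset ι} {f : ι → Space n → F} {M : ι → ℝ}
    (hn : n = 2 ∨ n = 3) (hκ : KerBound κ C) (h : ∀ i ∈ s, DecayBound (f i) (M i))
    (x : Space n) : pot κ (fun y => ∑ i ∈ s, f i y) x = ∑ i ∈ s, pot κ (f i) x := by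
  simp only [pot, Finset.smul_sum]
  exact integral_finsetSum _ fun i hi => integrable_pot hn hκ (h i hi) x

lemma pot_sub_kernel (hn : n = 2 ∨ n = 3) (hκ : KerBound κ C) (hκ' : KerBound κ' C')
    (hf : DecayBound f M) (x : Space n) :
    pot (fun y => κ y - κ' y) f x = pot κ f x - pot κ' f x := by
  simp only [pot, sub_smul]
  exact integral_sub (integrable_pot hn hκ hf x) (integrable_pot hn hκ' hf x)

lemma pot_kernel_neg_comp (κ : Space n → ℝ) (f : Space n → F) (x : Space n) :
    pot (fun y => κ (-y)) f x = ∫ y, κ (y - x) • f y := by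
  rw [pot_eq_integral_sub]; simp

/-- Convolution with a kernel is the transpose of convolution with the reflected kernel. -/
lemma integral_bilin_pot [CompleteSpace F] [CompleteSpace G] [CompleteSpace H]
    (hn : n = 2 ∨ n = 3) (hκ : KerBound κ C)
    {g : Space n → G} (hf : DecayBound f M) (hg : DecayBound g M') (B : G →L[ℝ] F →L[ℝ] H) :
    ∫ x, B (g x) (pot κ f x) = ∫ y, B (pot (fun z => κ (-z)) g y) (f y) := by
  set D : Space n → Space n → H := fun x y => B (g x) (κ (x - y) • f y) with hD
  -- Integrability for Fubini: the integrand is dominated by `wt(y)⁻² · env(x - y) wt(x - y)⁻³`, a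
  -- convolution integrand of two integrable functions.
  have h1 : Integrable (Function.uncurry D) (volume.prod volume) := by
    have hI := Integrable.convolution_integrand (ContinuousLinearMap.mul ℝ ℝ)
      (integrable_inv_wt_sq hn) (integrable_env_div_wt hn)
    refine Integrable.mono' (hI.const_mul (‖B‖ * M' * C * M * 8)) ?_ ?_
    · have e1 : AEStronglyMeasurable (fun p : Space n × Space n => κ (p.1 - p.2) • f p.2)
          (volume.prod volume) :=
        ((hκ.meas.comp (measurable_fst.sub measurable_snd)).aestronglyMeasurable).smul
          (hf.cont.comp continuous_snd).aestronglyMeasurable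
      exact B.aestronglyMeasurable_comp₂
        (hg.cont.comp continuous_fst).aestronglyMeasurable e1
    -- The kernel bound says nothing at the origin; the diagonal is null, being the preimage of a
    -- null set under subtraction.
    · have hae : ∀ᵐ p : Space n × Space n ∂(volume.prod volume), p.1 - p.2 ≠ 0 :=
        (quasiMeasurePreserving_sub_of_right_invariant (G := Space n) volume volume).ae
          (ae_ne_zero hn)
      filter_upwards [hae] with p hp
      obtain ⟨x, y⟩ := p
      simp only [Function.uncurry, hD, ContinuousLinearMap.mul_apply']
      have h2 := hκ.bound (x - y) hp
      have a1 := wt_pos x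
      have a2 := wt_pos y
      have a3 := wt_pos (x - y)
      have a4 := env_pos (x - y)
      have a5 := hκ.nonneg
      have a6 := hf.nonneg
      have a7 := hg.nonneg
      have hw : wt (x - y) ≤ 2 * wt y * wt x := by
        have := wt_le_mul x (x - y)
        simpa using this
      have hw3 : wt (x - y) ^ 3 ≤ 8 * wt y ^ 3 * wt x ^ 3 := by
        calc wt (x - y) ^ 3 ≤ (2 * wt y * wt x) ^ 3 := by gcongr
          _ = _ := by ring
      have hw5 : 1 / (wt x ^ 5 * wt y ^ 5) ≤ 8 / (wt y ^ 2 * wt (x - y) ^ 3) := by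
        rw [div_le_div_iff₀ (by positivity) (by positivity)]
        have : (1 : ℝ) ≤ wt x ^ 2 := one_le_pow₀ (one_le_wt x)
        calc 1 * (wt y ^ 2 * wt (x - y) ^ 3) ≤ 1 * (wt y ^ 2 * (8 * wt y ^ 3 * wt x ^ 3)) := by
              gcongr
          _ = 8 * (wt x ^ 3 * wt y ^ 5) * 1 := by ring
          _ ≤ 8 * (wt x ^ 3 * wt y ^ 5) * wt x ^ 2 := by gcongr
          _ = _ := by ring
      calc ‖B (g x) (κ (x - y) • f y)‖ ≤ ‖B‖ * ‖g x‖ * ‖κ (x - y) • f y‖ := B.le_opNorm₂ _ _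
        _ = ‖B‖ * ‖g x‖ * (|κ (x - y)| * ‖f y‖) := by rw [norm_smul, Real.norm_eq_abs]
        _ ≤ ‖B‖ * (M' / wt x ^ 5) * (C * env (x - y) * (M / wt y ^ 5)) := by
          gcongr
          · exact hg.bound x
          · exact hf.bound y
        _ = ‖B‖ * M' * C * M * env (x - y) * (1 / (wt x ^ 5 * wt y ^ 5)) := by
          field_simp
        _ ≤ ‖B‖ * M' * C * M * env (x - y) * (8 / (wt y ^ 2 * wt (x - y) ^ 3)) :=
          mul_le_mul_of_nonneg_left hw5 (by positivity)
        _ = _ := by field_simp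
  have h2 : ∀ x, B (g x) (pot κ f x) = ∫ y, D x y := by
    intro x
    rw [pot_eq_integral_sub, ← (B (g x)).integral_comp_comm (integrable_pot' hn hκ hf x)]
  have h3 : ∀ y, B (pot (fun z => κ (-z)) g y) (f y) = ∫ x, D x y := by
    intro y
    have e : ∀ x, D x y = (B.flip (f y)) (κ (x - y) • g x) := by
      intro x; simp [hD]
    simp only [e]
    have hi : Integrable (fun x => κ (x - y) • g x) := by
      have := integrable_pot' hn hκ.comp_neg hg y
      simpa using this
    rw [(B.flip (f y)).integral_comp_comm hi, pot_kernel_neg_comp]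
    simp
  simp only [h2, h3]
  exact integral_integral_swap h1

end Pot

/-! ## The Newton kernel, its gradient, and their regularizations -/

section Kernels

variable {n : ℕ}

/-- The area of the unit sphere of `ℝⁿ`, `n = 2, 3`. -/
def sphereArea (n : ℕ) : ℝ := if n = 2 then 2 * Real.pi else 4 * Real.pi

lemma three_lt_sphereArea (n : ℕ) : 3 < sphereArea n := by
  unfold sphereArea
  split_ifs <;> linarith [Real.pi_gt_three]

/-- `(ε² + |x|²)^(-1/2)`. -/
def invReg (ε : ℝ) (x : Space n) : ℝ := (√(ε ^ 2 + ‖x‖ ^ 2))⁻¹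

/-- The gradient `xᵢ / (σₙ |x|ⁿ)` of the Newton kernel. -/
def newtonGrad (i : Fin n) (x : Space n) : ℝ := x i / (sphereArea n * ‖x‖ ^ n)

/-- The regularized Newton kernel. -/
def regNewton (L ε : ℝ) (x : Space n) : ℝ :=
  if n = 2 then Real.log (√(ε ^ 2 + ‖x‖ ^ 2) / L) / (2 * Real.pi)
  else -invReg ε x / (4 * Real.pi)

/-- The gradient of the regularized Newton kernel. -/
def regGrad (ε : ℝ) (i : Fin n) (x : Space n) : ℝ := x i * invReg ε x ^ n / sphereArea n

/-- The Laplacian of the regularized Newton kernel. -/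
def regDelta (ε : ℝ) (x : Space n) : ℝ := n * ε ^ 2 * invReg ε x ^ (n + 2) / sphereArea n

variable {ε : ℝ}

lemma invReg_pos (hε : 0 < ε) (x : Space n) : 0 < invReg ε x := by
  unfold invReg; positivity

lemma invReg_sq (hε : 0 < ε) (x : Space n) : invReg ε x ^ 2 * (ε ^ 2 + ‖x‖ ^ 2) = 1 := by
  unfold invReg
  rw [inv_pow, Real.sq_sqrt (by positivity)]
  exact inv_mul_cancel₀ (by positivity)

lemma invReg_le (hε : 0 < ε) (x : Space n) : invReg ε x ≤ ε⁻¹ := by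
  unfold invReg
  gcongr
  exact Real.le_sqrt_of_sq_le (by nlinarith [sq_nonneg ‖x‖])

lemma norm_mul_invReg_le (hε : 0 < ε) (x : Space n) : ‖x‖ * invReg ε x ≤ 1 := by
  have h := invReg_sq hε x
  have h1 := invReg_pos hε x
  have h2 := norm_nonneg x
  have : (‖x‖ * invReg ε x) ^ 2 ≤ 1 := by nlinarith [sq_nonneg (invReg ε x * ε)]
  nlinarith [mul_nonneg h2 h1.le]

lemma abs_coord_le_norm (x : Space n) (i : Fin n) : |x i| ≤ ‖x‖ := by
  simpa using PiLp.norm_apply_le x i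

lemma hasFDerivAt_sqrt_reg (hε : 0 < ε) (x : Space n) :
    HasFDerivAt (fun x : Space n => √(ε ^ 2 + ‖x‖ ^ 2)) (invReg ε x • innerSL ℝ x) x := by
  have h1 : HasFDerivAt (fun x : Space n => ε ^ 2 + ‖x‖ ^ 2) (2 • innerSL ℝ x) x :=
    (hasStrictFDerivAt_norm_sq x).hasFDerivAt.const_add _
  convert! h1.sqrt (by positivity) using 1
  ext v
  simp [invReg]
  ring

lemma hasFDerivAt_invReg (hε : 0 < ε) (x : Space n) :
    HasFDerivAt (invReg ε) (-(invReg ε x) ^ 3 • innerSL ℝ x) x := by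
  have h := (hasDerivAt_inv (by positivity : √(ε ^ 2 + ‖x‖ ^ 2) ≠ 0)).comp_hasFDerivAt x
    (hasFDerivAt_sqrt_reg hε x)
  convert! h using 1
  ext v
  simp [invReg]
  ring

lemma hasFDerivAt_coord (i : Fin n) (x : Space n) :
    HasFDerivAt (fun x : Space n => x i) (EuclideanSpace.proj i : Space n →L[ℝ] ℝ) x :=
  (EuclideanSpace.proj i : Space n →L[ℝ] ℝ).hasFDerivAt

/-- The algebra of functions generated by `(ε² + |x|²)^(-1/2)` and `xᵢ (ε² + |x|²)^(-1/2)`. -/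
def symbolAlg (n : ℕ) (ε : ℝ) : Subalgebra ℝ (Space n → ℝ) :=
  Algebra.adjoin ℝ (insert (invReg ε) (range fun i : Fin n => fun x => x i * invReg ε x))

lemma invReg_mem : (invReg ε : Space n → ℝ) ∈ symbolAlg n ε :=
  Algebra.subset_adjoin (mem_insert _ _)

lemma coord_mul_invReg_mem (i : Fin n) :
    (fun x : Space n => x i * invReg ε x) ∈ symbolAlg n ε :=
  Algebra.subset_adjoin (mem_insert_of_mem _ ⟨i, rfl⟩)

lemma pd_invReg (hε : 0 < ε) (j : Fin n) (x : Space n) :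
    pd j (invReg ε) x = -(x j) * invReg ε x ^ 3 := by
  rw [pd, (hasFDerivAt_invReg hε x).fderiv]
  simp [EuclideanSpace.inner_single_right]
  ring

/-- The generators are bounded and their partial derivatives are polynomials in the generators, so
the Leibniz rule keeps the algebra stable under differentiation. Hence all iterated derivatives of
its members are bounded. -/
lemma symbolAlg_spec (hε : 0 < ε) {f : Space n → ℝ} (hf : f ∈ symbolAlg n ε) :
    Differentiable ℝ f ∧ (∃ C, ∀ x, |f x| ≤ C) ∧ ∀ j, pd j f ∈ symbolAlg n ε := by
  refine Algebra.adjoin_induction (p := fun f _ => Differentiable ℝ f ∧ (∃ C, ∀ x, |f x| ≤ C) ∧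
    ∀ j, pd j f ∈ symbolAlg n ε) ?_ ?_ ?_ ?_ hf
  · intro f hf
    rcases hf with rfl | ⟨i, rfl⟩
    · refine ⟨fun x => (hasFDerivAt_invReg hε x).differentiableAt, ⟨ε⁻¹, fun x => ?_⟩, fun j => ?_⟩
      · rw [abs_of_pos (invReg_pos hε x)]; exact invReg_le hε x
      · have : pd j (invReg ε : Space n → ℝ)
            = -((fun x => x j * invReg ε x) * (invReg ε * invReg ε)) := by
          ext x; rw [pd_invReg hε]; simp; ring
        rw [this]
        exact neg_mem (mul_mem (coord_mul_invReg_mem j) (mul_mem invReg_mem invReg_mem))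
    · have hd : ∀ x : Space n, HasFDerivAt (fun x : Space n => x i * invReg ε x)
          (x i • (-(invReg ε x) ^ 3 • innerSL ℝ x)
            + invReg ε x • (EuclideanSpace.proj i : Space n →L[ℝ] ℝ)) x :=
        fun x => (hasFDerivAt_coord i x).mul (hasFDerivAt_invReg hε x)
      refine ⟨fun x => (hd x).differentiableAt, ⟨1, fun x => ?_⟩, fun j => ?_⟩
      · rw [abs_mul, abs_of_pos (invReg_pos hε x)]
        exact (mul_le_mul_of_nonneg_right (abs_coord_le_norm x i) (invReg_pos hε x).le).trans
          (norm_mul_invReg_le hε x)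
      · have : pd j (fun x : Space n => x i * invReg ε x)
            = (if i = j then (1 : ℝ) else 0) • (invReg ε : Space n → ℝ)
              - (fun x => x i * invReg ε x) * ((fun x => x j * invReg ε x) * invReg ε) := by
          ext x
          rw [pd, (hd x).fderiv]
          by_cases hij : i = j
          · subst hij
            simp [EuclideanSpace.inner_single_right]
            ring
          · simp [EuclideanSpace.inner_single_right, hij]
            ring
        rw [this]
        exact sub_mem (Subalgebra.smul_mem _ invReg_mem _)
          (mul_mem (coord_mul_invReg_mem i) (mul_mem (coord_mul_invReg_mem j) invReg_mem))
  · intro r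
    refine ⟨differentiable_const r, ⟨|r|, fun x => le_refl _⟩, fun j => ?_⟩
    have : pd j (algebraMap ℝ (Space n → ℝ) r) = 0 := by
      ext x
      have : (algebraMap ℝ (Space n → ℝ) r) = fun _ => r := rfl
      rw [pd, this]; simp
    rw [this]
    exact zero_mem _
  · rintro f g - - ⟨hf, ⟨C, hC⟩, hf'⟩ ⟨hg, ⟨C', hC'⟩, hg'⟩
    refine ⟨hf.add hg, ⟨C + C', fun x => (abs_add_le _ _).trans (add_le_add (hC x) (hC' x))⟩,
      fun j => ?_⟩
    have : pd j (f + g) = pd j f + pd j g := by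
      ext x
      simp [pd, fderiv_add (hf x) (hg x)]
    rw [this]
    exact add_mem (hf' j) (hg' j)
  · rintro f g hfm hgm ⟨hf, ⟨C, hC⟩, hf'⟩ ⟨hg, ⟨C', hC'⟩, hg'⟩
    refine ⟨hf.mul hg, ⟨C * C', fun x => ?_⟩, fun j => ?_⟩
    · simp only [Pi.mul_apply, abs_mul]
      exact mul_le_mul (hC x) (hC' x) (abs_nonneg _) ((abs_nonneg _).trans (hC x))
    have : pd j (f * g) = f * pd j g + g * pd j f := by
      ext x
      simp [pd, fderiv_mul (hf x) (hg x)]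
    rw [this]
    exact add_mem (mul_mem hfm (hg' j)) (mul_mem hgm (hf' j))

lemma kerBound_of_bounded {f : Space n → ℝ} (hc : Continuous f) {C : ℝ} (hC : ∀ x, |f x| ≤ C) :
    KerBound f C where
  meas := hc.measurable
  nonneg := (abs_nonneg _).trans (hC 0)
  bound x _ := (hC x).trans
    (le_mul_of_one_le_right ((abs_nonneg _).trans (hC 0)) (one_le_env x))

lemma regGrad_mem (hn : n = 2 ∨ n = 3) (i : Fin n) : regGrad ε i ∈ symbolAlg n ε := by
  have : regGrad ε i = (sphereArea n)⁻¹ •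
      ((fun x : Space n => x i * invReg ε x) * invReg ε ^ (n - 1)) := by
    ext x
    obtain ⟨k, rfl⟩ : ∃ k, n = k + 1 := ⟨n - 1, by omega⟩
    simp [regGrad]
    ring
  rw [this]
  exact Subalgebra.smul_mem _ (mul_mem (coord_mul_invReg_mem i) (pow_mem invReg_mem _)) _

lemma hasFDerivAt_regNewton (hn : n = 2 ∨ n = 3) {L : ℝ} (hL : 0 < L) (hε : 0 < ε) (x : Space n) :
    HasFDerivAt (regNewton L ε) ((invReg ε x ^ n / sphereArea n) • innerSL ℝ x) x := by
  rcases hn with rfl | rfl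
  · have h1 := ((hasFDerivAt_sqrt_reg hε x).mul_const L⁻¹).log (by positivity)
    have h2 := h1.mul_const (2 * Real.pi)⁻¹
    have e : (regNewton L ε : Space 2 → ℝ)
        = fun x => Real.log (√(ε ^ 2 + ‖x‖ ^ 2) / L) / (2 * Real.pi) := by
      ext x; simp [regNewton]
    rw [e]
    convert! h2 using 1
    ext v
    simp [invReg, sphereArea]
    field_simp
  · have h2 := ((hasFDerivAt_invReg hε x).neg).mul_const (4 * Real.pi)⁻¹
    have e : (regNewton L ε : Space 3 → ℝ) = fun x => -invReg ε x / (4 * Real.pi) := by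
      ext x; simp [regNewton]
    rw [e]
    convert! h2 using 1
    ext v
    simp [sphereArea]
    ring

lemma pd_regNewton (hn : n = 2 ∨ n = 3) {L : ℝ} (hL : 0 < L) (hε : 0 < ε) (i : Fin n) :
    pd i (regNewton L ε : Space n → ℝ) = regGrad ε i := by
  ext x
  rw [pd, (hasFDerivAt_regNewton hn hL hε x).fderiv]
  simp [EuclideanSpace.inner_single_right, regGrad]
  ring

lemma pd_regGrad (hε : 0 < ε) (i : Fin n) (x : Space n) :
    pd i (regGrad ε i) x
      = (invReg ε x ^ n - n * x i ^ 2 * invReg ε x ^ (n + 2)) / sphereArea n := by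
  have h := ((hasFDerivAt_coord i x).mul ((hasFDerivAt_invReg hε x).pow n)).mul_const (sphereArea n)⁻¹
  have e : regGrad ε i = fun x : Space n => x i * invReg ε x ^ n / sphereArea n := rfl
  rw [pd, e, HasFDerivAt.fderiv (by convert! h using 1)]
  rcases n with _ | k
  · exact i.elim0
  · simp [EuclideanSpace.inner_single_right]
    ring

lemma sum_pd_regGrad (hε : 0 < ε) (x : Space n) : ∑ i, pd i (regGrad ε i) x = regDelta ε x := by
  simp only [pd_regGrad hε, ← Finset.sum_div, Finset.sum_sub_distrib, ← Finset.sum_mul,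
    ← Finset.mul_sum, regDelta]
  have h1 : ∑ i, x i ^ 2 = ‖x‖ ^ 2 := by
    rw [EuclideanSpace.norm_sq_eq]; simp
  have h2 := invReg_sq hε x
  rw [h1]
  congr 1
  -- Inserting `1 = ρ² (ε² + |x|²)`, with `ρ = invReg ε x`, makes the `|x|²` terms cancel and leaves
  -- `n ε² ρ^(n+2)`.
  have : invReg ε x ^ n = invReg ε x ^ n * (invReg ε x ^ 2 * (ε ^ 2 + ‖x‖ ^ 2)) := by rw [h2, mul_one]
  simp
  rw [this]
  ring

/-- Inside the unit ball one compares the exponents `-k ≥ 1 - n > 1/2 - n`; outside it the constant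
in the envelope suffices. -/
lemma inv_pow_le_env (x : Space n) (hx : x ≠ 0) {k : ℕ} (hk : k + 1 ≤ n) :
    (‖x‖ ^ k)⁻¹ ≤ env x := by
  have hr : 0 < ‖x‖ := norm_pos_iff.2 hx
  unfold env
  have h0 : 0 < ‖x‖ ^ ((1 : ℝ) / 2 - n) := Real.rpow_pos_of_pos hr _
  rcases le_total ‖x‖ 1 with h | h
  · have h1 : (‖x‖ ^ k)⁻¹ = ‖x‖ ^ (-(k : ℝ)) := by rw [Real.rpow_neg hr.le, Real.rpow_natCast]
    have h2 : ‖x‖ ^ (-(k : ℝ)) ≤ ‖x‖ ^ ((1 : ℝ) / 2 - n) := by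
      apply Real.rpow_le_rpow_of_exponent_ge hr h
      have : ((k + 1 : ℕ) : ℝ) ≤ n := by exact_mod_cast hk
      push_cast at this
      linarith
    rw [h1]; linarith
  · have : (‖x‖ ^ k)⁻¹ ≤ 1 := inv_le_one_of_one_le₀ (one_le_pow₀ h)
    linarith

lemma sqrt_reg_bounds (hε : 0 < ε) (x : Space n) :
    ‖x‖ ≤ √(ε ^ 2 + ‖x‖ ^ 2) ∧ ε ≤ √(ε ^ 2 + ‖x‖ ^ 2) ∧ √(ε ^ 2 + ‖x‖ ^ 2) ≤ ‖x‖ + ε := by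
  refine ⟨Real.le_sqrt_of_sq_le (by nlinarith), Real.le_sqrt_of_sq_le (by nlinarith [sq_nonneg ‖x‖]),
    Real.sqrt_le_iff.2 ⟨by positivity, by nlinarith [norm_nonneg x]⟩⟩

lemma le_sqrt_self_of_le_one {t : ℝ} (h0 : 0 ≤ t) (h1 : t ≤ 1) : t ≤ √t :=
  Real.le_sqrt_of_sq_le (by nlinarith)

lemma measurable_newton (L : ℝ) : Measurable (newton L : Space n → ℝ) := by
  unfold newton
  split_ifs <;> fun_prop

lemma kerBound_newton (hn : n = 2 ∨ n = 3) {L : ℝ} (hL : 0 < L) :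
    KerBound (newton L : Space n → ℝ) (L + L⁻¹ + 1) where
  meas := measurable_newton L
  nonneg := by positivity
  bound x hx := by
    have hr : 0 < ‖x‖ := norm_pos_iff.2 hx
    have hpi := Real.pi_gt_three
    have he := one_le_env x
    have h1 := inv_pow_le_env x hx (k := 1) (by omega)
    rw [pow_one] at h1
    rcases hn with rfl | rfl
    · simp only [newton, if_true]
      rw [abs_div, abs_of_pos (by positivity : 0 < 2 * Real.pi), div_le_iff₀ (by positivity)]
      -- `log t ≤ t - 1` applied both to `t = |x| / L` and to its inverse.
      have hl : |Real.log (‖x‖ / L)| ≤ ‖x‖ * L⁻¹ + L * ‖x‖⁻¹ := by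
        have hp : 0 < ‖x‖ / L := by positivity
        have h2 := Real.log_le_sub_one_of_pos hp
        have h3 := Real.log_le_sub_one_of_pos (inv_pos.2 hp)
        rw [Real.log_inv, inv_div] at h3
        have h4 : 0 < L / ‖x‖ := by positivity
        rw [← div_eq_mul_inv, ← div_eq_mul_inv]
        rw [abs_le]; constructor <;> linarith
      have h5 : ‖x‖ ≤ env x := by
        unfold env; have := Real.rpow_nonneg hr.le ((1 : ℝ) / 2 - (2 : ℕ)); linarith
      have h6 : ‖x‖ * L⁻¹ + L * ‖x‖⁻¹ ≤ (L + L⁻¹) * env x := by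
        have := mul_le_mul_of_nonneg_right h5 (inv_pos.2 hL).le
        have := mul_le_mul_of_nonneg_left h1 hL.le
        linarith
      have h7 : 0 ≤ (L + L⁻¹ + 1) * env x := by positivity
      nlinarith
    · have e : newton L x = -1 / (4 * Real.pi * ‖x‖) := by simp [newton]
      rw [e, abs_div, abs_neg, abs_one, abs_of_pos (by positivity), one_div, mul_inv]
      have h2 : (4 * Real.pi)⁻¹ ≤ 1 := inv_le_one_of_one_le₀ (by linarith)
      have h3 : 0 < ‖x‖⁻¹ := by positivity
      have h4 : 0 < L + L⁻¹ := by positivity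
      nlinarith

lemma measurable_newtonGrad (i : Fin n) : Measurable (newtonGrad i) := by
  unfold newtonGrad
  fun_prop

lemma kerBound_newtonGrad (i : Fin n) : KerBound (newtonGrad i) 1 where
  meas := measurable_newtonGrad i
  nonneg := zero_le_one
  bound x hx := by
    have hr : 0 < ‖x‖ := norm_pos_iff.2 hx
    have hs := three_lt_sphereArea n
    obtain ⟨k, rfl⟩ : ∃ k, n = k + 1 := ⟨n - 1, by have := i.pos; omega⟩
    have h1 := inv_pow_le_env x hx (k := k) le_rfl
    rw [newtonGrad, abs_div, abs_of_pos (by positivity : 0 < sphereArea (k + 1) * ‖x‖ ^ (k + 1)),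
      div_le_iff₀ (by positivity)]
    calc |x i| ≤ ‖x‖ := abs_coord_le_norm x i
      _ = (‖x‖ ^ k)⁻¹ * ‖x‖ ^ (k + 1) := by rw [pow_succ]; field_simp
      _ ≤ env x * ‖x‖ ^ (k + 1) := by gcongr
      _ ≤ env x * ‖x‖ ^ (k + 1) * sphereArea (k + 1) :=
        le_mul_of_one_le_right (by have := env_pos x; positivity) (by linarith)
      _ = _ := by ring

lemma newtonGrad_neg (i : Fin n) (x : Space n) : newtonGrad i (-x) = -newtonGrad i x := by
  simp [newtonGrad, neg_div]

lemma newton_neg (L : ℝ) (x : Space n) : newton L (-x) = newton L x := by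
  simp [newton]

lemma continuous_regNewton (hn : n = 2 ∨ n = 3) {L : ℝ} (hL : 0 < L) (hε : 0 < ε) :
    Continuous (regNewton L ε : Space n → ℝ) :=
  Differentiable.continuous fun x => (hasFDerivAt_regNewton hn hL hε x).differentiableAt (𝕜 := ℝ)

lemma continuous_regGrad (hn : n = 2 ∨ n = 3) (hε : 0 < ε) (i : Fin n) :
    Continuous (regGrad ε i) :=
  (symbolAlg_spec hε (regGrad_mem hn i)).1.continuous

/-- The error is in fact at most `ε |x|^(1-n)`; the weaker rate `√ε` is recorded so as to agree with
that of the gradient kernels. -/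
lemma kerBound_newton_sub (hn : n = 2 ∨ n = 3) {L : ℝ} (hL : 0 < L) (hε : 0 < ε) (hε1 : ε ≤ 1) :
    KerBound (fun x : Space n => newton L x - regNewton L ε x) (√ε) where
  meas := (measurable_newton L).sub (continuous_regNewton hn hL hε).measurable
  nonneg := Real.sqrt_nonneg _
  bound x hx := by
    have hr : 0 < ‖x‖ := norm_pos_iff.2 hx
    have hpi := Real.pi_gt_three
    obtain ⟨h1, h2, h3⟩ := sqrt_reg_bounds hε x
    have hε' := le_sqrt_self_of_le_one hε.le hε1
    have he := one_le_env x
    rcases hn with rfl | rfl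
    · have h4 := inv_pow_le_env x hx (k := 1) (by omega)
      rw [pow_one] at h4
      have e : newton L x - regNewton L ε x
          = -(Real.log (√(ε ^ 2 + ‖x‖ ^ 2) / ‖x‖) / (2 * Real.pi)) := by
        have a : √(ε ^ 2 + ‖x‖ ^ 2) ≠ 0 := by positivity
        simp only [newton, regNewton, if_true]
        rw [Real.log_div hr.ne' hL.ne', Real.log_div a hL.ne', Real.log_div a hr.ne']
        ring
      have hnn : 0 ≤ Real.log (√(ε ^ 2 + ‖x‖ ^ 2) / ‖x‖) :=
        Real.log_nonneg ((one_le_div hr).2 h1)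
      have hle : Real.log (√(ε ^ 2 + ‖x‖ ^ 2) / ‖x‖) ≤ ε * ‖x‖⁻¹ := by
        refine (Real.log_le_sub_one_of_pos (by positivity)).trans ?_
        rw [div_sub_one hr.ne', div_eq_mul_inv]
        gcongr
        linarith
      rw [e, abs_neg, abs_of_nonneg (by positivity), div_le_iff₀ (by positivity)]
      have h5 : ε * ‖x‖⁻¹ ≤ √ε * env x := by gcongr
      have h6 : 0 ≤ √ε * env x := by positivity
      nlinarith
    · have h4 := inv_pow_le_env x hx (k := 2) (by omega)
      have e : newton L x - regNewton L ε x
          = -((√(ε ^ 2 + ‖x‖ ^ 2) - ‖x‖) / (‖x‖ * √(ε ^ 2 + ‖x‖ ^ 2)) / (4 * Real.pi)) := by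
        have a : √(ε ^ 2 + ‖x‖ ^ 2) ≠ 0 := by positivity
        simp only [newton, regNewton, invReg, show ¬ ((3 : ℕ) = 2) by norm_num, if_false]
        field_simp
        ring
      have hb : (√(ε ^ 2 + ‖x‖ ^ 2) - ‖x‖) / (‖x‖ * √(ε ^ 2 + ‖x‖ ^ 2)) ≤ ε * (‖x‖ ^ 2)⁻¹ := by
        rw [← div_eq_mul_inv]
        exact div_le_div₀ hε.le (by linarith) (by positivity) (by nlinarith)
      have hnn : 0 ≤ (√(ε ^ 2 + ‖x‖ ^ 2) - ‖x‖) / (‖x‖ * √(ε ^ 2 + ‖x‖ ^ 2)) :=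
        div_nonneg (by linarith) (by positivity)
      rw [e, abs_neg, abs_of_nonneg (by positivity), div_le_iff₀ (by positivity)]
      have h5 : ε * (‖x‖ ^ 2)⁻¹ ≤ √ε * env x := by gcongr
      have h6 : 0 ≤ √ε * env x := by positivity
      nlinarith

/-- `s^n - r^n` contains the factor `s - r ≤ ε`, and the cofactor is at most `n s^(n-1)` with `n ≤
3`. Used with `r = |x|` and `s = √(ε² + |x|²)`. -/
lemma inv_pow_sub_inv_pow_le (hn : n = 2 ∨ n = 3) {r s : ℝ} (hr : 0 < r) (hrs : r ≤ s)
    (hsr : s ≤ r + ε) (hε : 0 < ε) :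
    0 ≤ (r ^ n)⁻¹ - (s ^ n)⁻¹ ∧ r * ((r ^ n)⁻¹ - (s ^ n)⁻¹) ≤ 3 * ((r ^ (n - 1))⁻¹ * (ε / s)) := by
  have hs : 0 < s := hr.trans_le hrs
  constructor
  · rw [sub_nonneg]; gcongr
  · have e : r * ((r ^ n)⁻¹ - (s ^ n)⁻¹) = (r ^ (n - 1))⁻¹ * ((s ^ n - r ^ n) / s ^ n) := by
      obtain ⟨k, rfl⟩ : ∃ k, n = k + 1 := ⟨n - 1, by omega⟩
      simp only [Nat.add_sub_cancel]
      field_simp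
      ring
    have h : (s ^ n - r ^ n) / s ^ n ≤ 3 * (ε / s) := by
      rw [div_le_iff₀ (by positivity)]
      have h0 : 0 ≤ s - r := by linarith
      have h1 : s - r ≤ ε := by linarith
      rcases hn with rfl | rfl
      · have : 3 * (ε / s) * s ^ 2 = 3 * ε * s := by field_simp
        rw [this]
        nlinarith
      · have : 3 * (ε / s) * s ^ 3 = 3 * ε * s ^ 2 := by field_simp
        rw [this]
        have : s ^ 3 - r ^ 3 = (s - r) * (s ^ 2 + s * r + r ^ 2) := by ring
        rw [this]
        have : s ^ 2 + s * r + r ^ 2 ≤ 3 * s ^ 2 := by nlinarith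
        calc (s - r) * (s ^ 2 + s * r + r ^ 2) ≤ ε * (3 * s ^ 2) := by gcongr
          _ = _ := by ring
    rw [e]
    calc (r ^ (n - 1))⁻¹ * ((s ^ n - r ^ n) / s ^ n) ≤ (r ^ (n - 1))⁻¹ * (3 * (ε / s)) := by gcongr
      _ = _ := by ring

/-- A full factor `ε` would cost a power of `|x|` and leave the non-integrable `|x|^(-n)`.
Interpolating, `ε / s ≤ √(ε / s) ≤ √(ε / |x|)`, costs half a power only; this is the origin of the
exponent `1/2 - n` in `env` and of the rate `√ε`. -/
lemma kerBound_newtonGrad_sub (hn : n = 2 ∨ n = 3) (hε : 0 < ε) (i : Fin n) :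
    KerBound (fun x : Space n => newtonGrad i x - regGrad ε i x) (√ε) where
  meas := (measurable_newtonGrad i).sub (continuous_regGrad hn hε i).measurable
  nonneg := Real.sqrt_nonneg _
  bound x hx := by
    have hr : 0 < ‖x‖ := norm_pos_iff.2 hx
    have hσ := three_lt_sphereArea n
    obtain ⟨h1, h2, h3⟩ := sqrt_reg_bounds hε x
    set s := √(ε ^ 2 + ‖x‖ ^ 2) with hs
    have hs0 : 0 < s := hr.trans_le h1
    obtain ⟨hd0, hd⟩ := inv_pow_sub_inv_pow_le hn hr h1 h3 hε
    have e : newtonGrad i x - regGrad ε i x = x i * ((‖x‖ ^ n)⁻¹ - (s ^ n)⁻¹) / sphereArea n := by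
      simp only [newtonGrad, regGrad, invReg, ← hs, inv_pow]
      field_simp
    rw [e, abs_div, abs_mul, abs_of_nonneg hd0, abs_of_pos (by linarith : 0 < sphereArea n),
      div_le_iff₀ (by linarith)]
    have h4 : (‖x‖ ^ (n - 1))⁻¹ * (ε / s) ≤ √ε * ‖x‖ ^ ((1 : ℝ) / 2 - n) := by
      have a1 : ε / s ≤ √(ε / s) :=
        le_sqrt_self_of_le_one (by positivity) ((div_le_one hs0).2 h2)
      have a2 : √(ε / s) ≤ √(ε / ‖x‖) := Real.sqrt_le_sqrt (by gcongr)
      have a3 : √(ε / ‖x‖) = √ε * ‖x‖ ^ (-(1 : ℝ) / 2) := by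
        rw [Real.sqrt_div hε.le, div_eq_mul_inv, Real.sqrt_eq_rpow ‖x‖, ← Real.rpow_neg hr.le]
        norm_num
      have a4 : (‖x‖ ^ (n - 1))⁻¹ = ‖x‖ ^ (-((n : ℝ) - 1)) := by
        rw [Real.rpow_neg hr.le, ← Real.rpow_natCast]
        congr 2
        rcases hn with rfl | rfl <;> norm_num
      calc (‖x‖ ^ (n - 1))⁻¹ * (ε / s) ≤ (‖x‖ ^ (n - 1))⁻¹ * (√ε * ‖x‖ ^ (-(1 : ℝ) / 2)) := by
            gcongr
            exact a1.trans (a2.trans a3.le)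
        _ = √ε * (‖x‖ ^ (-((n : ℝ) - 1)) * ‖x‖ ^ (-(1 : ℝ) / 2)) := by rw [a4]; ring
        _ = _ := by
          rw [← Real.rpow_add hr]
          congr 2
          ring
    have h5 : ‖x‖ ^ ((1 : ℝ) / 2 - n) ≤ env x := by unfold env; linarith
    calc |x i| * ((‖x‖ ^ n)⁻¹ - (s ^ n)⁻¹) ≤ ‖x‖ * ((‖x‖ ^ n)⁻¹ - (s ^ n)⁻¹) := by
          gcongr; exact abs_coord_le_norm x i
      _ ≤ 3 * ((‖x‖ ^ (n - 1))⁻¹ * (ε / s)) := hd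
      _ ≤ 3 * (√ε * env x) := by
        have := Real.sqrt_nonneg ε
        have : √ε * ‖x‖ ^ ((1 : ℝ) / 2 - n) ≤ √ε * env x := by gcongr
        linarith
      _ ≤ √ε * env x * sphereArea n := by
        have : 0 ≤ √ε * env x := mul_nonneg (Real.sqrt_nonneg ε) (env_pos x).le
        nlinarith

lemma kerBound_regNewton (hn : n = 2 ∨ n = 3) {L : ℝ} (hL : 0 < L) (hε : 0 < ε) (hε1 : ε ≤ 1) :
    KerBound (regNewton L ε : Space n → ℝ) (L + L⁻¹ + 1 + √ε) := by
  simpa using (kerBound_newton hn hL).sub (kerBound_newton_sub hn hL hε hε1)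

lemma kerBound_regGrad (hn : n = 2 ∨ n = 3) (hε : 0 < ε) (i : Fin n) :
    KerBound (regGrad ε i) (1 + √ε) := by
  simpa using (kerBound_newtonGrad i).sub (kerBound_newtonGrad_sub hn hε i)

end Kernels

/-! ## The Newton kernel is a fundamental solution -/

section Fundamental

variable {n : ℕ} {F : Type*} [NormedAddCommGroup F] [InnerProductSpace ℝ F]
  {C C' M M' L ε : ℝ} {κ : Space n → ℝ} {f : Space n → F}

lemma finrank_mul_volume_ball (hn : n = 2 ∨ n = 3) :
    (n : ℝ) * (volume : Measure (Space n)).real (Metric.ball 0 1) = sphereArea n := by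
  rcases hn with rfl | rfl
  · rw [Measure.real, EuclideanSpace.volume_ball_fin_two]
    simp [sphereArea, Real.pi_pos.le]
  · rw [Measure.real, EuclideanSpace.volume_ball_fin_three]
    have := Real.pi_pos.le
    simp [sphereArea]
    rw [ENNReal.toReal_ofReal (by positivity)]
    ring

/-- The integrand is the derivative of `(r / √(1 + r²))^n`, which increases from `0` to `1`. -/
lemma integral_Ioi_radial (hn : n = 2 ∨ n = 3) :
    IntegrableOn (fun r : ℝ => r ^ (n - 1) * (n * ((√(1 + r ^ 2))⁻¹) ^ (n + 2))) (Ioi 0) ∧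
    ∫ r in Ioi (0 : ℝ), r ^ (n - 1) * (n * ((√(1 + r ^ 2))⁻¹) ^ (n + 2)) = 1 := by
  have hs : ∀ r : ℝ, 0 < √(1 + r ^ 2) := fun r => by positivity
  have hsq : ∀ r : ℝ, √(1 + r ^ 2) ^ 2 = 1 + r ^ 2 := fun r => Real.sq_sqrt (by positivity)
  have hd : ∀ r : ℝ, HasDerivAt (fun r : ℝ => (r * (√(1 + r ^ 2))⁻¹) ^ n)
      (r ^ (n - 1) * (n * ((√(1 + r ^ 2))⁻¹) ^ (n + 2))) r := by
    intro r
    have h1 : HasDerivAt (fun r : ℝ => 1 + r ^ 2) (2 * r) r := by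
      simpa using (hasDerivAt_pow 2 r).const_add 1
    have h2 := h1.sqrt (by positivity)
    have h3 := (hasDerivAt_id r).mul (h2.inv (hs r).ne')
    have h4 := h3.pow n
    convert! h4 using 1
    obtain ⟨k, rfl⟩ : ∃ k, n = k + 1 := ⟨n - 1, by omega⟩
    simp only [id_eq, Pi.mul_apply, Pi.inv_apply, Nat.add_sub_cancel]
    have e : 1 * (√(1 + r ^ 2))⁻¹ + r * (-(2 * r / (2 * √(1 + r ^ 2))) / √(1 + r ^ 2) ^ 2)
        = (√(1 + r ^ 2))⁻¹ ^ 3 := by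
      have := hs r
      have h := hsq r
      field_simp
      nlinarith
    rw [e]
    ring
  have hlim : Tendsto (fun r : ℝ => (r * (√(1 + r ^ 2))⁻¹) ^ n) atTop (𝓝 1) := by
    have h1 : Tendsto (fun r : ℝ => (√((r ^ 2)⁻¹ + 1))⁻¹) atTop (𝓝 1) := by
      have : Tendsto (fun r : ℝ => (r ^ 2)⁻¹ + 1) atTop (𝓝 (0 + 1)) :=
        (tendsto_inv_atTop_zero.comp (tendsto_pow_atTop (by norm_num))).add tendsto_const_nhds
      have h := (this.sqrt).inv₀ (by simp)
      simpa using h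
    have h2 : (fun r : ℝ => r * (√(1 + r ^ 2))⁻¹) =ᶠ[atTop] fun r : ℝ => (√((r ^ 2)⁻¹ + 1))⁻¹ := by
      filter_upwards [eventually_gt_atTop 0] with r hr
      have : √(1 + r ^ 2) = r * √((r ^ 2)⁻¹ + 1) := by
        rw [show (1 + r ^ 2 : ℝ) = r ^ 2 * ((r ^ 2)⁻¹ + 1) by field_simp,
          Real.sqrt_mul (by positivity), Real.sqrt_sq hr.le]
      rw [this, mul_inv, ← mul_assoc, mul_inv_cancel₀ hr.ne', one_mul]
    have := (h1.congr' h2.symm).pow n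
    simpa using this
  have hnn : ∀ r ∈ Ioi (0 : ℝ), 0 ≤ r ^ (n - 1) * (n * ((√(1 + r ^ 2))⁻¹) ^ (n + 2)) :=
    fun r hr => by have : (0 : ℝ) < r := hr; positivity
  have hn0 : n ≠ 0 := by omega
  refine ⟨integrableOn_Ioi_deriv_of_nonneg' (fun r _ => hd r) hnn hlim, ?_⟩
  rw [integral_Ioi_of_hasDerivAt_of_nonneg' (fun r _ => hd r) hnn hlim]
  simp [hn0]

lemma regDelta_one_eq (x : Space n) :
    regDelta 1 x = (fun r : ℝ => n * ((√(1 + r ^ 2))⁻¹) ^ (n + 2)) ‖x‖ / sphereArea n := by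
  simp [regDelta, invReg]

lemma integrable_regDelta_one (hn : n = 2 ∨ n = 3) : Integrable (regDelta 1 : Space n → ℝ) := by
  have : Nonempty (Fin n) := ⟨⟨0, by omega⟩⟩
  have h := (integrable_fun_norm_addHaar (E := Space n) volume
    (f := fun r : ℝ => n * ((√(1 + r ^ 2))⁻¹) ^ (n + 2))).2
    (by simpa using (integral_Ioi_radial hn).1)
  exact (h.div_const (sphereArea n)).congr
    (Eventually.of_forall fun x => (regDelta_one_eq x).symm)

lemma integral_regDelta_one (hn : n = 2 ∨ n = 3) : ∫ x : Space n, regDelta 1 x = 1 := by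
  have : Nonempty (Fin n) := ⟨⟨0, by omega⟩⟩
  have h := integral_fun_norm_addHaar (E := Space n) volume
    (fun r : ℝ => n * ((√(1 + r ^ 2))⁻¹) ^ (n + 2))
  have h2 := (integral_Ioi_radial hn).2
  simp only [finrank_euclideanSpace, Fintype.card_fin, smul_eq_mul] at h
  rw [h2, mul_one, nsmul_eq_mul, finrank_mul_volume_ball hn] at h
  simp only [regDelta_one_eq, integral_div]
  rw [h, div_self (by linarith [three_lt_sphereArea n])]

lemma regDelta_scale (hε : 0 < ε) (z : Space n) :
    ε ^ n * regDelta ε (ε • z) = regDelta 1 z := by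
  have h : invReg ε (ε • z) = ε⁻¹ * invReg 1 z := by
    unfold invReg
    rw [norm_smul, Real.norm_of_nonneg hε.le, ← mul_inv]
    congr 1
    rw [show ε ^ 2 + (ε * ‖z‖) ^ 2 = ε ^ 2 * (1 ^ 2 + ‖z‖ ^ 2) by ring,
      Real.sqrt_mul (by positivity), Real.sqrt_sq hε.le]
  rw [regDelta, regDelta, h, mul_pow, inv_pow]
  field_simp
  ring

lemma pot_regDelta_eq (hε : 0 < ε) (f : Space n → F) (x : Space n) :
    pot (regDelta ε) f x = ∫ z, regDelta 1 z • f (x - ε • z) := by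
  have h := Measure.integral_comp_smul (volume : Measure (Space n))
    (fun y => regDelta ε y • f (x - y)) ε
  rw [pot]
  have e : ∀ z : Space n, regDelta 1 z • f (x - ε • z)
      = ε ^ n • (regDelta ε (ε • z) • f (x - ε • z)) := by
    intro z; rw [← regDelta_scale hε z, smul_smul]
  rw [finrank_euclideanSpace, Fintype.card_fin] at h
  simp only [e]
  rw [integral_smul, h, smul_smul, abs_of_pos (by positivity), mul_inv_cancel₀ (by positivity),
    one_smul]

/-- The functions `regDelta ε` are the dilates of one integrable profile of mass one, hence an
approximate identity. -/
lemma tendsto_pot_regDelta (hn : n = 2 ∨ n = 3) [CompleteSpace F] (hf : DecayBound f M)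
    (x : Space n) : Tendsto (fun ε : ℝ => pot (regDelta ε) f x) (𝓝[>] 0) (𝓝 (f x)) := by
  have h1 : Tendsto (fun ε : ℝ => ∫ z, regDelta 1 z • f (x - ε • z)) (𝓝[>] 0)
      (𝓝 (∫ z : Space n, regDelta 1 z • f x)) := by
    refine tendsto_integral_filter_of_dominated_convergence
      (bound := fun z => ‖regDelta 1 z‖ * M) ?_ ?_ ((integrable_regDelta_one hn).norm.mul_const M) ?_
    · refine Eventually.of_forall fun ε => ?_
      have hc : Continuous fun z : Space n => x - ε • z := by fun_prop
      exact (integrable_regDelta_one hn).aestronglyMeasurable.smul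
        (hf.cont.comp hc).aestronglyMeasurable
    · refine Eventually.of_forall fun ε => Eventually.of_forall fun z => ?_
      rw [norm_smul]
      exact mul_le_mul_of_nonneg_left (hf.bound_const _) (norm_nonneg _)
    · refine Eventually.of_forall fun z => ?_
      refine Tendsto.mono_left ?_ nhdsWithin_le_nhds
      have hc0 : Continuous fun ε : ℝ => x - ε • z := by fun_prop
      have hc : Continuous fun ε : ℝ => regDelta 1 z • f (x - ε • z) :=
        continuous_const.smul (hf.cont.comp hc0)
      have := hc.tendsto 0
      simpa using this
  rw [integral_smul_const, integral_regDelta_one hn, one_smul] at h1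
  refine h1.congr' ?_
  filter_upwards [self_mem_nhdsWithin] with ε hε
  exact (pot_regDelta_eq hε f x).symm

/-- Integration by parts; its sign cancels the one from differentiating `y ↦ f (x - y)`. -/
lemma pot_pd_of_smooth (hn : n = 2 ∨ n = 3) (i : Fin n) (hd : Differentiable ℝ κ)
    (hκ : KerBound κ C) (hκ' : KerBound (pd i κ) C') (hf : DecayBound f M)
    (hfd : Differentiable ℝ f) (hf' : DecayBound (pd i f) M') (x : Space n) :
    pot κ (pd i f) x = pot (pd i κ) f x := by
  have hg : ∀ y, HasFDerivAt (fun y => f (x - y)) (-(fderiv ℝ f (x - y))) y := by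
    intro y
    have := (hfd (x - y)).hasFDerivAt.comp y ((hasFDerivAt_id y).const_sub x)
    convert! this using 1
    ext v
    simp
  have h := integral_bilinear_hasFDerivAt_right_eq_neg_left_of_integrable
    (μ := (volume : Measure (Space n)))
    (f := κ) (f' := fderiv ℝ κ) (g := fun y => f (x - y)) (g' := fun y => -(fderiv ℝ f (x - y)))
    (v := EuclideanSpace.single i (1 : ℝ)) (B := ContinuousLinearMap.lsmul ℝ ℝ)
    (integrable_pot hn hκ' hf x)
    (by simpa using! (integrable_pot hn hκ hf' x).neg)
    (integrable_pot hn hκ hf x) (fun y _ => (hd y).hasFDerivAt) (fun y _ => hg y)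
  simp only [ContinuousLinearMap.lsmul_apply, neg_apply, smul_neg,
    integral_neg, neg_inj] at h
  exact h

lemma eq_zero_of_norm_le_sqrt {a : F} {K : ℝ} (h : ∀ ε : ℝ, 0 < ε → ε ≤ 1 → ‖a‖ ≤ K * √ε) :
    a = 0 := by
  have h1 : Tendsto (fun ε : ℝ => K * √ε) (𝓝[>] 0) (𝓝 0) := by
    refine Tendsto.mono_left ?_ nhdsWithin_le_nhds
    have : Continuous fun ε : ℝ => K * √ε := by fun_prop
    simpa using this.tendsto 0
  have h2 : ‖a‖ ≤ 0 := by
    refine ge_of_tendsto h1 ?_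
    filter_upwards [Ioc_mem_nhdsGT (zero_lt_one (α := ℝ))] with ε hε
    exact h ε hε.1 hε.2
  exact norm_le_zero_iff.1 h2

/-- `N * ∂ᵢ f = ∂ᵢ N * f`. -/
lemma pot_newton_pd (hn : n = 2 ∨ n = 3) (hL : 0 < L) (i : Fin n) (hf : DecayBound f M)
    (hfd : Differentiable ℝ f) (hf' : DecayBound (pd i f) M') (x : Space n) :
    pot (newton L) (pd i f) x = pot (newtonGrad i) f x := by
  rw [← sub_eq_zero]
  refine eq_zero_of_norm_le_sqrt (K := 32 * envMass n * M' * wt x ^ 5 + 32 * envMass n * M * wt x ^ 5)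
    fun ε hε hε1 => ?_
  have h1 := pot_sub_kernel hn (kerBound_newton hn hL) (kerBound_regNewton hn hL hε hε1) hf' x
  have h2 := pot_sub_kernel hn (kerBound_newtonGrad i) (kerBound_regGrad hn hε i) hf x
  -- The identity is exact for the regularized kernels, so the defect for the singular ones is a sum
  -- of two errors of order `√ε`.
  have h3 : pot (regNewton L ε) (pd i f) x = pot (regGrad ε i) f x := by
    rw [← pd_regNewton hn hL hε i]
    exact pot_pd_of_smooth hn i
      (fun x => (hasFDerivAt_regNewton hn hL hε x).differentiableAt)
      (kerBound_regNewton hn hL hε hε1)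
      (by rw [pd_regNewton hn hL hε i]; exact kerBound_regGrad hn hε i) hf hfd hf' x
  have h4 := norm_pot_le hn (kerBound_newton_sub hn hL hε hε1) hf' x
  have h5 := norm_pot_le hn (kerBound_newtonGrad_sub hn hε i) hf x
  have h6 : pot (newton L) (pd i f) x - pot (newtonGrad i) f x
      = pot (fun y => newton L y - regNewton L ε y) (pd i f) x
        - pot (fun y => newtonGrad i y - regGrad ε i y) f x := by
    rw [h1, h2, h3]; abel
  rw [h6]
  refine (norm_sub_le _ _).trans ((add_le_add h4 h5).trans (le_of_eq ?_))
  ring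

lemma differentiable_regGrad (hn : n = 2 ∨ n = 3) (hε : 0 < ε) (i : Fin n) :
    Differentiable ℝ (regGrad ε i) :=
  (symbolAlg_spec hε (regGrad_mem hn i)).1

lemma exists_kerBound_of_mem_symbolAlg (hε : 0 < ε) {g : Space n → ℝ} (hg : g ∈ symbolAlg n ε) :
    ∃ C, KerBound g C := by
  obtain ⟨h1, ⟨C, hC⟩, -⟩ := symbolAlg_spec hε hg
  exact ⟨C, kerBound_of_bounded h1.continuous hC⟩

/-- `∑ᵢ ∂ᵢ N * ∂ᵢ f = f`. -/
lemma sum_pot_newtonGrad_pd [CompleteSpace F] (hn : n = 2 ∨ n = 3) (hf : DecayBound f M)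
    (hfd : Differentiable ℝ f) (hf' : ∀ i, DecayBound (pd i f) M') (x : Space n) :
    ∑ i, pot (newtonGrad i) (pd i f) x = f x := by
  have h1 : ∀ i : Fin n, Tendsto (fun ε : ℝ => pot (regGrad ε i) (pd i f) x) (𝓝[>] 0)
      (𝓝 (pot (newtonGrad i) (pd i f) x)) := by
    intro i
    rw [tendsto_iff_norm_sub_tendsto_zero]
    have h0 : Tendsto (fun ε : ℝ => 32 * envMass n * √ε * M' * wt x ^ 5) (𝓝[>] 0) (𝓝 0) := by
      refine Tendsto.mono_left ?_ nhdsWithin_le_nhds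
      have : Continuous fun ε : ℝ => 32 * envMass n * √ε * M' * wt x ^ 5 := by fun_prop
      simpa using this.tendsto 0
    refine squeeze_zero' (Eventually.of_forall fun _ => norm_nonneg _) ?_ h0
    filter_upwards [self_mem_nhdsWithin] with ε hε
    rw [norm_sub_rev, ← pot_sub_kernel hn (kerBound_newtonGrad i) (kerBound_regGrad hn hε i) (hf' i)]
    exact norm_pot_le hn (kerBound_newtonGrad_sub hn hε i) (hf' i) x
  have h2 := tendsto_finsetSum Finset.univ fun i _ => h1 i
  refine tendsto_nhds_unique h2 ((tendsto_pot_regDelta hn hf x).congr' ?_)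
  filter_upwards [self_mem_nhdsWithin] with ε hε
  -- Moving the derivatives back onto the regularized kernel produces its divergence, which is the
  -- approximate identity `regDelta ε`.
  have h3 : ∀ i, pot (regGrad ε i) (pd i f) x = pot (pd i (regGrad ε i)) f x := by
    intro i
    obtain ⟨C', hC'⟩ := exists_kerBound_of_mem_symbolAlg hε
      ((symbolAlg_spec hε (regGrad_mem hn i)).2.2 i)
    exact pot_pd_of_smooth hn i (differentiable_regGrad hn hε i) (kerBound_regGrad hn hε i) hC' hf
      hfd (hf' i) x
  simp only [h3]
  have h4 : ∀ i ∈ Finset.univ, Integrable fun y => pd i (regGrad ε i) y • f (x - y) := by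
    intro i _
    obtain ⟨C', hC'⟩ := exists_kerBound_of_mem_symbolAlg hε
      ((symbolAlg_spec hε (regGrad_mem hn i)).2.2 i)
    exact integrable_pot hn hC' hf x
  simp only [pot]
  rw [← integral_finsetSum _ h4]
  refine integral_congr_ae (Eventually.of_forall fun y => ?_)
  simp only [← Finset.sum_smul, sum_pd_regGrad hε y]

/-- `N * Δ f = f`. -/
lemma pot_newton_laplacian [CompleteSpace F] (hn : n = 2 ∨ n = 3) (hL : 0 < L)
    (hf : DecayBound f M) (hfd : Differentiable ℝ f) (hf' : ∀ i, DecayBound (pd i f) M')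
    (hfd' : ∀ i, Differentiable ℝ (pd i f)) {M'' : ℝ}
    (hf'' : ∀ i, DecayBound (pd i (pd i f)) M'') (x : Space n) :
    pot (newton L) (fun y => ∑ i, pd i (pd i f) y) x = f x := by
  rw [pot_sum hn (kerBound_newton hn hL) (fun i _ => hf'' i),
    ← sum_pot_newtonGrad_pd hn hf hfd hf' x]
  exact Finset.sum_congr rfl fun i _ => pot_newton_pd hn hL i (hf' i) (hfd' i) (hf'' i) x

end Fundamental

/-! ## Behaviour at infinity -/

section Asymptotics

variable {n : ℕ} {F : Type*} [NormedAddCommGroup F] [InnerProductSpace ℝ F]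
  {C M L : ℝ} {κ : Space n → ℝ} {f u v : Space n → F}

instance : (cocompact (Space n)).IsCountablyGenerated := by
  rw [← Metric.cobounded_eq_cocompact, ← comap_norm_atTop]
  infer_instance

lemma tendsto_zero_of_norm_le_inv {F : Type*} [NormedAddCommGroup F] {g : Space n → F} {K : ℝ}
    (h : ∀ x : Space n, 1 ≤ ‖x‖ → ‖g x‖ ≤ K * ‖x‖⁻¹) : Tendsto g (cocompact (Space n)) (𝓝 0) := by
  have h1 : Tendsto (fun x : Space n => K * ‖x‖⁻¹) (cocompact (Space n)) (𝓝 0) := by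
    have := ((tendsto_inv_atTop_zero (𝕜 := ℝ)).comp
      (tendsto_norm_cocompact_atTop (E := Space n))).const_mul K
    simpa using this
  refine squeeze_zero_norm' ?_ h1
  filter_upwards [(tendsto_norm_cocompact_atTop (E := Space n)).eventually_ge_atTop 1] with x hx
    using h x hx

lemma DecayBound.tendsto (hf : DecayBound f M) : Tendsto f (cocompact (Space n)) (𝓝 0) := by
  refine tendsto_zero_of_norm_le_inv (K := M) fun x hx => ?_
  refine (hf.bound x).trans ?_
  rw [div_eq_mul_inv]
  have h1 : wt x ≤ wt x ^ 5 := le_self_pow₀ (one_le_wt x) (by norm_num)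
  have h2 : ‖x‖ ≤ wt x := by unfold wt; nlinarith
  have := hf.nonneg
  have : 0 < ‖x‖ := by linarith
  gcongr
  linarith

lemma tendsto_sub_const_cocompact (z : Space n) :
    Tendsto (fun x => x - z) (cocompact (Space n)) (cocompact (Space n)) :=
  (Homeomorph.subRight z).isClosedEmbedding.tendsto_cocompact

/-- The kernel is cut at a radius beyond which it is at most `1`. For the inner part the decay of `f
(x - y)` gives the limit at fixed `y` and the integrable singularity the majorant; for the outer
part the kernel tends to `0` and `‖f‖` is the majorant. -/
lemma tendsto_pot_zero (hn : n = 2 ∨ n = 3) (hκ : KerBound κ C) (hf : DecayBound f M)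
    (h0 : Tendsto κ (cocompact (Space n)) (𝓝 0)) :
    Tendsto (pot κ f) (cocompact (Space n)) (𝓝 0) := by
  have hb : ∀ᶠ x in cocompact (Space n), |κ x| ≤ 1 := by
    have := h0.norm
    rw [norm_zero] at this
    filter_upwards [this.eventually (ge_mem_nhds zero_lt_one)] with x hx using hx
  obtain ⟨R, hR⟩ : ∃ R : ℝ, ∀ x : Space n, R < ‖x‖ → |κ x| ≤ 1 := by
    rw [← Metric.cobounded_eq_cocompact, ← comap_norm_atTop, eventually_comap,
      eventually_atTop] at hb
    obtain ⟨R, hR⟩ := hb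
    exact ⟨R, fun x hx => hR _ hx.le x rfl⟩
  set B : Set (Space n) := Metric.closedBall 0 R
  have hBm : MeasurableSet B := Metric.isClosed_closedBall.measurableSet
  have h1 : Tendsto (fun x => ∫ y, (B.indicator κ y) • f (x - y)) (cocompact (Space n)) (𝓝 0) := by
    have : (0 : F) = ∫ y : Space n, (0 : F) := by simp
    rw [this]
    refine tendsto_integral_filter_of_dominated_convergence
      (bound := fun y => C * M * (1 + R ^ 2) ^ 3 * (env y / wt y ^ 3)) ?_ ?_
      ((integrable_env_div_wt hn).const_mul _) ?_
    · exact Eventually.of_forall fun x => (hκ.meas.indicator hBm).aestronglyMeasurable.smul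
        (hf.cont.comp (continuous_const.sub continuous_id)).aestronglyMeasurable
    · refine Eventually.of_forall fun x => ?_
      filter_upwards [ae_ne_zero hn] with y hy
      have a1 := hκ.nonneg
      have a2 := hf.nonneg
      have a3 := wt_pos y
      have a4 := env_pos y
      by_cases hyB : y ∈ B
      · rw [indicator_of_mem hyB, norm_smul, Real.norm_eq_abs]
        have hy' : ‖y‖ ≤ R := by simpa [B] using hyB
        have hw : wt y ^ 3 ≤ (1 + R ^ 2) ^ 3 := by
          have := wt_le_of_norm_le hy'
          gcongr
        have h5 : 1 ≤ (1 + R ^ 2) ^ 3 / wt y ^ 3 := (one_le_div (by positivity)).2 hw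
        calc |κ y| * ‖f (x - y)‖ ≤ (C * env y) * M := by
              gcongr
              · exact hκ.bound y hy
              · exact hf.bound_const _
          _ ≤ (C * env y) * M * ((1 + R ^ 2) ^ 3 / wt y ^ 3) :=
            le_mul_of_one_le_right (by positivity) h5
          _ = _ := by ring
      · rw [indicator_of_notMem hyB, zero_smul, norm_zero]
        positivity
    · refine Eventually.of_forall fun y => ?_
      have := (hf.tendsto.comp (tendsto_sub_const_cocompact y)).const_smul (B.indicator κ y)
      simpa using! this
  have h2 : Tendsto (fun x => ∫ y, (Bᶜ.indicator κ (x - y)) • f y) (cocompact (Space n)) (𝓝 0) := by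
    have : (0 : F) = ∫ y : Space n, (0 : F) := by simp
    rw [this]
    refine tendsto_integral_filter_of_dominated_convergence (bound := fun y => ‖f y‖) ?_ ?_
      (hf.integrable hn).norm ?_
    · exact Eventually.of_forall fun x => (((hκ.meas.indicator hBm.compl).comp
        (measurable_const.sub measurable_id)).aestronglyMeasurable).smul hf.cont.aestronglyMeasurable
    · refine Eventually.of_forall fun x => Eventually.of_forall fun y => ?_
      rw [norm_smul]
      refine mul_le_of_le_one_left (norm_nonneg _) ?_
      by_cases hyB : x - y ∈ B
      · rw [indicator_of_notMem (by simpa using hyB)]; simp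
      · rw [indicator_of_mem (by simpa using hyB), Real.norm_eq_abs]
        exact hR _ (by simpa [B] using hyB)
    · refine Eventually.of_forall fun y => ?_
      have h3 : Tendsto (fun x => Bᶜ.indicator κ (x - y)) (cocompact (Space n)) (𝓝 0) := by
        have h4 : Tendsto (Bᶜ.indicator κ) (cocompact (Space n)) (𝓝 0) := by
          refine squeeze_zero_norm (fun x => ?_) (tendsto_zero_iff_norm_tendsto_zero.1 h0)
          exact norm_indicator_le_norm_self _ _
        exact h4.comp (tendsto_sub_const_cocompact y)
      simpa using h3.smul_const (f y)
  have h3 := h1.add h2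
  rw [add_zero] at h3
  refine h3.congr fun x => ?_
  have i1 : KerBound (B.indicator κ) C := ⟨hκ.meas.indicator hBm, hκ.nonneg, fun x hx =>
    (norm_indicator_le_norm_self κ x).trans (hκ.bound x hx)⟩
  have i2 : KerBound (Bᶜ.indicator κ) C := ⟨hκ.meas.indicator hBm.compl, hκ.nonneg, fun x hx =>
    (norm_indicator_le_norm_self κ x).trans (hκ.bound x hx)⟩
  rw [pot_eq_integral_sub, ← integral_sub_left_eq_self (fun y => B.indicator κ y • f (x - y)) volume x]
  simp only [sub_sub_cancel]
  rw [← integral_add (integrable_pot' hn i1 hf x) (integrable_pot' hn i2 hf x)]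
  congr 1
  ext y
  rw [← add_smul, indicator_self_add_compl_apply]

lemma tendsto_newtonGrad (hn : n = 2 ∨ n = 3) (i : Fin n) :
    Tendsto (newtonGrad i) (cocompact (Space n)) (𝓝 0) := by
  refine tendsto_zero_of_norm_le_inv (K := 1) fun x hx => ?_
  have hσ := three_lt_sphereArea n
  have hr : 0 < ‖x‖ := by linarith
  rw [newtonGrad, Real.norm_eq_abs, abs_div,
    abs_of_pos (by positivity : 0 < sphereArea n * ‖x‖ ^ n), div_le_iff₀ (by positivity)]
  calc |x i| ≤ ‖x‖ := abs_coord_le_norm x i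
    _ = ‖x‖⁻¹ * ‖x‖ ^ 2 := by field_simp
    _ ≤ ‖x‖⁻¹ * ‖x‖ ^ n := by
      gcongr
      omega
    _ ≤ ‖x‖⁻¹ * ‖x‖ ^ n * sphereArea n := le_mul_of_one_le_right (by positivity) (by linarith)
    _ = _ := by ring

lemma regNewton_one_eq (hL : 0 < L) (x : Space 2) :
    regNewton L 1 x = (Real.log (wt x) / 2 - Real.log L) / (2 * Real.pi) := by
  have h : (1 : ℝ) ^ 2 + ‖x‖ ^ 2 = wt x := by simp [wt]
  have hw := wt_pos x
  simp only [regNewton, if_true]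
  rw [h, Real.log_div (by positivity) hL.ne', Real.log_sqrt hw.le]

/-- In the plane the logarithmic asymptotics are computed with the regularization `ε = 1`, which is
continuous and a function of `log wt`; this transfers them to the singular kernel. -/
lemma tendsto_newton_sub_regNewton (hL : 0 < L) :
    Tendsto (fun x : Space 2 => newton L x - regNewton L 1 x) (cocompact (Space 2)) (𝓝 0) := by
  refine tendsto_zero_of_norm_le_inv (K := 1) fun x hx => ?_
  have hr : 0 < ‖x‖ := by linarith
  have hpi := Real.pi_gt_three
  obtain ⟨h1, h2, h3⟩ := sqrt_reg_bounds one_pos x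
  have e : newton L x - regNewton L 1 x
      = -(Real.log (√(1 ^ 2 + ‖x‖ ^ 2) / ‖x‖) / (2 * Real.pi)) := by
    have a : √(1 ^ 2 + ‖x‖ ^ 2) ≠ 0 := by positivity
    simp only [newton, regNewton, if_true]
    rw [Real.log_div hr.ne' hL.ne', Real.log_div a hL.ne', Real.log_div a hr.ne']
    ring
  have hnn : 0 ≤ Real.log (√(1 ^ 2 + ‖x‖ ^ 2) / ‖x‖) :=
    Real.log_nonneg ((one_le_div hr).2 h1)
  have hle : Real.log (√(1 ^ 2 + ‖x‖ ^ 2) / ‖x‖) ≤ 1 * ‖x‖⁻¹ := by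
    refine (Real.log_le_sub_one_of_pos (by positivity)).trans ?_
    rw [div_sub_one hr.ne', div_eq_mul_inv]
    gcongr
    linarith
  rw [e, norm_neg, Real.norm_of_nonneg (by positivity), div_le_iff₀ (by positivity)]
  have : 0 < ‖x‖⁻¹ := by positivity
  nlinarith

/-- Both bounds come from `log t ≤ t - 1` for the two quotients of the weights. The first is uniform
in `x` and serves as a majorant; the second tends to `0` as `x → ∞` for fixed `y`. -/
lemma abs_log_wt_sub_le (x y : Space n) :
    |Real.log (wt (x - y)) - Real.log (wt x)| ≤ 2 * wt y ∧
    |Real.log (wt (x - y)) - Real.log (wt x)|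
      ≤ (2 * wt y * (2 * ‖y‖ + ‖y‖ ^ 2)) * ((‖x‖ + 1) / wt x) := by
  have a1 := wt_pos x
  have a2 := wt_pos y
  have a3 := wt_pos (x - y)
  have b1 : wt (x - y) ≤ 2 * wt y * wt x := by simpa using wt_le_mul x (x - y)
  have b2 : wt x ≤ 2 * wt y * wt (x - y) := by
    have := wt_le_mul y x
    rw [← wt_neg (y - x), neg_sub] at this
    linarith
  have l1 : Real.log (wt (x - y)) - Real.log (wt x) ≤ wt (x - y) / wt x - 1 := by
    rw [← Real.log_div a3.ne' a1.ne']
    exact Real.log_le_sub_one_of_pos (by positivity)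
  have l2 : Real.log (wt x) - Real.log (wt (x - y)) ≤ wt x / wt (x - y) - 1 := by
    rw [← Real.log_div a1.ne' a3.ne']
    exact Real.log_le_sub_one_of_pos (by positivity)
  have c1 : wt (x - y) / wt x ≤ 2 * wt y := (div_le_iff₀ a1).2 b1
  have c2 : wt x / wt (x - y) ≤ 2 * wt y := (div_le_iff₀ a3).2 b2
  refine ⟨abs_le.2 ⟨by linarith, by linarith⟩, ?_⟩
  have hx := norm_nonneg x
  have hy := norm_nonneg y
  have n1 : ‖x - y‖ ≤ ‖x‖ + ‖y‖ := norm_sub_le x y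
  have n2 : ‖x‖ ≤ ‖x - y‖ + ‖y‖ := by
    have := norm_add_le (x - y) y; simpa using this
  have n3 := norm_nonneg (x - y)
  have d1 : wt (x - y) - wt x ≤ (2 * ‖y‖ + ‖y‖ ^ 2) * (‖x‖ + 1) := by
    unfold wt; nlinarith [mul_nonneg (sq_nonneg ‖y‖) hx]
  have d2 : wt x - wt (x - y) ≤ (2 * ‖y‖ + ‖y‖ ^ 2) * (‖x‖ + 1) := by
    have : ‖x‖ ^ 2 - ‖x - y‖ ^ 2 ≤ 2 * ‖x‖ * ‖y‖ := by
      rcases le_total ‖x‖ ‖y‖ with h | h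
      · nlinarith [sq_nonneg ‖x - y‖]
      · have : (‖x‖ - ‖y‖) ^ 2 ≤ ‖x - y‖ ^ 2 := by
          apply pow_le_pow_left₀ (by linarith); linarith
        nlinarith
    unfold wt; nlinarith [mul_nonneg (sq_nonneg ‖y‖) hx]
  set D := (2 * ‖y‖ + ‖y‖ ^ 2) * (‖x‖ + 1) with hD
  have hD0 : 0 ≤ D := by positivity
  have e1 : wt (x - y) / wt x - 1 ≤ 2 * wt y * (D / wt x) := by
    rw [div_sub_one a1.ne']
    have : (wt (x - y) - wt x) / wt x ≤ D / wt x := by gcongr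
    have h2 : 0 ≤ D / wt x := by positivity
    have := one_le_wt y
    nlinarith
  have e2 : wt x / wt (x - y) - 1 ≤ 2 * wt y * (D / wt x) := by
    rw [div_sub_one a3.ne']
    have h1 : (wt x - wt (x - y)) / wt (x - y) ≤ D / wt (x - y) := by gcongr
    have h2 : D / wt (x - y) ≤ 2 * wt y * (D / wt x) := by
      rw [div_le_iff₀ a3]
      have : 2 * wt y * (D / wt x) * wt (x - y) = D * (2 * wt y * wt (x - y) / wt x) := by ring
      rw [this]
      exact le_mul_of_one_le_right hD0 ((one_le_div a1).2 b2)
    linarith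
  have : 2 * wt y * (2 * ‖y‖ + ‖y‖ ^ 2) * ((‖x‖ + 1) / wt x) = 2 * wt y * (D / wt x) := by
    rw [hD]; ring
  rw [this]
  exact abs_le.2 ⟨by linarith, by linarith⟩

lemma DecayBound.integrable_wt_mul (hn : n = 2 ∨ n = 3) (hf : DecayBound f M) :
    Integrable fun x => wt x * ‖f x‖ := by
  refine Integrable.mono' ((integrable_inv_wt_sq hn).const_mul M)
    (continuous_wt.mul hf.cont.norm).aestronglyMeasurable (Eventually.of_forall fun x => ?_)
  have a1 := wt_pos x
  rw [Real.norm_of_nonneg (by positivity)]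
  have h1 := hf.bound x
  have := hf.nonneg
  have h2 : wt x ^ 3 ≤ wt x ^ 5 := pow_le_pow_right₀ (one_le_wt x) (by norm_num)
  calc wt x * ‖f x‖ ≤ wt x * (M / wt x ^ 5) := by gcongr
    _ ≤ wt x * (M / wt x ^ 3) := by gcongr
    _ = _ := by field_simp

/-- Far away the potential sees only the total charge: `N₁(x - y) - N₁(x)`, with `N₁` the kernel at
`ε = 1`, tends to `0` for each `y` and is at most `2 wt y`. -/
lemma tendsto_pot_regNewton_sub (hL : 0 < L) {f : Space 2 → F} (hf : DecayBound f M) :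
    Tendsto (fun x => pot (regNewton L 1) f x - regNewton L 1 x • ∫ y, f y)
      (cocompact (Space 2)) (𝓝 0) := by
  have hn : (2 : ℕ) = 2 ∨ (2 : ℕ) = 3 := Or.inl rfl
  have hpi := Real.pi_gt_three
  have hdiff : ∀ x y : Space 2, |regNewton L 1 (x - y) - regNewton L 1 x|
      ≤ |Real.log (wt (x - y)) - Real.log (wt x)| := by
    intro x y
    rw [regNewton_one_eq hL, regNewton_one_eq hL, ← sub_div, abs_div,
      abs_of_pos (by positivity : 0 < 2 * Real.pi), div_le_iff₀ (by positivity)]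
    rw [show Real.log (wt (x - y)) / 2 - Real.log L - (Real.log (wt x) / 2 - Real.log L)
      = (Real.log (wt (x - y)) - Real.log (wt x)) / 2 by ring, abs_div, abs_of_pos (two_pos (α := ℝ))]
    nlinarith [abs_nonneg (Real.log (wt (x - y)) - Real.log (wt x))]
  have hk := kerBound_regNewton hn hL one_pos le_rfl
  have e : ∀ x, pot (regNewton L 1) f x - regNewton L 1 x • ∫ y, f y
      = ∫ y, (regNewton L 1 (x - y) - regNewton L 1 x) • f y := by
    intro x
    simp only [sub_smul]
    have hi : Integrable fun y => regNewton L 1 x • f y := (hf.integrable hn).smul _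
    rw [integral_sub (integrable_pot' hn hk hf x) hi, integral_smul,
      pot_eq_integral_sub]
  simp only [e]
  have : (0 : F) = ∫ y : Space 2, (0 : F) := by simp
  rw [this]
  refine tendsto_integral_filter_of_dominated_convergence (bound := fun y => 2 * (wt y * ‖f y‖))
    ?_ ?_ ((hf.integrable_wt_mul hn).const_mul 2) ?_
  · refine Eventually.of_forall fun x => ?_
    have hc : Continuous fun y : Space 2 => regNewton L 1 (x - y) - regNewton L 1 x :=
      ((continuous_regNewton hn hL one_pos).comp (continuous_const.sub continuous_id)).sub
        continuous_const
    exact (hc.smul hf.cont).aestronglyMeasurable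
  · refine Eventually.of_forall fun x => Eventually.of_forall fun y => ?_
    rw [norm_smul, Real.norm_eq_abs, ← mul_assoc]
    gcongr
    exact (hdiff x y).trans (abs_log_wt_sub_le x y).1
  · refine Eventually.of_forall fun y => ?_
    have h1 : Tendsto (fun x : Space 2 => regNewton L 1 (x - y) - regNewton L 1 x)
        (cocompact (Space 2)) (𝓝 0) := by
      refine tendsto_zero_of_norm_le_inv (K := 2 * wt y * (2 * ‖y‖ + ‖y‖ ^ 2) * 2) fun x hx => ?_
      refine (hdiff x y).trans ((abs_log_wt_sub_le x y).2.trans ?_)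
      have a2 := wt_pos y
      rw [mul_assoc (2 * wt y * (2 * ‖y‖ + ‖y‖ ^ 2)) 2]
      gcongr
      have hr : 0 < ‖x‖ := by linarith
      rw [div_le_iff₀ (wt_pos x)]
      have : 2 * ‖x‖⁻¹ * wt x = 2 * (‖x‖⁻¹ + ‖x‖) := by unfold wt; field_simp
      rw [this]
      have : 0 < ‖x‖⁻¹ := by positivity
      linarith
    simpa using h1.smul_const (f y)

lemma GreenAsymptotics.add (hu : GreenAsymptotics L u) (hv : GreenAsymptotics L v) :
    GreenAsymptotics L (fun x => u x + v x) := by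
  unfold GreenAsymptotics at *
  split_ifs at * with h
  · obtain ⟨c, hc⟩ := hu
    obtain ⟨c', hc'⟩ := hv
    refine ⟨c + c', ?_⟩
    have := hc.add hc'
    rw [add_zero] at this
    refine this.congr fun x => ?_
    module
  · simpa using hu.add hv

lemma GreenAsymptotics.neg (hu : GreenAsymptotics L u) : GreenAsymptotics L (fun x => -u x) := by
  unfold GreenAsymptotics at *
  split_ifs at * with h
  · obtain ⟨c, hc⟩ := hu
    refine ⟨-c, ?_⟩
    have := hc.neg
    rw [neg_zero] at this
    refine this.congr fun x => ?_
    module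
  · simpa using hu.neg

lemma GreenAsymptotics.of_tendsto_zero (hu : Tendsto u (cocompact (Space n)) (𝓝 0)) :
    GreenAsymptotics L u := by
  unfold GreenAsymptotics
  split_ifs with h
  · exact ⟨0, by simpa using hu⟩
  · exact hu

lemma greenAsymptotics_pot_newton (hn : n = 2 ∨ n = 3) (hL : 0 < L) (hf : DecayBound f M) :
    GreenAsymptotics L (pot (newton L) f) := by
  rcases hn with rfl | rfl
  · have hn : (2 : ℕ) = 2 ∨ (2 : ℕ) = 3 := Or.inl rfl
    -- The coefficient of the logarithm is the total charge divided by `2π`.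
    refine (if_pos rfl).mpr ⟨(2 * Real.pi)⁻¹ • ∫ y, f y, ?_⟩
    have h1 := tendsto_pot_zero hn (kerBound_newton_sub hn hL one_pos le_rfl) hf
      (tendsto_newton_sub_regNewton hL)
    have h2 := tendsto_pot_regNewton_sub hL hf
    have h3 := ((tendsto_newton_sub_regNewton hL).smul_const (∫ y, f y)).neg
    have h4 := (h1.add h2).add h3
    simp only [zero_smul, neg_zero, add_zero] at h4
    refine h4.congr fun x => ?_
    have e : newton L x • ∫ y, f y = Real.log (‖x‖ / L) • (2 * Real.pi)⁻¹ • ∫ y, f y := by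
      rw [smul_smul, newton, if_pos rfl, div_eq_mul_inv]
    rw [pot_sub_kernel hn (kerBound_newton hn hL) (kerBound_regNewton hn hL one_pos le_rfl) hf,
      sub_smul, e]
    abel
  · have hn : (3 : ℕ) = 2 ∨ (3 : ℕ) = 3 := Or.inr rfl
    refine GreenAsymptotics.of_tendsto_zero
      (tendsto_pot_zero hn (kerBound_newton hn hL) hf ?_)
    refine tendsto_zero_of_norm_le_inv (K := 1) fun x hx => ?_
    have hr : 0 < ‖x‖ := by linarith
    have hpi := Real.pi_gt_three
    have e : newton L x = -1 / (4 * Real.pi * ‖x‖) := by simp [newton]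
    rw [e, Real.norm_eq_abs, abs_div, abs_neg, abs_one, abs_of_pos (by positivity), one_div, mul_inv]
    gcongr
    exact inv_le_one_of_one_le₀ (by linarith)

lemma greenAsymptotics_pot_newtonGrad (hn : n = 2 ∨ n = 3) (i : Fin n) (hf : DecayBound f M) :
    GreenAsymptotics L (pot (newtonGrad i) f) :=
  GreenAsymptotics.of_tendsto_zero
    (tendsto_pot_zero hn (kerBound_newtonGrad i) hf (tendsto_newtonGrad hn i))

lemma tendsto_log_norm_div (hL : 0 < L) :
    Tendsto (fun x : Space n => ‖x‖⁻¹ * Real.log (‖x‖ / L)) (cocompact (Space n)) (𝓝 0) := by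
  have h1 : Tendsto (fun r : ℝ => r⁻¹ * Real.log (r / L)) atTop (𝓝 0) := by
    have h2 : Tendsto (fun r : ℝ => r⁻¹ * Real.log r - r⁻¹ * Real.log L) atTop (𝓝 (0 - 0 * Real.log L)) := by
      refine Tendsto.sub ?_ (tendsto_inv_atTop_zero.mul_const _)
      have := Real.isLittleO_log_id_atTop.tendsto_div_nhds_zero
      refine this.congr fun r => ?_
      simp [div_eq_mul_inv, mul_comm]
    rw [zero_mul, sub_zero] at h2
    refine h2.congr' ?_
    filter_upwards [eventually_gt_atTop 0] with r hr
    rw [Real.log_div hr.ne' hL.ne']; ring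
  exact h1.comp tendsto_norm_cocompact_atTop

/-- In both dimensions the behaviour at infinity is `o(|x|)`, the growth condition of the Liouville
theorem. -/
lemma GreenAsymptotics.tendsto_inv_norm_smul (hL : 0 < L) (hu : GreenAsymptotics L u) :
    Tendsto (fun x => ‖x‖⁻¹ • u x) (cocompact (Space n)) (𝓝 0) := by
  have hi : Tendsto (fun x : Space n => ‖x‖⁻¹) (cocompact (Space n)) (𝓝 0) :=
    tendsto_inv_atTop_zero.comp tendsto_norm_cocompact_atTop
  unfold GreenAsymptotics at hu
  split_ifs at hu with h
  · obtain ⟨c, hc⟩ := hu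
    have h1 := (hi.smul hc).add ((tendsto_log_norm_div (n := n) hL).smul_const c)
    simp only [smul_zero, zero_smul, add_zero] at h1
    refine h1.congr fun x => ?_
    rw [smul_sub, smul_smul]; abel
  · simpa using hi.smul hu

lemma exists_norm_le_wt_of_tendsto (hc : Continuous u)
    (hu : Tendsto (fun x => ‖x‖⁻¹ • u x) (cocompact (Space n)) (𝓝 0)) :
    ∃ K, ∀ x, ‖u x‖ ≤ K * wt x := by
  have hb : ∀ᶠ x in cocompact (Space n), ‖‖x‖⁻¹ • u x‖ ≤ 1 := by
    have := hu.norm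
    rw [norm_zero] at this
    exact this.eventually (ge_mem_nhds zero_lt_one)
  rw [← Metric.cobounded_eq_cocompact, ← comap_norm_atTop, eventually_comap, eventually_atTop] at hb
  obtain ⟨R, hR⟩ := hb
  obtain ⟨K, hK⟩ := (isCompact_closedBall (0 : Space n) (max R 1)).exists_bound_of_continuousOn
    hc.continuousOn
  refine ⟨max K 1, fun x => ?_⟩
  have hw := one_le_wt x
  have hm : 1 ≤ max K 1 := le_max_right _ _
  by_cases hx : ‖x‖ ≤ max R 1
  · have h1 := hK x (by simpa using hx)
    have : K ≤ max K 1 := le_max_left _ _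
    nlinarith
  · push Not at hx
    have h1 := hR ‖x‖ ((le_max_left _ _).trans hx.le) x rfl
    have h2 : 0 < ‖x‖ := lt_of_lt_of_le one_pos ((le_max_right R 1).trans hx.le)
    rw [norm_smul, norm_inv, norm_norm, inv_mul_le_iff₀ h2, mul_one] at h1
    have h3 : ‖x‖ ≤ wt x := by unfold wt; nlinarith [sq_nonneg (‖x‖ - 1)]
    nlinarith

/-- In the plane, division by the logarithm first forces the coefficient `c` to vanish, and then the
constant itself tends to `0`. Together with Liouville this removes the remaining harmonic ambiguity.
-/
lemma GreenAsymptotics.eq_zero_of_const (hn : n = 2 ∨ n = 3) {q : F}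
    (h : GreenAsymptotics L (fun _ : Space n => q)) (hL : 0 < L) : q = 0 := by
  have : Nonempty (Fin n) := ⟨⟨0, by omega⟩⟩
  have : (cocompact (Space n)).NeBot := inferInstance
  unfold GreenAsymptotics at h
  split_ifs at h with h2
  · obtain ⟨c, hc⟩ := h
    have hl : Tendsto (fun x : Space n => Real.log (‖x‖ / L)) (cocompact (Space n)) atTop :=
      Real.tendsto_log_atTop.comp (tendsto_norm_cocompact_atTop.atTop_div_const hL)
    have hi := hl.inv_tendsto_atTop
    have h1 := hi.smul hc
    have h3 : Tendsto (fun x : Space n => (Real.log (‖x‖ / L))⁻¹ • q - c) (cocompact (Space n))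
        (𝓝 0) := by
      rw [smul_zero] at h1
      refine h1.congr' ?_
      filter_upwards [hl.eventually_gt_atTop 0] with x hx
      simp only [Pi.inv_apply]
      rw [smul_sub, smul_smul, inv_mul_cancel₀ hx.ne', one_smul]
    have h4 : Tendsto (fun x : Space n => (Real.log (‖x‖ / L))⁻¹ • q - c) (cocompact (Space n))
        (𝓝 (0 - c)) := by
      have := (hi.smul_const q).sub_const c
      simpa using! this
    have h5 := tendsto_nhds_unique h3 h4
    have hc0 : c = 0 := by simpa using h5.symm
    subst hc0
    simp only [smul_zero, sub_zero] at hc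
    exact tendsto_nhds_unique tendsto_const_nhds hc
  · exact tendsto_nhds_unique tendsto_const_nhds h

end Asymptotics

/-! ## The Liouville theorem for weakly harmonic functions -/

section Liouville

variable {n : ℕ} {F : Type*} [NormedAddCommGroup F] [InnerProductSpace ℝ F]

/-- `q` is annihilated by the Laplacian in the sense of distributions. -/
def WeaklyHarmonic (q : Space n → F) : Prop :=
  ∀ η : Space n → ℝ, ContDiff ℝ ∞ η → HasCompactSupport η →
    ∫ y, (∑ i, pd i (pd i η) y) • q y = 0

/-- A test function `ζ` is wanted whose gradient is radial with a bump `ψ` as profile; then the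
Laplacian of its dilates is a dilation derivative of `ψ`, and weak harmonicity becomes constancy of
the `ψ`-means. -/
lemma exists_radial_primitive (n : ℕ) : ∃ ζ ψ : Space n → ℝ, ContDiff ℝ ∞ ζ ∧ HasCompactSupport ζ ∧
    ContDiff ℝ ∞ ψ ∧ HasCompactSupport ψ ∧ (∀ w, 0 ≤ ψ w) ∧ ψ 0 = 1 ∧
    ∀ w, HasFDerivAt ζ ((2 * ψ w) • innerSL ℝ w) w := by
  set b : ℝ → ℝ := fun s => Real.smoothTransition (1 - s) with hb
  have hbs : ContDiff ℝ ∞ b := Real.smoothTransition.contDiff.comp (contDiff_const.sub contDiff_id)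
  have hb0 : ∀ s, 1 ≤ s → b s = 0 := fun s hs =>
    Real.smoothTransition.zero_of_nonpos (by linarith)
  -- The base point `1` makes the primitive vanish for `s ≥ 1`, hence `ζ` compactly supported.
  set h : ℝ → ℝ := fun s => ∫ t in (1 : ℝ)..s, b t with hh
  have hd : ∀ s, HasDerivAt h (b s) s := fun s =>
    (hbs.continuous.integral_hasStrictDerivAt 1 s).hasDerivAt
  have hhs : ContDiff ℝ ∞ h := by
    rw [contDiff_infty_iff_deriv]
    refine ⟨fun s => (hd s).differentiableAt, ?_⟩
    have : deriv h = b := funext fun s => (hd s).deriv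
    rw [this]; exact hbs
  have hh0 : ∀ s, 1 ≤ s → h s = 0 := by
    intro s hs
    rw [hh]
    simp only
    rw [intervalIntegral.integral_congr (g := fun _ => (0 : ℝ))]
    · simp
    · intro t ht
      rw [uIcc_of_le hs] at ht
      exact hb0 t ht.1
  have hsq : ContDiff ℝ ∞ fun w : Space n => ‖w‖ ^ 2 := contDiff_norm_sq ℝ
  have hsupp : ∀ g : ℝ → ℝ, (∀ s, 1 ≤ s → g s = 0) →
      HasCompactSupport fun w : Space n => g (‖w‖ ^ 2) := by
    intro g hg
    refine HasCompactSupport.of_support_subset_isCompact (isCompact_closedBall (0 : Space n) 1)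
      fun w hw => ?_
    by_contra hc
    rw [Metric.mem_closedBall, dist_zero_right, not_le] at hc
    exact hw (hg _ (by nlinarith))
  refine ⟨fun w => h (‖w‖ ^ 2), fun w => b (‖w‖ ^ 2), hhs.comp hsq, hsupp h hh0, hbs.comp hsq,
    hsupp b hb0, fun w => Real.smoothTransition.nonneg _, by simp [hb], fun w => ?_⟩
  have := (hd (‖w‖ ^ 2)).comp_hasFDerivAt w (hasStrictFDerivAt_norm_sq w).hasFDerivAt
  convert! this using 1
  ext v
  simp
  ring

lemma HasFDerivAt.comp_scale {g : Space n → F} {g' : Space n →L[ℝ] F} {lam : ℝ} {x y : Space n}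
    (h : HasFDerivAt g g' (lam • (y - x))) :
    HasFDerivAt (fun y => g (lam • (y - x))) (lam • g') y := by
  have h1 : HasFDerivAt (fun y : Space n => lam • (y - x)) (lam • ContinuousLinearMap.id ℝ (Space n)) y :=
    ((hasFDerivAt_id y).sub_const x).const_smul lam
  have := h.comp y h1
  convert! this using 1
  ext v
  simp

lemma clm_eq_sum_coord (l : Space n →L[ℝ] ℝ) (v : Space n) :
    l v = ∑ i, v i * l (EuclideanSpace.single i 1) := by
  conv_lhs => rw [← (EuclideanSpace.basisFun (Fin n) ℝ).sum_repr v]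
  rw [map_sum]
  refine Finset.sum_congr rfl fun i _ => ?_
  rw [map_smul]
  simp

/-- For `λ > 0` the right-hand side is `2 λ^(3-n) ∂_λ (λ^n ψ(λ(y - x)))`. -/
lemma laplacian_scaled_primitive {ζ ψ : Space n → ℝ} (hψ : ContDiff ℝ ∞ ψ)
    (hζ : ∀ w, HasFDerivAt ζ ((2 * ψ w) • innerSL ℝ w) w) (lam : ℝ) (x y : Space n) :
    ∑ i, pd i (pd i fun y => ζ (lam • (y - x))) y
      = 2 * lam ^ 2 * (n * ψ (lam • (y - x)) + lam * fderiv ℝ ψ (lam • (y - x)) (y - x)) := by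
  have hψd : Differentiable ℝ ψ := hψ.differentiable (by simp)
  have h1 : ∀ i, pd i (fun y => ζ (lam • (y - x)))
      = fun y => 2 * lam ^ 2 * ((y - x) i * ψ (lam • (y - x))) := by
    intro i
    ext y
    rw [pd, (hζ _).comp_scale.fderiv]
    simp [EuclideanSpace.inner_single_right]
    ring
  have h2 : ∀ i, pd i (pd i fun y => ζ (lam • (y - x))) y
      = 2 * lam ^ 2 * (ψ (lam • (y - x))
        + (y - x) i * (lam * fderiv ℝ ψ (lam • (y - x)) (EuclideanSpace.single i 1))) := by
    intro i
    rw [h1 i]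
    have e1 : HasFDerivAt (fun y : Space n => (y - x) i)
        (EuclideanSpace.proj i : Space n →L[ℝ] ℝ) y := by
      have := (hasFDerivAt_coord i (y - x)).comp y ((hasFDerivAt_id y).sub_const x)
      convert! this using 1
    have e2 : HasFDerivAt (fun y => ψ (lam • (y - x))) (lam • fderiv ℝ ψ (lam • (y - x))) y :=
      (hψd _).hasFDerivAt.comp_scale
    have e3 := (e1.mul e2).const_mul (2 * lam ^ 2)
    rw [pd, HasFDerivAt.fderiv (by convert! e3 using 1)]
    simp
    ring
  simp only [h2, ← Finset.mul_sum, Finset.sum_add_distrib]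
  congr 1
  have h3 : fderiv ℝ ψ (lam • (y - x)) (y - x)
      = ∑ i, (y - x) i * fderiv ℝ ψ (lam • (y - x)) (EuclideanSpace.single i 1) := by
    exact clm_eq_sum_coord _ _
  rw [h3, Finset.mul_sum]
  simp
  exact Finset.sum_congr rfl fun i _ => by ring

lemma hasDerivAt_scaled_mean {q : Space n → F} (hq : Continuous q) {ψ : Space n → ℝ}
    (hψ : ContDiff ℝ ∞ ψ) (hψc : HasCompactSupport ψ) (x : Space n) {lam : ℝ} (hlam : 0 < lam) :
    HasDerivAt (fun lam : ℝ => ∫ y, (lam ^ n * ψ (lam • (y - x))) • q y)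
      (∫ y, (n * lam ^ (n - 1) * ψ (lam • (y - x))
        + lam ^ n * fderiv ℝ ψ (lam • (y - x)) (y - x)) • q y) lam := by
  have hψd : Differentiable ℝ ψ := hψ.differentiable (by simp)
  have hψ' : Continuous (fderiv ℝ ψ) := hψ.continuous_fderiv (by simp)
  obtain ⟨R, hR⟩ := hψc.isCompact.isBounded.subset_closedBall (0 : Space n)
  have hz : ∀ w : Space n, R < ‖w‖ → ψ w = 0 ∧ fderiv ℝ ψ w = 0 := by
    intro w hw
    have h1 : w ∉ tsupport ψ := fun h => by
      have := hR h
      rw [Metric.mem_closedBall, dist_zero_right] at this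
      linarith
    exact ⟨image_eq_zero_of_notMem_tsupport h1,
      image_eq_zero_of_notMem_tsupport fun h => h1 (tsupport_fderiv_subset ℝ h)⟩
  set G : ℝ → Space n → F := fun t y => (n * t ^ (n - 1) * ψ (t • (y - x))
    + t ^ n * fderiv ℝ ψ (t • (y - x)) (y - x)) • q y with hG
  have hGc : Continuous (Function.uncurry G) := by
    have e1 : Continuous fun p : ℝ × Space n => p.1 • (p.2 - x) := by fun_prop
    have e2 : Continuous fun p : ℝ × Space n => fderiv ℝ ψ (p.1 • (p.2 - x)) (p.2 - x) :=
      (hψ'.comp e1).clm_apply (by fun_prop)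
    have e3 : Continuous fun p : ℝ × Space n => ψ (p.1 • (p.2 - x)) := hψ.continuous.comp e1
    have e4 : Continuous fun p : ℝ × Space n => q p.2 := hq.comp continuous_snd
    simp only [hG, Function.uncurry_def]
    fun_prop
  -- For all `t > λ/2` the integrands are supported in this one ball, since outside it `|t (y - x)|
  -- > R`.
  set K : Set (Space n) := Metric.closedBall x (2 * R / lam) with hK
  have hKc : IsCompact K := isCompact_closedBall _ _
  have hout : ∀ t ∈ Metric.ball lam (lam / 2), ∀ y ∉ K, R < ‖t • (y - x)‖ := by
    intro t ht y hy
    rw [Metric.mem_ball, Real.dist_eq, abs_lt] at ht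
    rw [hK, Metric.mem_closedBall, not_le, dist_eq_norm, div_lt_iff₀ hlam] at hy
    have h2 : lam / 2 < t := by linarith
    rw [norm_smul, Real.norm_of_nonneg (by linarith)]
    have := norm_nonneg (y - x)
    nlinarith
  obtain ⟨B, hB⟩ := ((isCompact_closedBall lam (lam / 2)).prod hKc).exists_bound_of_continuousOn
    hGc.continuousOn
  have hmeas : ∀ t : ℝ, Continuous fun y => (t ^ n * ψ (t • (y - x))) • q y := by
    intro t
    have e3 : Continuous fun y : Space n => ψ (t • (y - x)) :=
      hψ.continuous.comp (by fun_prop)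
    fun_prop
  have hlamball : lam ∈ Metric.ball lam (lam / 2) := Metric.mem_ball_self (by linarith)
  refine (hasDerivAt_integral_of_dominated_loc_of_deriv_le (𝕜 := ℝ)
    (F := fun t y => (t ^ n * ψ (t • (y - x))) • q y) (F' := G)
    (bound := K.indicator fun _ => B)
    (Metric.ball_mem_nhds lam (half_pos hlam)) ?_ ?_ ?_ ?_ ?_ ?_).2
  · exact Eventually.of_forall fun t => (hmeas t).aestronglyMeasurable
  · refine (hmeas lam).integrable_of_hasCompactSupport
      (HasCompactSupport.of_support_subset_isCompact hKc fun y hy => ?_)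
    by_contra hc
    exact hy (by simp [(hz _ (hout lam hlamball y hc)).1])
  · exact (hGc.comp (Continuous.prodMk_right lam)).aestronglyMeasurable
  · refine Eventually.of_forall fun y t ht => ?_
    by_cases hy : y ∈ K
    · rw [indicator_of_mem hy]
      exact hB (t, y) ⟨Metric.ball_subset_closedBall ht, hy⟩
    · rw [indicator_of_notMem hy, hG]
      simp [(hz _ (hout t ht y hy)).1, (hz _ (hout t ht y hy)).2]
  · exact (integrable_indicator_iff hKc.measurableSet).2
      (integrableOn_const (hs := hKc.measure_lt_top.ne))
  · refine Eventually.of_forall fun y t ht => ?_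
    have h1 : HasDerivAt (fun t : ℝ => t • (y - x)) (y - x) t := by
      simpa using (hasDerivAt_id t).smul_const (y - x)
    have h2 := (hψd (t • (y - x))).hasFDerivAt.comp_hasDerivAt t h1
    exact ((hasDerivAt_pow n t).mul h2).smul_const (q y)

lemma scaled_mean_eq {q : Space n → F} {ψ : Space n → ℝ} (x : Space n) {lam : ℝ} (hlam : 0 < lam) :
    ∫ y, (lam ^ n * ψ (lam • (y - x))) • q y = ∫ z, ψ z • q (x + lam⁻¹ • z) := by
  have h1 := integral_sub_right_eq_self (μ := (volume : Measure (Space n)))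
    (fun z => (lam ^ n * ψ (lam • z)) • q (x + z)) x
  have h2 := Measure.integral_comp_smul (volume : Measure (Space n))
    (fun z => ψ z • q (x + lam⁻¹ • z)) lam
  rw [finrank_euclideanSpace, Fintype.card_fin, abs_of_pos (by positivity)] at h2
  simp only [add_sub_cancel] at h1
  rw [h1]
  simp only [smul_smul, inv_mul_cancel₀ hlam.ne', one_smul] at h2
  simp only [mul_smul]
  rw [integral_smul, h2, smul_smul, mul_inv_cancel₀ (by positivity), one_smul]

/-- A continuous weakly harmonic function which is `o(|x|)` at infinity is constant. -/
theorem WeaklyHarmonic.eq_const [CompleteSpace F] (hn : n = 2 ∨ n = 3) {q : Space n → F}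
    (hw : WeaklyHarmonic q) (hq : Continuous q)
    (hinf : Tendsto (fun x => ‖x‖⁻¹ • q x) (cocompact (Space n)) (𝓝 0)) (x : Space n) :
    q x = q 0 := by
  have hne : Nonempty (Fin n) := ⟨⟨0, by omega⟩⟩
  obtain ⟨ζ, ψ, hζs, hζc, hψs, hψc, hψ0, hψ1, hζ⟩ := exists_radial_primitive n
  have hm : 0 < ∫ w, ψ w :=
    hψs.continuous.integral_pos_of_hasCompactSupport_nonneg_nonzero hψc hψ0 (x := 0) (by simp [hψ1])
  have hψi : Integrable ψ := hψs.continuous.integrable_of_hasCompactSupport hψc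
  set Φ : Space n → ℝ → F := fun x lam => ∫ y, (lam ^ n * ψ (lam • (y - x))) • q y with hΦ
  -- The derivative in the scale is `q` tested against a multiple of the Laplacian of a dilate of
  -- `ζ`, so it vanishes.
  have hder : ∀ x, ∀ lam : ℝ, 0 < lam → HasDerivAt (Φ x) 0 lam := by
    intro x lam hlam
    have h1 := hasDerivAt_scaled_mean hq hψs hψc x hlam
    convert! h1 using 1
    have hηs : ContDiff ℝ ∞ fun y => ζ (lam • (y - x)) := hζs.comp (by fun_prop)
    have hηc : HasCompactSupport fun y => ζ (lam • (y - x)) := by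
      have := (Homeomorph.subRight x).trans (Homeomorph.smulOfNeZero lam hlam.ne')
      exact hζc.comp_homeomorph ((Homeomorph.subRight x).trans (Homeomorph.smulOfNeZero lam hlam.ne'))
    have h2 := hw _ hηs hηc
    simp only [laplacian_scaled_primitive hψs hζ] at h2
    have h3 : ∀ y : Space n, (n * lam ^ (n - 1) * ψ (lam • (y - x))
        + lam ^ n * fderiv ℝ ψ (lam • (y - x)) (y - x)) • q y
        = (lam ^ (n - 1) / (2 * lam ^ 2)) • ((2 * lam ^ 2 * (n * ψ (lam • (y - x))
          + lam * fderiv ℝ ψ (lam • (y - x)) (y - x))) • q y) := by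
      intro y
      rw [smul_smul]
      congr 1
      obtain ⟨k, rfl⟩ : ∃ k, n = k + 1 := ⟨n - 1, by omega⟩
      simp only [Nat.add_sub_cancel]
      field_simp
      ring
    simp only [h3]
    rw [integral_smul, h2, smul_zero]
  have hconst : ∀ x, ∀ lam : ℝ, 0 < lam → Φ x lam = Φ x 1 := by
    intro x lam hlam
    exact (convex_Ioi (0 : ℝ)).is_const_of_fderivWithin_eq_zero (𝕜 := ℝ)
      (fun t ht => (hder x t ht).differentiableAt.differentiableWithinAt)
      (fun t ht => by
        rw [fderivWithin_of_isOpen isOpen_Ioi ht, ← toSpanSingleton_deriv, (hder x t ht).deriv]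
        simp) hlam (mem_Ioi.2 one_pos)
  -- As `λ → ∞` the mean concentrates at `x`.
  have hval : ∀ x, Φ x 1 = (∫ w, ψ w) • q x := by
    intro x
    have h1 : Tendsto (fun lam : ℝ => ∫ z, ψ z • q (x + lam⁻¹ • z)) atTop (𝓝 (∫ z, ψ z • q x)) := by
      obtain ⟨R, hR⟩ := hψc.isCompact.isBounded.subset_closedBall (0 : Space n)
      obtain ⟨B, hB⟩ := (isCompact_closedBall x (max R 0)).exists_bound_of_continuousOn
        hq.continuousOn
      refine tendsto_integral_filter_of_dominated_convergence (bound := fun z => ψ z * B) ?_ ?_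
        (hψi.mul_const B) ?_
      · refine Eventually.of_forall fun lam => ?_
        have : Continuous fun z : Space n => x + lam⁻¹ • z := by fun_prop
        exact (hψs.continuous.smul (hq.comp this)).aestronglyMeasurable
      · filter_upwards [eventually_ge_atTop 1] with lam hlam
        refine Eventually.of_forall fun z => ?_
        rw [norm_smul, Real.norm_of_nonneg (hψ0 z)]
        by_cases hz : z ∈ tsupport ψ
        · refine mul_le_mul_of_nonneg_left (hB _ ?_) (hψ0 z)
          have := hR hz
          rw [Metric.mem_closedBall, dist_zero_right] at this
          rw [Metric.mem_closedBall, dist_eq_norm, add_sub_cancel_left, norm_smul,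
            Real.norm_of_nonneg (by positivity)]
          have h3 : lam⁻¹ ≤ 1 := inv_le_one_of_one_le₀ hlam
          have h4 := norm_nonneg z
          have h5 := le_max_left R 0
          nlinarith
        · rw [image_eq_zero_of_notMem_tsupport hz]; simp
      · refine Eventually.of_forall fun z => ?_
        have h2 : Tendsto (fun lam : ℝ => x + lam⁻¹ • z) atTop (𝓝 x) := by
          have := (tendsto_inv_atTop_zero (𝕜 := ℝ)).smul_const z
          simpa using this.const_add x
        exact ((hq.tendsto x).comp h2).const_smul (ψ z)
    rw [integral_smul_const] at h1
    refine tendsto_nhds_unique (tendsto_const_nhds.congr' ?_) h1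
    filter_upwards [eventually_gt_atTop 0] with lam hlam
    rw [← hconst x lam hlam, hΦ]
    exact scaled_mean_eq x hlam
  obtain ⟨K, hK⟩ := exists_norm_le_wt_of_tendsto hq hinf
  -- A global linear bound makes `λ q(w / λ)` bounded for `λ ≤ 1` and `w` in a ball, which provides
  -- the majorant for the limit `λ → 0`.
  obtain ⟨K1, hK1⟩ : ∃ K1, ∀ z, ‖q z‖ ≤ K1 * (1 + ‖z‖) := by
    have hb : ∀ᶠ x in cocompact (Space n), ‖‖x‖⁻¹ • q x‖ ≤ 1 := by
      have := hinf.norm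
      rw [norm_zero] at this
      exact this.eventually (ge_mem_nhds zero_lt_one)
    rw [← Metric.cobounded_eq_cocompact, ← comap_norm_atTop, eventually_comap,
      eventually_atTop] at hb
    obtain ⟨R, hR⟩ := hb
    refine ⟨max (|K| * (1 + (max R 1) ^ 2)) 1, fun z => ?_⟩
    have hz := norm_nonneg z
    have hm1 := le_max_left (|K| * (1 + (max R 1) ^ 2)) 1
    have hm2 := le_max_right (|K| * (1 + (max R 1) ^ 2)) 1
    by_cases h : ‖z‖ ≤ max R 1
    · have h1 := wt_le_of_norm_le h
      have h2 : ‖q z‖ ≤ |K| * (1 + (max R 1) ^ 2) := by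
        refine (hK z).trans ?_
        have := wt_pos z
        have := le_abs_self K
        gcongr
      nlinarith
    · push Not at h
      have h1 := hR ‖z‖ ((le_max_left _ _).trans h.le) z rfl
      have h2 : 0 < ‖z‖ := lt_of_lt_of_le one_pos ((le_max_right R 1).trans h.le)
      rw [norm_smul, norm_inv, norm_norm, inv_mul_le_iff₀ h2, mul_one] at h1
      nlinarith
  obtain ⟨Lip, hLip⟩ := ContDiff.lipschitzWith_of_hasCompactSupport hψc
    (hψs.of_le (by exact_mod_cast le_top : (1 : WithTop ℕ∞) ≤ ∞)) one_ne_zero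
  have hdiff : ∀ lam : ℝ, 0 < lam →
      Φ x lam - Φ 0 lam = ∫ w, (ψ (w - lam • x) - ψ w) • q (lam⁻¹ • w) := by
    intro lam hlam
    have e1 : Φ x lam = ∫ w, ψ (w - lam • x) • q (lam⁻¹ • w) := by
      rw [hΦ]
      simp only
      rw [scaled_mean_eq x hlam, ← integral_sub_right_eq_self _ (lam • x)]
      congr 1
      ext w
      rw [smul_sub, smul_smul, inv_mul_cancel₀ hlam.ne', one_smul]
      simp
    have e2 : Φ 0 lam = ∫ w, ψ w • q (lam⁻¹ • w) := by
      rw [hΦ]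
      simp only
      rw [scaled_mean_eq 0 hlam]
      simp
    have c0 : Continuous fun w => q (lam⁻¹ • w) := hq.comp (by fun_prop)
    have i1 : Integrable fun w => ψ (w - lam • x) • q (lam⁻¹ • w) := by
      refine Continuous.integrable_of_hasCompactSupport
        ((hψs.continuous.comp (by fun_prop)).smul c0) ?_
      exact (hψc.comp_homeomorph (Homeomorph.subRight (lam • x))).smul_right
    have i2 : Integrable fun w => ψ w • q (lam⁻¹ • w) :=
      Continuous.integrable_of_hasCompactSupport (hψs.continuous.smul c0) hψc.smul_right
    rw [e1, e2, ← integral_sub i1 i2]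
    simp only [sub_smul]
  obtain ⟨R, hR⟩ := hψc.isCompact.isBounded.subset_closedBall (0 : Space n)
  have hz : ∀ w : Space n, R < ‖w‖ → ψ w = 0 := fun w hw =>
    image_eq_zero_of_notMem_tsupport fun h => by
      have := hR h
      rw [Metric.mem_closedBall, dist_zero_right] at this
      linarith
  set K : Set (Space n) := Metric.closedBall 0 (R + ‖x‖)
  -- At large scale the means about `x` and about `0` agree: the Lipschitz bound for `ψ` yields a
  -- factor `λ`, and `λ q(w / λ) → 0` because `q` is `o(|x|)`.
  have hlim : Tendsto (fun lam : ℝ => ∫ w, (ψ (w - lam • x) - ψ w) • q (lam⁻¹ • w)) (𝓝[>] 0)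
      (𝓝 0) := by
    have h0 : (0 : F) = ∫ w : Space n, (0 : F) := by simp
    rw [h0]
    have hpt : ∀ lam : ℝ, 0 < lam → ∀ w : Space n, ‖(ψ (w - lam • x) - ψ w) • q (lam⁻¹ • w)‖
        ≤ Lip * ‖x‖ * ‖lam • q (lam⁻¹ • w)‖ := by
      intro lam hlam w
      have h1 := hLip.dist_le_mul (w - lam • x) w
      rw [dist_eq_norm, dist_eq_norm, sub_sub_cancel_left, norm_neg, norm_smul,
        Real.norm_of_nonneg hlam.le] at h1
      rw [norm_smul, norm_smul, Real.norm_of_nonneg hlam.le]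
      calc _ ≤ (Lip * (lam * ‖x‖)) * ‖q (lam⁻¹ • w)‖ := by gcongr
        _ = _ := by ring
    refine tendsto_integral_filter_of_dominated_convergence
      (bound := K.indicator fun _ => Lip * ‖x‖ * (K1 * (1 + (R + ‖x‖)))) ?_ ?_ ?_ ?_
    · refine Eventually.of_forall fun lam => ?_
      have c0 : Continuous fun w => q (lam⁻¹ • w) := hq.comp (by fun_prop)
      have c1 : Continuous fun w => ψ (w - lam • x) := hψs.continuous.comp (by fun_prop)
      exact ((c1.sub hψs.continuous).smul c0).aestronglyMeasurable
    · filter_upwards [Ioc_mem_nhdsGT (zero_lt_one (α := ℝ))] with lam hlam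
      obtain ⟨hlam, hlam1⟩ := hlam
      refine Eventually.of_forall fun w => ?_
      by_cases hwK : w ∈ K
      · rw [indicator_of_mem hwK]
        refine (hpt lam hlam w).trans ?_
        have hwn : ‖w‖ ≤ R + ‖x‖ := by simpa [K] using hwK
        have hK10 : 0 ≤ K1 := by
          have := (norm_nonneg _).trans (hK1 0)
          simpa using this
        have : ‖lam • q (lam⁻¹ • w)‖ ≤ K1 * (1 + (R + ‖x‖)) := by
          rw [norm_smul, Real.norm_of_nonneg hlam.le]
          have h1 := hK1 (lam⁻¹ • w)
          rw [norm_smul, norm_inv, Real.norm_of_nonneg hlam.le] at h1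
          calc lam * ‖q (lam⁻¹ • w)‖ ≤ lam * (K1 * (1 + lam⁻¹ * ‖w‖)) := by gcongr
            _ = K1 * (lam + ‖w‖) := by field_simp
            _ ≤ _ := by gcongr
        gcongr
      · rw [indicator_of_notMem hwK]
        have hwn : R + ‖x‖ < ‖w‖ := by simpa [K] using hwK
        have h1 : ψ w = 0 := hz w (by linarith [norm_nonneg x])
        have h2 : ψ (w - lam • x) = 0 := by
          refine hz _ ?_
          have h3 := norm_sub_norm_le w (lam • x)
          rw [norm_smul, Real.norm_of_nonneg hlam.le] at h3
          have := norm_nonneg x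
          nlinarith
        simp [h1, h2]
    · exact (integrable_indicator_iff (isCompact_closedBall _ _).measurableSet).2
        (integrableOn_const (hs := (isCompact_closedBall _ _).measure_lt_top.ne))
    · filter_upwards [ae_ne_zero hn] with w hw0
      have h1 : Tendsto (fun lam : ℝ => lam⁻¹ • w) (𝓝[>] 0) (cocompact (Space n)) := by
        rw [← Metric.cobounded_eq_cocompact, ← comap_norm_atTop, tendsto_comap_iff]
        have : Tendsto (fun lam : ℝ => lam⁻¹ * ‖w‖) (𝓝[>] 0) atTop :=
          tendsto_inv_nhdsGT_zero.atTop_mul_const (norm_pos_iff.2 hw0)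
        refine this.congr' ?_
        filter_upwards [self_mem_nhdsWithin] with lam hlam
        have : (0 : ℝ) < lam := hlam
        simp [norm_smul, abs_of_pos this]
      have h2 := ((hinf.comp h1).norm).const_mul (Lip * ‖x‖ * ‖w‖)
      rw [norm_zero, mul_zero] at h2
      refine squeeze_zero_norm' ?_ h2
      filter_upwards [self_mem_nhdsWithin] with lam hlam
      have hlam' : (0 : ℝ) < lam := hlam
      refine (hpt lam hlam' w).trans (le_of_eq ?_)
      have := norm_pos_iff.2 hw0
      have e : ‖lam⁻¹ • w‖ = lam⁻¹ * ‖w‖ := by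
        rw [norm_smul, norm_inv, Real.norm_of_nonneg hlam'.le]
      simp only [Function.comp, e]
      rw [norm_smul, norm_smul, norm_inv, Real.norm_of_nonneg hlam'.le,
        Real.norm_of_nonneg (by positivity)]
      field_simp
  have h1 : Tendsto (fun lam : ℝ => Φ x lam - Φ 0 lam) (𝓝[>] 0) (𝓝 0) := by
    refine hlim.congr' ?_
    filter_upwards [self_mem_nhdsWithin] with lam hlam
    exact (hdiff lam hlam).symm
  have h2 : Tendsto (fun lam : ℝ => Φ x lam - Φ 0 lam) (𝓝[>] 0) (𝓝 (Φ x 1 - Φ 0 1)) := by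
    refine tendsto_const_nhds.congr' ?_
    filter_upwards [self_mem_nhdsWithin] with lam hlam
    rw [hconst x lam hlam, hconst 0 lam hlam]
  have h3 := tendsto_nhds_unique h2 h1
  rw [hval, hval, ← smul_sub, smul_eq_zero] at h3
  rcases h3 with h3 | h3
  · exact absurd h3 hm.ne'
  · exact sub_eq_zero.1 h3

end Liouville

/-! ## Weighted potential operators on bounded continuous functions -/

section PotOp

open BoundedContinuousFunction

variable {n : ℕ} {F : Type*} [NormedAddCommGroup F] [NormedSpace ℝ F] {κ κ' : Space n → ℝ}
  {C C' : ℝ}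

lemma decayBound_inv_wt_smul (g : Space n →ᵇ F) :
    DecayBound (fun y => (wt y ^ 5)⁻¹ • g y) ‖g‖ where
  cont := ((continuous_wt.pow 5).inv₀ fun x => (pow_pos (wt_pos x) 5).ne').smul g.continuous
  bound x := by
    have h := wt_pos x
    rw [norm_smul, norm_inv, Real.norm_of_nonneg (by positivity), inv_mul_eq_div]
    have := g.norm_coe_le_norm x
    gcongr

/-- The potential grows like `wt⁵` and is divided by `wt⁶`. The surplus power makes the images of a
bounded set vanish uniformly at infinity, the noncompact half of the compactness argument. -/
lemma norm_weighted_pot_le (hn : n = 2 ∨ n = 3) (hκ : KerBound κ C) (g : Space n →ᵇ F)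
    (x : Space n) : ‖(wt x ^ 6)⁻¹ • pot κ (fun y => (wt y ^ 5)⁻¹ • g y) x‖
      ≤ 32 * envMass n * C * ‖g‖ / wt x := by
  have h := wt_pos x
  rw [norm_smul, norm_inv, Real.norm_of_nonneg (by positivity), inv_mul_le_iff₀ (by positivity)]
  refine (norm_pot_le hn hκ (decayBound_inv_wt_smul g) x).trans (le_of_eq ?_)
  field_simp

lemma norm_weighted_pot_le' (hn : n = 2 ∨ n = 3) (hκ : KerBound κ C) (g : Space n →ᵇ F)
    (x : Space n) : ‖(wt x ^ 6)⁻¹ • pot κ (fun y => (wt y ^ 5)⁻¹ • g y) x‖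
      ≤ 32 * envMass n * C * ‖g‖ := by
  refine (norm_weighted_pot_le hn hκ g x).trans (div_le_self ?_ (one_le_wt x))
  have := envMass_nonneg (n := n)
  have := hκ.nonneg
  positivity

/-- The operator `g ↦ wt⁻⁶ (κ * (wt⁻⁵ g))`. -/
def potOp (hn : n = 2 ∨ n = 3) (hκ : KerBound κ C) : (Space n →ᵇ F) →L[ℝ] (Space n →ᵇ F) :=
  LinearMap.mkContinuous
    { toFun := fun g => ofNormedAddCommGroup
        (fun x => (wt x ^ 6)⁻¹ • pot κ (fun y => (wt y ^ 5)⁻¹ • g y) x)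
        (((continuous_wt.pow 6).inv₀ fun x => (pow_pos (wt_pos x) 6).ne').smul
          (continuous_pot hn hκ (decayBound_inv_wt_smul g)))
        (32 * envMass n * C * ‖g‖) (norm_weighted_pot_le' hn hκ g)
      map_add' := fun g g' => by
        ext x
        simp only [coe_ofNormedAddCommGroup, coe_add, Pi.add_apply, smul_add]
        rw [pot_add hn hκ (decayBound_inv_wt_smul g) (decayBound_inv_wt_smul g'), smul_add]
      map_smul' := fun c g => by
        ext x
        simp only [coe_ofNormedAddCommGroup, coe_smul, RingHom.id_apply]
        simp only [smul_comm _ c, pot_const_smul] }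
    (32 * envMass n * C) fun g => norm_ofNormedAddCommGroup_le _ (by
      have := envMass_nonneg (n := n)
      have := hκ.nonneg
      positivity) (norm_weighted_pot_le' hn hκ g)

lemma potOp_apply (hn : n = 2 ∨ n = 3) (hκ : KerBound κ C) (g : Space n →ᵇ F) (x : Space n) :
    potOp hn hκ g x = (wt x ^ 6)⁻¹ • pot κ (fun y => (wt y ^ 5)⁻¹ • g y) x := rfl

lemma norm_potOp_le (hn : n = 2 ∨ n = 3) (hκ : KerBound κ C) :
    ‖(potOp hn hκ : (Space n →ᵇ F) →L[ℝ] (Space n →ᵇ F))‖ ≤ 32 * envMass n * C :=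
  LinearMap.mkContinuous_norm_le _ (by
    have := envMass_nonneg (n := n)
    have := hκ.nonneg
    positivity) _

lemma potOp_sub (hn : n = 2 ∨ n = 3) (hκ : KerBound κ C) (hκ' : KerBound κ' C') {C'' : ℝ}
    (h : KerBound (fun x => κ x - κ' x) C'') :
    (potOp hn hκ - potOp hn hκ' : (Space n →ᵇ F) →L[ℝ] (Space n →ᵇ F)) = potOp hn h := by
  ext g x
  simp only [_root_.sub_apply, coe_sub, Pi.sub_apply, potOp_apply]
  rw [pot_sub_kernel hn hκ hκ' (decayBound_inv_wt_smul g), smul_sub]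

/-- The radial retraction onto the ball of radius `R`. -/
def ballRetract (R : ℝ) (x : Space n) : Space n := (max 1 (‖x‖ / R))⁻¹ • x

lemma continuous_ballRetract (R : ℝ) : Continuous (ballRetract R : Space n → Space n) := by
  unfold ballRetract
  have h : Continuous fun x : Space n => max 1 (‖x‖ / R) := by fun_prop
  refine (h.inv₀ fun x => ?_).smul continuous_id
  exact (lt_of_lt_of_le one_pos (le_max_left _ _)).ne'

lemma ballRetract_mem {R : ℝ} (hR : 0 < R) (x : Space n) :
    ballRetract R x ∈ Metric.closedBall (0 : Space n) R := by
  have h : 0 < max 1 (‖x‖ / R) := lt_of_lt_of_le one_pos (le_max_left _ _)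
  rw [mem_closedBall_zero_iff, ballRetract, norm_smul, norm_inv, Real.norm_of_nonneg h.le,
    inv_mul_le_iff₀ h]
  calc ‖x‖ = (‖x‖ / R) * R := by field_simp
    _ ≤ _ := by gcongr; exact le_max_right _ _

lemma ballRetract_eq {R : ℝ} (hR : 0 < R) {x : Space n} (hx : ‖x‖ ≤ R) : ballRetract R x = x := by
  rw [ballRetract, max_eq_left ((div_le_one hR).2 hx)]
  simp

lemma norm_ballRetract {R : ℝ} (hR : 0 < R) {x : Space n} (hx : R ≤ ‖x‖) :
    ‖ballRetract R x‖ = R := by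
  have h1 : 0 < ‖x‖ := hR.trans_le hx
  rw [ballRetract, max_eq_right ((one_le_div hR).2 hx), norm_smul, norm_inv,
    Real.norm_of_nonneg (by positivity)]
  field_simp

lemma lipschitz_pot (hn : n = 2 ∨ n = 3) (hκ : KerBound κ C) {K : NNReal} (hK : LipschitzWith K κ)
    {f : Space n → F} {M : ℝ} (hf : DecayBound f M) (x y : Space n) :
    ‖pot κ f x - pot κ f y‖ ≤ K * ‖x - y‖ * (M * ∫ z : Space n, 1 / wt z ^ 2) := by
  rw [pot_eq_integral_sub, pot_eq_integral_sub,
    ← integral_sub (integrable_pot' hn hκ hf x) (integrable_pot' hn hκ hf y), ← integral_const_mul,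
    ← integral_const_mul]
  refine norm_integral_le_of_norm_le (((integrable_inv_wt_sq hn).const_mul M).const_mul _)
    (Eventually.of_forall fun z => ?_)
  rw [← sub_smul, norm_smul]
  have h1 := hK.dist_le_mul (x - z) (y - z)
  rw [dist_eq_norm, dist_eq_norm, sub_sub_sub_cancel_right] at h1
  have h2 : ‖f z‖ ≤ M * (1 / wt z ^ 2) := by
    refine (hf.bound z).trans ?_
    rw [mul_one_div]
    have := one_le_wt z
    have := hf.nonneg
    have : wt z ^ 2 ≤ wt z ^ 5 := pow_le_pow_right₀ ‹_› (by norm_num)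
    have := wt_pos z
    gcongr
  gcongr

/-- A Lipschitz kernel gives equicontinuous images, so Arzelà–Ascoli applies on every closed ball.
Composition with the retraction onto a ball makes this an operator on the whole space, and uniform
decay yields norm convergence as the radius grows. -/
lemma isCompactOperator_potOp_of_lipschitz [FiniteDimensional ℝ F] (hn : n = 2 ∨ n = 3)
    (hκ : KerBound κ C) {K : NNReal} (hK : LipschitzWith K κ) :
    IsCompactOperator (potOp hn hκ : (Space n →ᵇ F) →L[ℝ] (Space n →ᵇ F)) := by
  set G : (Space n →ᵇ F) →L[ℝ] (Space n →ᵇ F) := potOp hn hκ with hG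
  have hJ := envMass_nonneg (n := n)
  have hC := hκ.nonneg
  set P : ℝ → (Space n →ᵇ F) →L[ℝ] (Space n →ᵇ F) := fun R =>
    compContinuousCLM F ℝ ⟨ballRetract R, continuous_ballRetract R⟩
  have hPG : ∀ R : ℝ, 0 < R → IsCompactOperator (P R ∘L G) := by
    intro R hR
    set i : C(Metric.closedBall (0 : Space n) R, Space n) := ⟨Subtype.val, continuous_subtype_val⟩
    set r : C(Space n, Metric.closedBall (0 : Space n) R) :=
      ⟨fun x => ⟨ballRetract R x, ballRetract_mem hR x⟩, (continuous_ballRetract R).subtype_mk _⟩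
    -- The truncated operator factors through continuous functions on a compact ball.
    have hfac : P R ∘L G = (compContinuousCLM F ℝ r) ∘L (compContinuousCLM F ℝ i ∘L G) := by
      ext g x
      rfl
    rw [hfac]
    have : CompactSpace (Metric.closedBall (0 : Space n) R) :=
      isCompact_iff_compactSpace.1 (isCompact_closedBall _ _)
    have hc : IsCompactOperator (compContinuousCLM F ℝ i ∘L G) := by
      refine (isCompactOperator_iff_isCompact_closure_image_closedBall
        (compContinuousCLM F ℝ i ∘L G).toLinearMap one_pos).2 ?_
      refine arzela_ascoli (Metric.closedBall (0 : F) (32 * envMass n * C))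
        (isCompact_closedBall _ _) _ ?_ ?_
      · rintro _ x ⟨g, hg, rfl⟩
        rw [mem_closedBall_zero_iff] at hg ⊢
        refine (norm_weighted_pot_le' hn hκ g x).trans ?_
        exact mul_le_of_le_one_right (by positivity) hg
      · intro x₀
        set J := ∫ z : Space n, 1 / wt z ^ 2
        have hJ0 : 0 ≤ J := integral_nonneg fun z => by
          have := wt_pos z
          positivity
        set a : Metric.closedBall (0 : Space n) R → ℝ := fun x => (wt (x : Space n) ^ 6)⁻¹ with ha
        have hac : Continuous a := ((continuous_wt.comp continuous_subtype_val).pow 6).inv₀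
          fun x => (pow_pos (wt_pos _) 6).ne'
        set D := 32 * envMass n * C * (1 + R ^ 2) ^ 5
        refine Metric.equicontinuousAt_of_continuity_modulus
          (fun x : Metric.closedBall (0 : Space n) R => K * ‖(x₀ : Space n) - x‖ * J + |a x₀ - a x| * D) ?_ _ ?_
        · have : Continuous fun x : Metric.closedBall (0 : Space n) R =>
              K * ‖(x₀ : Space n) - x‖ * J + |a x₀ - a x| * D := by fun_prop
          have := this.tendsto x₀
          simpa using this
        · refine Eventually.of_forall ?_
          rintro x ⟨_, ⟨g, hg, rfl⟩⟩
          rw [mem_closedBall_zero_iff] at hg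
          set p := pot κ (fun y => (wt y ^ 5)⁻¹ • g y) with hp
          change dist (a x₀ • p (x₀ : Space n)) (a x • p (x : Space n)) ≤ _
          rw [dist_eq_norm]
          have e : a x₀ • p (x₀ : Space n) - a x • p (x : Space n)
              = a x₀ • (p (x₀ : Space n) - p x) + (a x₀ - a x) • p (x : Space n) := by
            module
          rw [e]
          refine (norm_add_le _ _).trans (add_le_add ?_ ?_)
          · have h1 := lipschitz_pot hn hκ hK (decayBound_inv_wt_smul g) (x₀ : Space n) x
            have h2 : ‖a x₀‖ ≤ 1 := by
              rw [ha, norm_inv, Real.norm_of_nonneg (pow_pos (wt_pos _) 6).le]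
              exact inv_le_one_of_one_le₀ (one_le_pow₀ (one_le_wt _))
            rw [norm_smul]
            calc _ ≤ 1 * (K * ‖(x₀ : Space n) - x‖ * (1 * J)) := by
                  refine mul_le_mul h2 (h1.trans ?_) (norm_nonneg _) zero_le_one
                  gcongr
              _ = _ := by ring
          · rw [norm_smul, Real.norm_eq_abs]
            refine mul_le_mul_of_nonneg_left ?_ (abs_nonneg _)
            refine (norm_pot_le hn hκ (decayBound_inv_wt_smul g) x).trans ?_
            have h3 := wt_le_of_norm_le (mem_closedBall_zero_iff.1 x.2)
            have h4 := wt_pos (x : Space n)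
            calc _ ≤ 32 * envMass n * C * 1 * (1 + R ^ 2) ^ 5 := by gcongr
              _ = _ := by ring
    exact hc.clm_comp (compContinuousCLM F ℝ r)
  -- Inside the ball the retraction changes nothing; outside, the values at `x` and at its
  -- retraction are both of order `1 / R`.
  have hlim : Tendsto (fun R => P R ∘L G) atTop (𝓝 G) := by
    rw [tendsto_iff_norm_sub_tendsto_zero]
    have hz : Tendsto (fun R : ℝ => 2 * (32 * envMass n * C) / R) atTop (𝓝 0) :=
      tendsto_const_nhds.div_atTop tendsto_id
    refine squeeze_zero' (Eventually.of_forall fun R => norm_nonneg _) ?_ hz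
    filter_upwards [eventually_ge_atTop 1] with R hR1
    have hR : 0 < R := one_pos.trans_le hR1
    refine ContinuousLinearMap.opNorm_le_bound _ (by positivity) fun g => ?_
    refine (norm_le (by positivity)).2 fun x => ?_
    change ‖G g (ballRetract R x) - G g x‖ ≤ _
    rcases le_total ‖x‖ R with hx | hx
    · rw [ballRetract_eq hR hx, sub_self, norm_zero]
      positivity
    · have h1 := norm_weighted_pot_le hn hκ g x
      have h2 := norm_weighted_pot_le hn hκ g (ballRetract R x)
      have h3 : R ≤ wt x := by unfold wt; nlinarith
      have h4 : R ≤ wt (ballRetract R x) := by unfold wt; rw [norm_ballRetract hR hx]; nlinarith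
      have h5 : 0 ≤ 32 * envMass n * C * ‖g‖ := by positivity
      calc ‖G g (ballRetract R x) - G g x‖ ≤ ‖G g (ballRetract R x)‖ + ‖G g x‖ := norm_sub_le _ _
        _ ≤ 32 * envMass n * C * ‖g‖ / R + 32 * envMass n * C * ‖g‖ / R :=
          add_le_add (h2.trans (div_le_div_of_nonneg_left h5 hR h4))
            (h1.trans (div_le_div_of_nonneg_left h5 hR h3))
        _ = _ := by ring
  exact isCompactOperator_of_tendsto hlim
    ((eventually_gt_atTop 0).mono fun R hR => hPG R hR)

end PotOp

/-! ## The kernels of the inverse Laplacian and of its gradient -/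

section Kernels

open BoundedContinuousFunction

variable {n : ℕ} {F : Type*} [NormedAddCommGroup F] [NormedSpace ℝ F] {L ε : ℝ}

/-- The fundamental solution and its partial derivatives. -/
def ker (L : ℝ) : Option (Fin n) → Space n → ℝ
  | none => newton L
  | some i => newtonGrad i

/-- The regularized fundamental solution and its partial derivatives. -/
def regKer (L ε : ℝ) : Option (Fin n) → Space n → ℝ
  | none => regNewton L ε
  | some i => regGrad ε i

/-- A common bound for the kernels. -/
def kerConst (L : ℝ) : ℝ := L + L⁻¹ + 1

lemma kerBound_ker (hn : n = 2 ∨ n = 3) (hL : 0 < L) (o : Option (Fin n)) :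
    KerBound (ker L o) (kerConst L) := by
  cases o with
  | none => exact kerBound_newton hn hL
  | some i =>
    have h := kerBound_newtonGrad i
    have h1 : 1 ≤ kerConst L := by
      unfold kerConst
      have := inv_pos.2 hL
      linarith
    exact ⟨h.meas, zero_le_one.trans h1, fun x hx => (h.bound x hx).trans (by
      have := env_pos x
      gcongr)⟩

lemma kerBound_regKer (hn : n = 2 ∨ n = 3) (hL : 0 < L) (hε : 0 < ε) (hε1 : ε ≤ 1)
    (o : Option (Fin n)) : KerBound (regKer L ε o) (kerConst L + √ε) := by
  cases o with
  | none => exact kerBound_regNewton hn hL hε hε1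
  | some i =>
    have h := kerBound_regGrad hn hε i
    have h1 : 1 + √ε ≤ kerConst L + √ε := by
      unfold kerConst
      have := inv_pos.2 hL
      linarith
    have h2 : 0 ≤ 1 + √ε := by positivity
    exact ⟨h.meas, h2.trans h1, fun x hx => (h.bound x hx).trans (by
      have := env_pos x
      gcongr)⟩

lemma kerBound_ker_sub (hn : n = 2 ∨ n = 3) (hL : 0 < L) (hε : 0 < ε) (hε1 : ε ≤ 1)
    (o : Option (Fin n)) : KerBound (fun x => ker L o x - regKer L ε o x) (√ε) := by
  cases o with
  | none => exact kerBound_newton_sub hn hL hε hε1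
  | some i => exact kerBound_newtonGrad_sub hn hε i

lemma differentiable_regKer (hn : n = 2 ∨ n = 3) (hL : 0 < L) (hε : 0 < ε) (o : Option (Fin n)) :
    Differentiable ℝ (regKer L ε o) := by
  cases o with
  | none => exact fun x => (hasFDerivAt_regNewton hn hL hε x).differentiableAt
  | some i => exact differentiable_regGrad hn hε i

lemma pd_regKer_mem (hn : n = 2 ∨ n = 3) (hL : 0 < L) (hε : 0 < ε) (o : Option (Fin n))
    (j : Fin n) : pd j (regKer L ε o) ∈ symbolAlg n ε := by
  cases o with
  | none =>
    change pd j (regNewton L ε) ∈ _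
    rw [pd_regNewton hn hL hε]
    exact regGrad_mem hn j
  | some i => exact (symbolAlg_spec hε (regGrad_mem hn i)).2.2 j

lemma exists_fderiv_bound_of_pd {f : Space n → ℝ} (h : ∀ j, ∃ C, ∀ x, |pd j f x| ≤ C) :
    ∃ C : ℝ, 0 ≤ C ∧ ∀ x, ‖fderiv ℝ f x‖ ≤ C := by
  choose C hC using h
  have hC0 : 0 ≤ ∑ j, C j := Finset.sum_nonneg fun j _ => (abs_nonneg _).trans (hC j 0)
  refine ⟨∑ j, C j, hC0, fun x => ContinuousLinearMap.opNorm_le_bound _ hC0 fun v => ?_⟩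
  rw [clm_eq_sum_coord, Finset.sum_mul]
  refine (norm_sum_le _ _).trans (Finset.sum_le_sum fun j _ => ?_)
  rw [norm_mul, mul_comm]
  have := abs_coord_le_norm v j
  have h2 := hC j x
  exact mul_le_mul h2 this (abs_nonneg _) ((abs_nonneg _).trans h2)

/-- The planar regularized kernel is an unbounded logarithm, but every kernel in the family has
bounded partial derivatives. -/
lemma exists_lipschitz_regKer (hn : n = 2 ∨ n = 3) (hL : 0 < L) (hε : 0 < ε)
    (o : Option (Fin n)) : ∃ K, LipschitzWith K (regKer L ε o) := by
  obtain ⟨C, hC0, hC⟩ := exists_fderiv_bound_of_pd (f := regKer L ε o) fun j =>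
    (symbolAlg_spec hε (pd_regKer_mem hn hL hε o j)).2.1
  exact ⟨⟨C, hC0⟩, lipschitzWith_of_nnnorm_fderiv_le (differentiable_regKer hn hL hε o) fun x => hC x⟩

/-- The singular operator is a norm limit of operators with Lipschitz kernels, the error being a
multiple of `√ε`. -/
lemma isCompactOperator_potOp_ker [FiniteDimensional ℝ F] (hn : n = 2 ∨ n = 3) (hL : 0 < L)
    (o : Option (Fin n)) : IsCompactOperator
      (potOp hn (kerBound_ker hn hL o) : (Space n →ᵇ F) →L[ℝ] (Space n →ᵇ F)) := by
  have hJ := envMass_nonneg (n := n)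
  set e : ℕ → ℝ := fun k => 1 / ((k : ℝ) + 1)
  have he : ∀ k, 0 < e k := fun k => by positivity
  have he1 : ∀ k, e k ≤ 1 := fun k => by
    rw [div_le_one (by positivity)]
    linarith [k.cast_nonneg (α := ℝ)]
  refine isCompactOperator_of_tendsto (l := atTop)
    (F := fun k => potOp hn (kerBound_regKer hn hL (he k) (he1 k) o)) ?_
    (Eventually.of_forall fun k => ?_)
  · rw [tendsto_iff_norm_sub_tendsto_zero]
    have hz : Tendsto (fun k => 32 * envMass n * √(e k)) atTop (𝓝 0) := by
      have h1 : Tendsto e atTop (𝓝 0) := tendsto_one_div_add_atTop_nhds_zero_nat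
      have h2 := ((Real.continuous_sqrt.tendsto 0).comp h1).const_mul (32 * envMass n)
      simpa using h2
    refine squeeze_zero (fun k => norm_nonneg _) (fun k => ?_) hz
    rw [norm_sub_rev, potOp_sub hn _ _ (kerBound_ker_sub hn hL (he k) (he1 k) o)]
    exact norm_potOp_le hn _
  · obtain ⟨K, hK⟩ := exists_lipschitz_regKer hn hL (he k) o
    exact isCompactOperator_potOp_of_lipschitz hn _ hK

lemma norm_apply_apply_le (a : Space n →ᵇ (F →L[ℝ] F)) (g : Space n →ᵇ F) (x : Space n) :
    ‖a x (g x)‖ ≤ ‖a‖ * ‖g‖ :=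
  ((a x).le_opNorm _).trans (mul_le_mul (a.norm_coe_le_norm x) (g.norm_coe_le_norm x)
    (norm_nonneg _) (by positivity))

/-- Pointwise application of an operator-valued coefficient. -/
def mulOp (n : ℕ) (F : Type*) [NormedAddCommGroup F] [NormedSpace ℝ F] :
    (Space n →ᵇ (F →L[ℝ] F)) →L[ℝ] (Space n →ᵇ F) →L[ℝ] (Space n →ᵇ F) :=
  LinearMap.mkContinuous₂
    (LinearMap.mk₂ ℝ (fun (a : Space n →ᵇ (F →L[ℝ] F)) (g : Space n →ᵇ F) => ofNormedAddCommGroup (fun x => a x (g x))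
        (a.continuous.clm_apply g.continuous) (‖a‖ * ‖g‖) (norm_apply_apply_le a g))
      (fun a a' g => by ext x; rfl) (fun c a g => by ext x; rfl)
      (fun a g g' => by ext x; simp) (fun c a g => by ext x; simp))
    1 fun a g => by
      rw [one_mul]
      exact norm_ofNormedAddCommGroup_le _ (mul_nonneg (by positivity) (by positivity))
        (norm_apply_apply_le a g)

lemma mulOp_apply (a : Space n →ᵇ (F →L[ℝ] F)) (g : Space n →ᵇ F) (x : Space n) :
    mulOp n F a g x = a x (g x) := rfl

lemma norm_mulOp_le (a : Space n →ᵇ (F →L[ℝ] F)) : ‖mulOp n F a‖ ≤ ‖a‖ := by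
  refine ContinuousLinearMap.opNorm_le_bound _ (by positivity) fun g => ?_
  refine (norm_le (by positivity)).2 fun x => ?_
  rw [mulOp_apply]
  exact norm_apply_apply_le a g x

/-- The operator `g ↦ ∑ₒ wt⁻⁶ (kerₒ * (wt⁻⁵ cₒ g))` with coefficients `cₒ`. -/
def kerOp (hn : n = 2 ∨ n = 3) (hL : 0 < L) : (Option (Fin n) → Space n →ᵇ (F →L[ℝ] F)) →L[ℝ]
    (Space n →ᵇ F) →L[ℝ] (Space n →ᵇ F) :=
  ∑ o, (ContinuousLinearMap.compL ℝ _ _ _ (potOp hn (kerBound_ker hn hL o))) ∘L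
    (mulOp n F) ∘L (ContinuousLinearMap.proj o)

lemma kerOp_eq (hn : n = 2 ∨ n = 3) (hL : 0 < L) (c : Option (Fin n) → Space n →ᵇ (F →L[ℝ] F)) :
    kerOp hn hL c = ∑ o, potOp hn (kerBound_ker hn hL o) ∘L mulOp n F (c o) := by
  simp [kerOp]

lemma isCompactOperator_kerOp [FiniteDimensional ℝ F] (hn : n = 2 ∨ n = 3) (hL : 0 < L)
    (c : Option (Fin n) → Space n →ᵇ (F →L[ℝ] F)) : IsCompactOperator (kerOp hn hL c) := by
  rw [kerOp_eq]
  have : ∀ s : Finset (Option (Fin n)), IsCompactOperator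
      (∑ o ∈ s, potOp hn (kerBound_ker hn hL o) ∘L mulOp n F (c o) :
        (Space n →ᵇ F) →L[ℝ] (Space n →ᵇ F)) := by
    classical
    intro s
    induction s using Finset.induction_on with
    | empty => simpa using isCompactOperator_zero
    | insert o s ho ih =>
      rw [Finset.sum_insert ho]
      exact ((isCompactOperator_potOp_ker hn hL o).comp_clm (mulOp n F (c o))).add ih
  exact this _

/-- The Fredholm alternative for `1 + T` with `T` compact. -/
lemma isUnit_one_add_of_isCompactOperator {X : Type*} [NormedAddCommGroup X] [NormedSpace ℝ X]
    [CompleteSpace X] {T : X →L[ℝ] X} (hT : IsCompactOperator T)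
    (hinj : ∀ u, u + T u = 0 → u = 0) : IsUnit (1 + T) := by
  rcases hT.hasEigenvalue_or_mem_resolventSet (μ := -1) (by norm_num) with h | h
  · obtain ⟨v, hv⟩ := h.exists_hasEigenvector
    refine absurd (hinj v ?_) hv.2
    have := hv.apply_eq_smul
    rw [ContinuousLinearMap.coe_coe] at this
    rw [this]
    simp
  · rw [spectrum.mem_resolventSet_iff] at h
    have h2 := h.neg
    convert! h2 using 1
    simp [add_comm]

end Kernels

/-! ## Regularity scales -/

section IterReg

variable {n : ℕ} {F : Type*} [NormedAddCommGroup F] [InnerProductSpace ℝ F]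

lemma clm_apply_eq_sum_smul {V : Type*} [NormedAddCommGroup V] [NormedSpace ℝ V]
    (l : Space n →L[ℝ] V) (v : Space n) : l v = ∑ i, v i • l (EuclideanSpace.single i 1) := by
  conv_lhs => rw [← (EuclideanSpace.basisFun (Fin n) ℝ).sum_repr v]
  rw [map_sum]
  refine Finset.sum_congr rfl fun i _ => ?_
  rw [map_smul]
  simp

/-- The linear map with given values on the standard basis. -/
def ofPartials (v : Fin n → F) : Space n →L[ℝ] F :=
  ∑ j, (EuclideanSpace.proj j : Space n →L[ℝ] ℝ).smulRight (v j)

lemma ofPartials_apply (v : Fin n → F) (x : Space n) : ofPartials v x = ∑ j, x j • v j := by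
  simp [ofPartials]

lemma ofPartials_single (v : Fin n → F) (j : Fin n) :
    ofPartials v (EuclideanSpace.single j 1) = v j := by
  rw [ofPartials_apply, Finset.sum_eq_single j] <;> simp +contextual

lemma fderiv_eq_ofPartials (u : Space n → F) (x : Space n) :
    fderiv ℝ u x = ofPartials fun j => pd j u x := by
  ext v
  rw [clm_apply_eq_sum_smul, ofPartials_apply]
  rfl

lemma norm_ofPartials_le (v : Fin n → F) : ‖ofPartials v‖ ≤ ∑ j, ‖v j‖ := by
  refine ContinuousLinearMap.opNorm_le_bound _ (Finset.sum_nonneg fun j _ => norm_nonneg _)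
    fun x => ?_
  rw [ofPartials_apply, Finset.sum_mul]
  refine (norm_sum_le _ _).trans (Finset.sum_le_sum fun j _ => ?_)
  rw [norm_smul, mul_comm, Real.norm_eq_abs]
  exact mul_le_mul_of_nonneg_left (abs_coord_le_norm x j) (norm_nonneg _)

lemma ofPartials_sub (v w : Fin n → F) : ofPartials v - ofPartials w = ofPartials (v - w) := by
  ext x
  simp [ofPartials_apply, smul_sub]

lemma pd_of_hasFDerivAt {u : Space n → F} {v : Fin n → F} {x : Space n}
    (h : HasFDerivAt u (ofPartials v) x) (j : Fin n) : pd j u x = v j := by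
  rw [pd, h.fderiv, ofPartials_single]

lemma pd_add {u v : Space n → F} (hu : Differentiable ℝ u) (hv : Differentiable ℝ v) (j : Fin n) :
    pd j (fun x => u x + v x) = fun x => pd j u x + pd j v x := by
  ext x
  rw [pd, fderiv_fun_add (hu x) (hv x)]
  rfl

lemma pd_neg (u : Space n → F) (j : Fin n) : pd j (fun x => -u x) = fun x => -pd j u x := by
  ext x
  rw [pd, fderiv_fun_neg]
  rfl

lemma pd_sub {u v : Space n → F} (hu : Differentiable ℝ u) (hv : Differentiable ℝ v) (j : Fin n) :
    pd j (fun x => u x - v x) = fun x => pd j u x - pd j v x := by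
  simp only [sub_eq_add_neg]
  rw [pd_add hu hv.fun_neg, pd_neg]

lemma pd_sum {ι : Type*} {s : Finset ι} {u : ι → Space n → F}
    (hu : ∀ i ∈ s, Differentiable ℝ (u i)) (j : Fin n) :
    pd j (fun x => ∑ i ∈ s, u i x) = fun x => ∑ i ∈ s, pd j (u i) x := by
  ext x
  rw [pd, fderiv_fun_sum fun i hi => hu i hi x]
  simp [pd]

/-- `k` partial derivatives exist, and all of them satisfy `P`. -/
def IterReg (P : (Space n → F) → Prop) : ℕ → (Space n → F) → Prop
  | 0, u => P u
  | k + 1, u => P u ∧ Differentiable ℝ u ∧ ∀ i, IterReg P k (pd i u)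

variable {P : (Space n → F) → Prop}

lemma IterReg.zero {k : ℕ} {u : Space n → F} (h : IterReg P k u) : P u := by
  cases k with
  | zero => exact h
  | succ k => exact h.1

lemma IterReg.of_succ {k : ℕ} : ∀ {u : Space n → F}, IterReg P (k + 1) u → IterReg P k u := by
  induction k with
  | zero => exact fun h => h.1
  | succ k ih => exact fun h => ⟨h.1, h.2.1, fun i => ih (h.2.2 i)⟩

lemma IterReg.add (hP : ∀ u v, P u → P v → P fun x => u x + v x) {k : ℕ} :
    ∀ {u v : Space n → F}, IterReg P k u → IterReg P k v → IterReg P k fun x => u x + v x := by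
  induction k with
  | zero => exact fun hu hv => hP _ _ hu hv
  | succ k ih =>
    intro u v hu hv
    refine ⟨hP _ _ hu.1 hv.1, hu.2.1.add hv.2.1, fun i => ?_⟩
    rw [pd_add hu.2.1 hv.2.1]
    exact ih (hu.2.2 i) (hv.2.2 i)

lemma IterReg.neg (hP : ∀ u, P u → P fun x => -u x) {k : ℕ} :
    ∀ {u : Space n → F}, IterReg P k u → IterReg P k fun x => -u x := by
  induction k with
  | zero => exact fun hu => hP _ hu
  | succ k ih =>
    intro u hu
    refine ⟨hP _ hu.1, hu.2.1.fun_neg, fun i => ?_⟩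
    rw [pd_neg]
    exact ih (hu.2.2 i)

lemma IterReg.sum (hP : ∀ u v, P u → P v → P fun x => u x + v x) (hP0 : P fun _ => 0) {k : ℕ}
    {ι : Type*} {s : Finset ι} {u : ι → Space n → F} (hu : ∀ i ∈ s, IterReg P k (u i)) :
    IterReg P k fun x => ∑ i ∈ s, u i x := by
  classical
  induction s using Finset.induction_on with
  | empty =>
    simp only [Finset.sum_empty]
    clear hu
    induction k with
    | zero => exact hP0
    | succ k ih =>
      refine ⟨hP0, differentiable_const _, fun i => ?_⟩
      have : pd i (fun _ : Space n => (0 : F)) = fun _ => 0 := by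
        ext x
        simp [pd]
      rw [this]
      exact ih
  | insert i s hi ih =>
    simp only [Finset.sum_insert hi]
    exact (hu i (Finset.mem_insert_self i s)).add hP
      (ih fun j hj => hu j (Finset.mem_insert_of_mem hj))

/-- Continuous functions of growth at most `(1 + |x|²)⁶`. -/
structure Growth (u : Space n → F) : Prop where
  cont : Continuous u
  bound : ∃ C, ∀ x, ‖u x‖ ≤ C * wt x ^ 6

/-- Continuous functions of decay at least `(1 + |x|²)⁻⁵`. -/
def Decay (u : Space n → F) : Prop := ∃ M, DecayBound u M

lemma Growth.add {u v : Space n → F} (hu : Growth u) (hv : Growth v) :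
    Growth fun x => u x + v x := by
  obtain ⟨C, hC⟩ := hu.bound
  obtain ⟨D, hD⟩ := hv.bound
  refine ⟨hu.cont.add hv.cont, C + D, fun x => ?_⟩
  rw [add_mul]
  exact (norm_add_le _ _).trans (add_le_add (hC x) (hD x))

lemma Growth.neg {u : Space n → F} (hu : Growth u) : Growth fun x => -u x := by
  obtain ⟨C, hC⟩ := hu.bound
  exact ⟨hu.cont.neg, C, fun x => by rw [norm_neg]; exact hC x⟩

lemma Growth.zero : Growth fun _ : Space n => (0 : F) := ⟨continuous_const, 0, by simp⟩

lemma Decay.add {u v : Space n → F} (hu : Decay u) (hv : Decay v) : Decay fun x => u x + v x := by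
  obtain ⟨C, hC⟩ := hu
  obtain ⟨D, hD⟩ := hv
  exact ⟨C + D, hC.add hD⟩

lemma Decay.zero : Decay fun _ : Space n => (0 : F) := ⟨0, continuous_const, by simp⟩

lemma exists_decayBound_fderiv {u : Space n → F} (h : ∀ i, Decay (pd i u)) :
    ∃ M, DecayBound (fderiv ℝ u) M := by
  choose M hM using h
  have e : fderiv ℝ u = fun x => ofPartials fun j => pd j u x :=
    funext fun x => fderiv_eq_ofPartials u x
  refine ⟨∑ j, M j, ?_, fun x => ?_⟩
  · rw [e]
    unfold ofPartials
    refine continuous_finsetSum _ fun j _ => ?_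
    exact ((ContinuousLinearMap.smulRightL ℝ (Space n) F
      (EuclideanSpace.proj j : Space n →L[ℝ] ℝ)).continuous.comp (hM j).cont)
  · rw [e, Finset.sum_div]
    exact (norm_ofPartials_le _).trans (Finset.sum_le_sum fun j _ => (hM j).bound x)

lemma iterReg_schwartz (f : 𝓢(Space n, F)) (k : ℕ) : IterReg Decay k f := by
  induction k generalizing f with
  | zero => exact exists_decayBound_of_schwartz f
  | succ k ih =>
    refine ⟨exists_decayBound_of_schwartz f, f.differentiable, fun i => ?_⟩
    exact ih (LineDeriv.lineDerivOp (EuclideanSpace.single i (1 : ℝ)) f)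

end IterReg

/-! ## Potentials with Schwartz coefficients -/

section Regularity

open BoundedContinuousFunction LineDeriv

variable {n : ℕ} {F : Type*} [NormedAddCommGroup F] [InnerProductSpace ℝ F]
  {V : Type*} [NormedAddCommGroup V] [NormedSpace ℝ V] {L ε C : ℝ}

/-- The function `wt¹¹ f` as a bounded continuous function. -/
def weightCoef (n : ℕ) (V : Type*) [NormedAddCommGroup V] [NormedSpace ℝ V] :
    𝓢(Space n, V) →L[ℝ] (Space n →ᵇ V) :=
  SchwartzMap.toBoundedContinuousFunctionCLM ℝ (Space n) V ∘L
    SchwartzMap.smulLeftCLM V fun x : Space n => wt x ^ 11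

lemma weightCoef_apply (f : 𝓢(Space n, V)) (x : Space n) :
    weightCoef n V f x = wt x ^ 11 • f x := by
  change SchwartzMap.smulLeftCLM V (fun x : Space n => wt x ^ 11) f x = _
  rw [SchwartzMap.smulLeftCLM_apply_apply (hasTemperateGrowth_wt_pow 11)]

lemma norm_schwartz_le (f : 𝓢(Space n, V)) (x : Space n) :
    ‖f x‖ ≤ ‖weightCoef n V f‖ / wt x ^ 11 := by
  have h := (weightCoef n V f).norm_coe_le_norm x
  have h1 := pow_pos (wt_pos x) 11
  rw [weightCoef_apply, norm_smul, Real.norm_of_nonneg h1.le] at h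
  rw [le_div_iff₀ h1]
  linarith

lemma Growth.decay_mul {u : Space n → F} (hu : Growth u) (σ : 𝓢(Space n, F →L[ℝ] F)) :
    Decay fun x => σ x (u x) := by
  obtain ⟨C, hC⟩ := hu.bound
  refine ⟨‖weightCoef n _ σ‖ * C, σ.continuous.clm_apply hu.cont, fun x => ?_⟩
  have h := wt_pos x
  calc ‖σ x (u x)‖ ≤ ‖σ x‖ * ‖u x‖ := (σ x).le_opNorm _
    _ ≤ ‖weightCoef n _ σ‖ / wt x ^ 11 * (C * wt x ^ 6) := by
      have := norm_schwartz_le σ x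
      have := hC x
      gcongr
    _ = _ := by field_simp

lemma pd_mul (σ : 𝓢(Space n, F →L[ℝ] F)) {u : Space n → F} (hu : Differentiable ℝ u) (j : Fin n) :
    pd j (fun x => σ x (u x)) = fun x => (∂_{EuclideanSpace.single j (1 : ℝ)} σ) x (u x)
      + σ x (pd j u x) := by
  ext x
  rw [pd, ((σ.hasFDerivAt x).clm_apply (hu x).hasFDerivAt).fderiv,
    SchwartzMap.lineDerivOp_apply_eq_fderiv]
  simp [pd, add_comm]

lemma differentiable_mul (σ : 𝓢(Space n, F →L[ℝ] F)) {u : Space n → F} (hu : Differentiable ℝ u) :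
    Differentiable ℝ fun x => σ x (u x) :=
  fun x => ((σ.hasFDerivAt x).clm_apply (hu x).hasFDerivAt).differentiableAt

/-- Leibniz rule. The induction runs over all coefficients at once because differentiation replaces
`σ` by its derivative, again Schwartz. -/
lemma IterReg.mul {k : ℕ} : ∀ {u : Space n → F} (_ : IterReg Growth k u)
    (σ : 𝓢(Space n, F →L[ℝ] F)), IterReg Decay k fun x => σ x (u x) := by
  induction k with
  | zero => exact fun hu σ => hu.decay_mul σ
  | succ k ih =>
    intro u hu σ
    refine ⟨hu.1.decay_mul σ, differentiable_mul σ hu.2.1, fun j => ?_⟩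
    rw [pd_mul σ hu.2.1]
    exact (ih hu.of_succ _).add (fun _ _ => Decay.add) (ih (hu.2.2 j) _)

variable {κ : Space n → ℝ}

lemma Decay.growth_pot (hn : n = 2 ∨ n = 3) (hκ : KerBound κ C) {f : Space n → F} (hf : Decay f) :
    Growth (pot κ f) := by
  obtain ⟨M, hM⟩ := hf
  refine ⟨continuous_pot hn hκ hM, 32 * envMass n * C * M, fun x => (norm_pot_le hn hκ hM x).trans ?_⟩
  have := envMass_nonneg (n := n)
  have := hκ.nonneg
  have := hM.nonneg
  have : wt x ^ 5 ≤ wt x ^ 6 := pow_le_pow_right₀ (one_le_wt x) (by norm_num)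
  gcongr

lemma differentiable_pot [CompleteSpace F] (hn : n = 2 ∨ n = 3) (hκ : KerBound κ C)
    {f : Space n → F} (hf : IterReg Decay 1 f) : Differentiable ℝ (pot κ f) := by
  obtain ⟨M', hM'⟩ := exists_decayBound_fderiv hf.2.2
  obtain ⟨M, hM⟩ := hf.1
  exact fun x => (hasFDerivAt_pot hn hκ hM hf.2.1 hM' x).differentiableAt

lemma pd_pot [CompleteSpace F] (hn : n = 2 ∨ n = 3) (hκ : KerBound κ C)
    {f : Space n → F} (hf : IterReg Decay 1 f) (j : Fin n) : pd j (pot κ f) = pot κ (pd j f) := by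
  obtain ⟨M', hM'⟩ := exists_decayBound_fderiv hf.2.2
  obtain ⟨M, hM⟩ := hf.1
  ext x
  rw [pd, (hasFDerivAt_pot hn hκ hM hf.2.1 hM' x).fderiv]
  exact (pot_clm hn hκ hM' (ContinuousLinearMap.apply ℝ F (EuclideanSpace.single j (1 : ℝ))) x).symm

lemma IterReg.pot [CompleteSpace F] (hn : n = 2 ∨ n = 3) (hκ : KerBound κ C) {k : ℕ} :
    ∀ {f : Space n → F}, IterReg Decay k f → IterReg Growth k (pot κ f) := by
  induction k with
  | zero => exact fun hf => Decay.growth_pot hn hκ hf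
  | succ k ih =>
    intro f hf
    have h1 : IterReg Decay 1 f := ⟨hf.1, hf.2.1, fun i => (hf.2.2 i).zero⟩
    refine ⟨hf.1.growth_pot hn hκ, differentiable_pot hn hκ h1, fun j => ?_⟩
    rw [pd_pot hn hκ h1]
    exact ih (hf.2.2 j)

/-- Counterpart of `hasFDerivAt_pot`: the derivative falls on the kernel, so the density need only
decay. This is how regularized potentials gain smoothness. -/
lemma hasFDerivAt_pot_of_smooth [CompleteSpace F] (hn : n = 2 ∨ n = 3) (hκ : KerBound κ C)
    (hd : Differentiable ℝ κ) (hc : ∀ j, Continuous (pd j κ)) {D : Fin n → ℝ}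
    (hD : ∀ j x, |pd j κ x| ≤ D j)
    {f : Space n → F} (hf : Decay f) (x : Space n) :
    HasFDerivAt (YangMills.pot κ f) (ofPartials fun j => YangMills.pot (pd j κ) f x) x := by
  obtain ⟨M, hM⟩ := hf
  have hfi := hM.integrable hn
  have hb : ∀ x, ‖fderiv ℝ κ x‖ ≤ ∑ j, D j := fun x => by
    rw [fderiv_eq_ofPartials]
    exact (norm_ofPartials_le _).trans (Finset.sum_le_sum fun j _ => hD j x)
  have hcf : Continuous (fderiv ℝ κ) := by
    rw [funext fun x => fderiv_eq_ofPartials κ x]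
    unfold ofPartials
    refine continuous_finsetSum _ fun j _ => ?_
    exact ((ContinuousLinearMap.smulRightL ℝ (Space n) ℝ
      (EuclideanSpace.proj j : Space n →L[ℝ] ℝ)).continuous.comp (hc j))
  have hcont : ∀ x, Continuous fun y => (fderiv ℝ κ (x - y)).smulRight (f y) := by
    intro x
    have h1 : Continuous fun y => x - y := by fun_prop
    exact ((ContinuousLinearMap.smulRightL ℝ (Space n) F).continuous.comp
      (hcf.comp h1)).clm_apply hM.cont
  have hnorm : ∀ x y, ‖(fderiv ℝ κ (x - y)).smulRight (f y)‖ ≤ (∑ j, D j) * ‖f y‖ := fun x y => by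
    rw [ContinuousLinearMap.norm_smulRight_apply]
    exact mul_le_mul_of_nonneg_right (hb _) (norm_nonneg _)
  have key : HasFDerivAt (fun x => ∫ y, κ (x - y) • f y)
      (∫ y, (fderiv ℝ κ (x - y)).smulRight (f y)) x := by
    refine hasFDerivAt_integral_of_dominated_of_fderiv_le (𝕜 := ℝ)
      (bound := fun y => (∑ j, D j) * ‖f y‖)
      (F' := fun x y => (fderiv ℝ κ (x - y)).smulRight (f y))
      Filter.univ_mem ?_ (integrable_pot' hn hκ hM x)
      (hcont x).aestronglyMeasurable ?_ (hfi.norm.const_mul _) ?_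
    · exact Eventually.of_forall fun x => (integrable_pot' hn hκ hM x).aestronglyMeasurable
    · exact Eventually.of_forall fun y x _ => hnorm x y
    · refine Eventually.of_forall fun y x _ => ?_
      have h1 : HasFDerivAt (fun x : Space n => x - y) (ContinuousLinearMap.id ℝ (Space n)) x :=
        (hasFDerivAt_id x).sub_const y
      have := ((hd (x - y)).hasFDerivAt.comp x h1).smul_const (f y)
      simpa using! this
  rw [funext fun x => pot_eq_integral_sub κ f x]
  convert! key using 1
  ext v
  have hint : Integrable fun y => (fderiv ℝ κ (x - y)).smulRight (f y) :=
    Integrable.mono' (hfi.norm.const_mul _) (hcont x).aestronglyMeasurable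
      (Eventually.of_forall fun y => hnorm x y)
  rw [clm_apply_eq_sum_smul (∫ y, (fderiv ℝ κ (x - y)).smulRight (f y)), ofPartials_apply]
  refine Finset.sum_congr rfl fun j _ => ?_
  rw [ContinuousLinearMap.integral_apply hint, pot_eq_integral_sub]
  rfl

lemma iterReg_pot_of_mem_symbolAlg [CompleteSpace F] (hn : n = 2 ∨ n = 3) (hε : 0 < ε) {k : ℕ} :
    ∀ {κ : Space n → ℝ} (_ : κ ∈ symbolAlg n ε) {f : Space n → F} (_ : Decay f),
      IterReg Growth k (pot κ f) := by
  induction k with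
  | zero =>
    intro κ hκ f hf
    obtain ⟨C, hC⟩ := exists_kerBound_of_mem_symbolAlg hε hκ
    exact hf.growth_pot hn hC
  | succ k ih =>
    intro κ hκ f hf
    obtain ⟨C, hC⟩ := exists_kerBound_of_mem_symbolAlg hε hκ
    obtain ⟨h1, -, h3⟩ := symbolAlg_spec hε hκ
    choose D hD using fun j => (symbolAlg_spec hε (h3 j)).2.1
    have key := fun x => hasFDerivAt_pot_of_smooth hn hC h1
      (fun j => (symbolAlg_spec hε (h3 j)).1.continuous) hD hf x
    refine ⟨hf.growth_pot hn hC, fun x => (key x).differentiableAt, fun j => ?_⟩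
    rw [funext fun x => pd_of_hasFDerivAt (key x) j]
    exact ih (h3 j) hf

/-- The planar logarithm is not in `symbolAlg`, but its gradient is; so the first derivative is
taken separately and the algebra takes over from there. -/
lemma iterReg_pot_regKer [CompleteSpace F] (hn : n = 2 ∨ n = 3) (hL : 0 < L) (hε : 0 < ε)
    (hε1 : ε ≤ 1) (o : Option (Fin n)) {f : Space n → F} (hf : Decay f) (k : ℕ) :
    IterReg Growth k (pot (regKer L ε o) f) := by
  have hC := kerBound_regKer hn hL hε hε1 o
  cases k with
  | zero => exact hf.growth_pot hn hC
  | succ k =>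
    have h3 := pd_regKer_mem hn hL hε o
    choose D hD using fun j => (symbolAlg_spec hε (h3 j)).2.1
    have key := fun x => hasFDerivAt_pot_of_smooth hn hC (differentiable_regKer hn hL hε o)
      (fun j => (symbolAlg_spec hε (h3 j)).1.continuous) hD hf x
    refine ⟨hf.growth_pot hn hC, fun x => (key x).differentiableAt, fun j => ?_⟩
    rw [funext fun x => pd_of_hasFDerivAt (key x) j]
    exact iterReg_pot_of_mem_symbolAlg hn hε (h3 j) hf

/-- `∑ₒ κₒ * (σₒ u)`. -/
def potSum (κ : Option (Fin n) → Space n → ℝ) (σ : Option (Fin n) → 𝓢(Space n, F →L[ℝ] F))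
    (u : Space n → F) (x : Space n) : F :=
  ∑ o, pot (κ o) (fun y => σ o y (u y)) x

variable {κ : Option (Fin n) → Space n → ℝ} {C : Option (Fin n) → ℝ}

lemma IterReg.potSum [CompleteSpace F] (hn : n = 2 ∨ n = 3) (hκ : ∀ o, KerBound (κ o) (C o))
    (σ : Option (Fin n) → 𝓢(Space n, F →L[ℝ] F)) {k : ℕ} {u : Space n → F}
    (hu : IterReg Growth k u) : IterReg Growth k (potSum κ σ u) :=
  IterReg.sum (fun _ _ => Growth.add) Growth.zero fun o _ => (hu.mul (σ o)).pot hn (hκ o)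

lemma pd_potSum [CompleteSpace F] (hn : n = 2 ∨ n = 3) (hκ : ∀ o, KerBound (κ o) (C o))
    (σ : Option (Fin n) → 𝓢(Space n, F →L[ℝ] F)) {u : Space n → F}
    (hu : IterReg Growth 1 u) (j : Fin n) (x : Space n) :
    pd j (YangMills.potSum κ σ u) x
      = YangMills.potSum κ (fun o => ∂_{EuclideanSpace.single j (1 : ℝ)} (σ o)) u x
        + YangMills.potSum κ σ (pd j u) x := by
  have e : YangMills.potSum κ σ u
      = fun x => ∑ o, YangMills.pot (κ o) (fun y => σ o y (u y)) x := rfl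
  have h2 := fun o => hu.mul (σ o)
  rw [e, pd_sum fun o _ => differentiable_pot hn (hκ o) (h2 o)]
  simp only [YangMills.potSum, ← Finset.sum_add_distrib]
  refine Finset.sum_congr rfl fun o _ => ?_
  rw [pd_pot hn (hκ o) (h2 o), pd_mul _ hu.2.1]
  obtain ⟨M, hM⟩ := hu.1.decay_mul (∂_{EuclideanSpace.single j (1 : ℝ)} (σ o))
  obtain ⟨M', hM'⟩ := Growth.decay_mul (u := pd j u) (hu.2.2 j) (σ o)
  exact pot_add hn (hκ o) hM hM' x

end Regularity

/-! ## Regularity of solutions of the integral equation -/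

section Smoothing

open BoundedContinuousFunction LineDeriv

variable {n : ℕ} {F : Type*} [NormedAddCommGroup F] [InnerProductSpace ℝ F] {L ε : ℝ}
  {κ : Option (Fin n) → Space n → ℝ} {C : Option (Fin n) → ℝ}

/-- The function `wt⁶ φ`. -/
def unweight (φ : Space n →ᵇ F) (x : Space n) : F := wt x ^ 6 • φ x

lemma growth_unweight (φ : Space n →ᵇ F) : Growth (unweight φ) := by
  refine ⟨(continuous_wt.pow 6).smul φ.continuous, ‖φ‖, fun x => ?_⟩
  have := pow_pos (wt_pos x) 6
  rw [unweight, norm_smul, Real.norm_of_nonneg this.le, mul_comm]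
  have := φ.norm_coe_le_norm x
  gcongr

lemma Growth.norm_inv_smul_le {u : Space n → F} (hu : Growth u) :
    ∀ x, ‖(wt x ^ 6)⁻¹ • u x‖ ≤ hu.bound.choose := fun x => by
  have h := hu.bound.choose_spec x
  have h1 := pow_pos (wt_pos x) 6
  rw [norm_smul, norm_inv, Real.norm_of_nonneg h1.le, inv_mul_le_iff₀ h1]
  linarith

/-- The bounded function `wt⁻⁶ u`. -/
def Growth.weight {u : Space n → F} (hu : Growth u) : Space n →ᵇ F :=
  ofNormedAddCommGroup (fun x => (wt x ^ 6)⁻¹ • u x)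
    (((continuous_wt.pow 6).inv₀ fun x => (pow_pos (wt_pos x) 6).ne').smul hu.cont)
    hu.bound.choose hu.norm_inv_smul_le

lemma Growth.weight_apply {u : Space n → F} (hu : Growth u) (x : Space n) :
    hu.weight x = (wt x ^ 6)⁻¹ • u x := rfl

lemma Growth.unweight_weight {u : Space n → F} (hu : Growth u) : unweight hu.weight = u := by
  ext x
  rw [unweight, hu.weight_apply, smul_smul, mul_inv_cancel₀ (pow_pos (wt_pos x) 6).ne', one_smul]

lemma inv_smul_unweight (φ : Space n →ᵇ F) (x : Space n) :
    (wt x ^ 6)⁻¹ • unweight φ x = φ x := by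
  rw [unweight, smul_smul, inv_mul_cancel₀ (pow_pos (wt_pos x) 6).ne', one_smul]

/-- The operator `φ ↦ ∑ₒ wt⁻⁶ (κₒ * (wt⁻⁵ cₒ φ))`. -/
def potSumOp (hn : n = 2 ∨ n = 3) (hκ : ∀ o, KerBound (κ o) (C o))
    (c : Option (Fin n) → Space n →ᵇ (F →L[ℝ] F)) : (Space n →ᵇ F) →L[ℝ] (Space n →ᵇ F) :=
  ∑ o, potOp hn (hκ o) ∘L mulOp n F (c o)

/-- The exponents fit: a coefficient weighted by `wt¹¹` and multiplied by the `wt⁻⁵` inside `potOp`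
leaves the `wt⁶` of `unweight`. -/
lemma potSumOp_apply (hn : n = 2 ∨ n = 3) (hκ : ∀ o, KerBound (κ o) (C o))
    (σ : Option (Fin n) → 𝓢(Space n, F →L[ℝ] F)) (φ : Space n →ᵇ F) (x : Space n) :
    potSumOp hn hκ (fun o => weightCoef n (F →L[ℝ] F) (σ o)) φ x
      = (wt x ^ 6)⁻¹ • potSum κ σ (unweight φ) x := by
  simp only [potSumOp, potSum, Finset.smul_sum, _root_.sum_apply,
    BoundedContinuousFunction.sum_apply,
    ContinuousLinearMap.comp_apply, potOp_apply, mulOp_apply, weightCoef_apply]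
  refine Finset.sum_congr rfl fun o _ => ?_
  congr 2
  ext y
  have h := wt_pos y
  rw [_root_.smul_apply, unweight, map_smul, smul_smul]
  congr 1
  field_simp

lemma norm_potSumOp_le (hn : n = 2 ∨ n = 3) (hκ : ∀ o, KerBound (κ o) (C o))
    (c : Option (Fin n) → Space n →ᵇ (F →L[ℝ] F)) :
    ‖potSumOp hn hκ c‖ ≤ ∑ o, 32 * envMass n * C o * ‖c o‖ := by
  unfold potSumOp
  refine (norm_sum_le (E := (Space n →ᵇ F) →L[ℝ] (Space n →ᵇ F)) _ _).trans
    (Finset.sum_le_sum fun o _ => ?_)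
  refine (ContinuousLinearMap.opNorm_comp_le _ _).trans ?_
  have h1 := norm_potOp_le (F := F) hn (hκ o)
  have h2 := norm_mulOp_le (c o)
  exact mul_le_mul h1 h2 (by positivity) (le_trans (by positivity) h1)

/-- Families `(φ, φ₁, …, φₙ)` such that `wt⁶ φⱼ` are the partial derivatives of `wt⁶ φ`. -/
def gradGraph (n : ℕ) (F : Type*) [NormedAddCommGroup F] [InnerProductSpace ℝ F] :
    Set (Option (Fin n) → Space n →ᵇ F) :=
  {φ | ∀ x, HasFDerivAt (unweight (φ none)) (ofPartials fun j => unweight (φ (some j)) x) x}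

/-- Convergence in the weighted supremum norms is locally uniform convergence of the functions and
of their gradients, and such limits may be differentiated. -/
lemma isClosed_gradGraph : IsClosed (gradGraph n F) := by
  refine IsSeqClosed.isClosed fun φ ψ hφ hlim x => ?_
  have hb : ∀ (o : Option (Fin n)) (m : ℕ) (y : Space n),
      ‖unweight (φ m o) y - unweight (ψ o) y‖ ≤ wt y ^ 6 * dist (φ m) ψ := by
    intro o m y
    have := pow_pos (wt_pos y) 6
    rw [unweight, unweight, ← smul_sub, norm_smul, Real.norm_of_nonneg this.le]
    have h1 := (φ m o - ψ o).norm_coe_le_norm y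
    rw [← dist_eq_norm, BoundedContinuousFunction.sub_apply] at h1
    have h2 := dist_le_pi_dist (φ m) ψ o
    have h3 := h1.trans h2
    gcongr
  have hd : Tendsto (fun m => dist (φ m) ψ) atTop (𝓝 0) := tendsto_iff_dist_tendsto_zero.1 hlim
  refine hasFDerivAt_of_tendstoUniformlyOn (l := atTop) (s := Metric.ball 0 (‖x‖ + 1))
    (f := fun m => unweight (φ m none))
    (f' := fun m x => ofPartials fun j => unweight (φ m (some j)) x)
    (g' := fun x => ofPartials fun j => unweight (ψ (some j)) x)
    Metric.isOpen_ball ?_ (fun m y _ => hφ m y) (fun y _ => ?_) (by simp)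
  · rw [Metric.tendstoUniformlyOn_iff]
    intro δ hδ
    have h1 : Tendsto (fun m => n * ((1 + (‖x‖ + 1) ^ 2) ^ 6 * dist (φ m) ψ)) atTop (𝓝 0) := by
      simpa using (hd.const_mul ((1 + (‖x‖ + 1) ^ 2) ^ 6)).const_mul (n : ℝ)
    filter_upwards [h1.eventually (gt_mem_nhds hδ)] with m hm y hy
    rw [dist_comm, dist_eq_norm, ofPartials_sub]
    refine lt_of_le_of_lt ((norm_ofPartials_le _).trans ?_) hm
    calc _ ≤ ∑ j : Fin n, (1 + (‖x‖ + 1) ^ 2) ^ 6 * dist (φ m) ψ := by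
          refine Finset.sum_le_sum fun j _ => (hb (some j) m y).trans ?_
          have h2 : wt y ≤ 1 + (‖x‖ + 1) ^ 2 :=
            wt_le_of_norm_le (le_of_lt (by simpa using hy))
          have := wt_pos y
          gcongr
      _ = _ := by simp
  · rw [tendsto_iff_norm_sub_tendsto_zero]
    refine squeeze_zero (fun m => norm_nonneg _) (fun m => hb none m y) ?_
    simpa using hd.const_mul (wt y ^ 6)

lemma iterReg_one_of_hasFDerivAt {u : Space n → F} (hu : Growth u) {v : Fin n → Space n → F}
    (hv : ∀ j, Growth (v j)) (h : ∀ x, HasFDerivAt u (ofPartials fun j => v j x) x) :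
    IterReg Growth 1 u := by
  refine ⟨hu, fun x => (h x).differentiableAt, fun j => ?_⟩
  have : pd j u = v j := funext fun x => pd_of_hasFDerivAt (h x) j
  rw [this]
  exact hv j

/-- A solution of `u + S u = g` with a contraction `S` is as differentiable as `g`. -/
lemma iterReg_one_of_contraction [CompleteSpace F] (hn : n = 2 ∨ n = 3)
    (hκ : ∀ o, KerBound (κ o) (C o))
    (σ : Option (Fin n) → 𝓢(Space n, F →L[ℝ] F))
    (h0 : ‖potSumOp hn hκ fun o => weightCoef n (F →L[ℝ] F) (σ o)‖ ≤ 1 / 4)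
    (h1 : ∀ j, ‖potSumOp hn hκ fun o =>
      weightCoef n (F →L[ℝ] F) (∂_{(EuclideanSpace.single j 1 : Space n)} (σ o))‖ ≤ 1 / 4)
    {u g : Space n → F} (hu : Growth u) (hg : IterReg Growth 1 g)
    (he : ∀ x, u x + potSum κ σ u x = g x) : IterReg Growth 1 u := by
  set S := potSumOp hn hκ fun o => weightCoef n (F →L[ℝ] F) (σ o) with hS
  set D : Fin n → (Space n →ᵇ F) →L[ℝ] (Space n →ᵇ F) := fun j =>
    potSumOp hn hκ fun o => weightCoef n (F →L[ℝ] F) (∂_{(EuclideanSpace.single j 1 : Space n)} (σ o)) with hD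
  have hSu : ∀ φ : Space n →ᵇ F, unweight (S φ) = potSum κ σ (unweight φ) := by
    intro φ
    ext x
    rw [unweight, hS, potSumOp_apply, smul_smul, mul_inv_cancel₀ (pow_pos (wt_pos x) 6).ne',
      one_smul]
  have hDu : ∀ j (φ : Space n →ᵇ F), unweight (D j φ)
      = potSum κ (fun o => ∂_{(EuclideanSpace.single j 1 : Space n)} (σ o)) (unweight φ) := by
    intro j φ
    ext x
    rw [unweight, hD, potSumOp_apply, smul_smul, mul_inv_cancel₀ (pow_pos (wt_pos x) 6).ne',
      one_smul]
  have hgj : ∀ j, Growth (pd j g) := hg.2.2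
  -- The equation together with its formal derivatives `uⱼ = ∂ⱼg - Dⱼ u - S uⱼ`, as a fixed point
  -- problem for `(u, u₁, …, uₙ)`. The two bounds `1/4` add up to the contraction constant `1/2`.
  set Φ : (Option (Fin n) → Space n →ᵇ F) → (Option (Fin n) → Space n →ᵇ F) := fun φ o =>
    o.elim (hg.1.weight - S (φ none))
      (fun j => (hgj j).weight - D j (φ none) - S (φ (some j))) with hΦ
  set G : Option (Fin n) → Space n →ᵇ F := fun o => o.elim hg.1.weight fun j => (hgj j).weight
  have hS' : ∀ φ ψ, dist (S φ) (S ψ) ≤ 1 / 4 * dist φ ψ := fun φ ψ => by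
    rw [dist_eq_norm, dist_eq_norm, ← map_sub]
    exact (S.le_opNorm _).trans (mul_le_mul_of_nonneg_right h0 (norm_nonneg _))
  have hD' : ∀ j φ ψ, dist (D j φ) (D j ψ) ≤ 1 / 4 * dist φ ψ := fun j φ ψ => by
    rw [dist_eq_norm, dist_eq_norm, ← map_sub]
    exact ((D j).le_opNorm _).trans (mul_le_mul_of_nonneg_right (h1 j) (norm_nonneg _))
  have hlip : ∀ φ ψ, dist (Φ φ) (Φ ψ) ≤ 1 / 2 * dist φ ψ := by
    intro φ ψ
    refine (dist_pi_le_iff (by positivity)).2 fun o => ?_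
    have e0 := dist_le_pi_dist φ ψ none
    cases o with
    | none =>
      simp only [hΦ, Option.elim, dist_sub_left]
      have := hS' (φ none) (ψ none)
      have := dist_nonneg (x := φ) (y := ψ)
      linarith
    | some j =>
      simp only [hΦ, Option.elim]
      refine (dist_sub_sub_le _ _ _ _).trans ?_
      rw [dist_sub_left]
      have := hS' (φ (some j)) (ψ (some j))
      have := hD' j (φ none) (ψ none)
      have := dist_le_pi_dist φ ψ (some j)
      linarith
  -- On true gradients the formal derivative is the derivative, so the contraction preserves the
  -- closed set and its fixed point lies there.
  have hmaps : MapsTo Φ (gradGraph n F) (gradGraph n F) := by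
    intro φ hφ x
    have hreg : IterReg Growth 1 (unweight (φ none)) :=
      iterReg_one_of_hasFDerivAt (growth_unweight _) (fun j => growth_unweight (φ (some j))) hφ
    have hpd : ∀ j, pd j (unweight (φ none)) = unweight (φ (some j)) := fun j =>
      funext fun x => pd_of_hasFDerivAt (hφ x) j
    have e1 : unweight (Φ φ none) = fun x => g x - potSum κ σ (unweight (φ none)) x := by
      ext x
      rw [← hSu]
      simp only [hΦ, Option.elim, unweight, BoundedContinuousFunction.sub_apply, smul_sub]
      congr 1
      exact congrFun hg.1.unweight_weight x
    have e2 : ∀ j, unweight (Φ φ (some j)) x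
        = pd j (fun x => g x - potSum κ σ (unweight (φ none)) x) x := by
      intro j
      rw [pd_sub hg.2.1 (hreg.potSum hn hκ σ).2.1]
      beta_reduce
      rw [pd_potSum hn hκ σ hreg, hpd, ← hSu, ← hDu]
      simp only [hΦ, Option.elim, unweight, BoundedContinuousFunction.sub_apply, smul_sub]
      rw [sub_sub]
      congr 1
      exact congrFun (hgj j).unweight_weight x
    rw [e1, funext e2, ← fderiv_eq_ofPartials]
    exact (hg.2.1.sub (hreg.potSum hn hκ σ).2.1 x).hasFDerivAt
  have hG : G ∈ gradGraph n F := by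
    intro x
    have e2 : ∀ j, unweight (G (some j)) x = pd j g x := fun j =>
      congrFun (hgj j).unweight_weight x
    have e1 : unweight (G none) = g := hg.1.unweight_weight
    rw [e1, funext e2, ← fderiv_eq_ofPartials]
    exact (hg.2.1 x).hasFDerivAt
  have hcontr : ContractingWith (1 / 2) (hmaps.restrict Φ _ _) := by
    refine ⟨by rw [div_lt_one] <;> norm_num, LipschitzWith.of_dist_le_mul fun φ ψ => ?_⟩
    have := hlip φ ψ
    rw [show ((1 / 2 : NNReal) : ℝ) = 1 / 2 by norm_num]
    exact this
  obtain ⟨φ, hφ, hfix, -⟩ := hcontr.exists_fixedPoint' isClosed_gradGraph.isComplete hmaps hG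
    (edist_ne_top _ _)
  have hf0 : φ none = hg.1.weight - S (φ none) := by
    have := congrFun hfix none
    exact this.symm
  have hu0 : hu.weight = hg.1.weight - S hu.weight := by
    rw [eq_sub_iff_add_eq]
    ext x
    rw [BoundedContinuousFunction.add_apply, hS, potSumOp_apply, hu.unweight_weight, hu.weight_apply,
      hg.1.weight_apply, ← smul_add, he]
  -- Both solve the equation for the zeroth component, and `S` alone is a contraction; hence the
  -- given solution inherits the gradient.
  have heq : hu.weight = φ none := by
    have h2 := hS' hu.weight (φ none)
    have h3 : dist hu.weight (φ none) = dist (S hu.weight) (S (φ none)) := by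
      conv_lhs => rw [hu0, hf0, dist_sub_left]
    have h4 := dist_nonneg (x := hu.weight) (y := φ none)
    exact dist_eq_zero.1 (by linarith)
  have : u = unweight (φ none) := by rw [← heq, hu.unweight_weight]
  rw [this]
  exact iterReg_one_of_hasFDerivAt (growth_unweight _) (fun j => growth_unweight (φ (some j))) hφ

/-- A partial derivative of `u` solves the same equation, with the potentials of `(∂ⱼσ) u` moved to
the right-hand side; these are as regular as `u` is already known to be, so induction applies. -/
lemma iterReg_of_contraction [CompleteSpace F] (hn : n = 2 ∨ n = 3)
    (hκ : ∀ o, KerBound (κ o) (C o))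
    (σ : Option (Fin n) → 𝓢(Space n, F →L[ℝ] F))
    (h0 : ‖potSumOp hn hκ fun o => weightCoef n (F →L[ℝ] F) (σ o)‖ ≤ 1 / 4)
    (h1 : ∀ j, ‖potSumOp hn hκ fun o =>
      weightCoef n (F →L[ℝ] F) (∂_{(EuclideanSpace.single j 1 : Space n)} (σ o))‖ ≤ 1 / 4) {k : ℕ} :
    ∀ {u g : Space n → F} (_ : Growth u) (_ : IterReg Growth k g)
      (_ : ∀ x, u x + potSum κ σ u x = g x), IterReg Growth k u := by
  induction k with
  | zero => exact fun hu _ _ => hu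
  | succ k ih =>
    intro u g hu hg he
    have hr : IterReg Growth 1 u := iterReg_one_of_contraction hn hκ σ h0 h1 hu
      ⟨hg.1, hg.2.1, fun i => (hg.2.2 i).zero⟩ he
    have hk : IterReg Growth k u := ih hu hg.of_succ he
    refine ⟨hu, hr.2.1, fun j => ?_⟩
    refine ih (g := fun x => pd j g x + -potSum κ (fun o =>
      ∂_{(EuclideanSpace.single j 1 : Space n)} (σ o)) u x) (hr.2.2 j)
      ((hg.2.2 j).add (fun _ _ => Growth.add) ((hk.potSum hn hκ _).neg fun _ => Growth.neg)) ?_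
    intro x
    have e : g = fun x => u x + potSum κ σ u x := funext fun x => (he x).symm
    rw [e, pd_add hr.2.1 (hr.potSum hn hκ σ).2.1]
    beta_reduce
    rw [pd_potSum hn hκ σ hr]
    abel

lemma exists_small_factor {J a : ℝ} (hJ : 0 ≤ J) (ha : 0 ≤ a) {b : Fin n → ℝ}
    (hb : ∀ j, 0 ≤ b j) :
    ∃ t : ℝ, 0 < t ∧ t ≤ 1 ∧ J * t * a ≤ 1 / 4 ∧ ∀ j, J * t * b j ≤ 1 / 4 := by
  have hbs : 0 ≤ ∑ j, b j := Finset.sum_nonneg fun j _ => hb j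
  obtain ⟨B, hB⟩ : ∃ B, B = J * (a + ∑ j, b j) := ⟨_, rfl⟩
  have hB0 : 0 ≤ B := by rw [hB]; positivity
  obtain ⟨t, ht⟩ : ∃ t, t = 1 / (4 * (B + 1)) := ⟨_, rfl⟩
  have ht0 : 0 < t := by rw [ht]; positivity
  have htB : B * t ≤ 1 / 4 := by
    rw [ht, mul_one_div, div_le_iff₀ (by positivity)]
    linarith
  refine ⟨t, ht0, ?_, le_trans ?_ htB, fun j => le_trans ?_ htB⟩
  · rw [ht, div_le_one (by positivity)]
    linarith
  · rw [hB, mul_right_comm]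
    gcongr
    linarith
  · have := Finset.single_le_sum (f := b) (fun j _ => hb j) (Finset.mem_univ j)
    rw [hB, mul_right_comm]
    gcongr
    linarith

lemma exists_small_remainder (hn : n = 2 ∨ n = 3) (hL : 0 < L)
    (σ : Option (Fin n) → 𝓢(Space n, F →L[ℝ] F)) :
    ∃ (ε : ℝ) (hε : 0 < ε) (hε1 : ε ≤ 1),
      ‖potSumOp hn (kerBound_ker_sub hn hL hε hε1) fun o => weightCoef n (F →L[ℝ] F) (σ o)‖
        ≤ 1 / 4 ∧
      ∀ j, ‖potSumOp hn (kerBound_ker_sub hn hL hε hε1) fun o =>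
        weightCoef n (F →L[ℝ] F) (∂_{(EuclideanSpace.single j 1 : Space n)} (σ o))‖ ≤ 1 / 4 := by
  have hJ := envMass_nonneg (n := n)
  obtain ⟨t, ht0, ht1, h0, h1⟩ := exists_small_factor (n := n) (J := 32 * envMass n)
    (a := ∑ o, ‖weightCoef n (F →L[ℝ] F) (σ o)‖)
    (b := fun j => ∑ o,
      ‖weightCoef n (F →L[ℝ] F) (∂_{(EuclideanSpace.single j 1 : Space n)} (σ o))‖)
    (by positivity) (Finset.sum_nonneg fun o _ => by positivity)
    (fun j => Finset.sum_nonneg fun o _ => by positivity)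
  have hsq : √(t ^ 2) = t := Real.sqrt_sq ht0.le
  -- The kernel error is `√ε`, so `ε = t²` makes it exactly `t`.
  refine ⟨t ^ 2, by positivity, pow_le_one₀ ht0.le ht1, ?_, fun j => ?_⟩
  · refine (norm_potSumOp_le _ _ _).trans (le_trans (le_of_eq ?_) h0)
    rw [hsq, ← Finset.mul_sum]
  · refine (norm_potSumOp_le _ _ _).trans (le_trans (le_of_eq ?_) (h1 j))
    rw [hsq, ← Finset.mul_sum]

/-- Elliptic regularity: solutions of `u + ∑ₒ kerₒ * (σₒ u) = g` are as regular as `g`. -/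
theorem iterReg_of_integral_equation [CompleteSpace F] (hn : n = 2 ∨ n = 3) (hL : 0 < L)
    (σ : Option (Fin n) → 𝓢(Space n, F →L[ℝ] F)) {k : ℕ} {u g : Space n → F} (hu : Growth u)
    (hg : IterReg Growth k g) (he : ∀ x, u x + potSum (ker L) σ u x = g x) :
    IterReg Growth k u := by
  obtain ⟨ε, hε, hε1, h0, h1⟩ := exists_small_remainder hn hL σ
  -- Only the small singular remainder stays on the left. The regularized part is moved to the
  -- right, where it is as often differentiable as desired although `u` is so far only continuous.
  refine iterReg_of_contraction hn (kerBound_ker_sub hn hL hε hε1) σ h0 h1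
    (g := fun x => g x + -potSum (regKer L ε) σ u x) hu
    (hg.add (fun _ _ => Growth.add) (IterReg.neg (fun _ => Growth.neg)
      (IterReg.sum (fun _ _ => Growth.add) Growth.zero fun o _ =>
        iterReg_pot_regKer hn hL hε hε1 o (hu.decay_mul (σ o)) k))) fun x => ?_
  have : potSum (fun o x => ker L o x - regKer L ε o x) σ u x
      = potSum (ker L) σ u x - potSum (regKer L ε) σ u x := by
    simp only [potSum, ← Finset.sum_sub_distrib]
    refine Finset.sum_congr rfl fun o _ => ?_
    obtain ⟨M, hM⟩ := hu.decay_mul (σ o)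
    exact pot_sub_kernel hn (kerBound_ker hn hL o) (kerBound_regKer hn hL hε hε1 o) hM x
  rw [this, ← he x]
  abel

lemma IterReg.contDiff {k : ℕ} : ∀ {u : Space n → F}, IterReg Growth k u → ContDiff ℝ k u := by
  induction k with
  | zero => exact fun hu => contDiff_zero.2 hu.cont
  | succ k ih =>
    intro u hu
    have : ((k + 1 : ℕ) : WithTop ℕ∞) = k + 1 := by norm_cast
    rw [this, contDiff_succ_iff_fderiv]
    refine ⟨hu.2.1, by simp, ?_⟩
    rw [funext fun x => fderiv_eq_ofPartials u x]
    unfold ofPartials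
    refine ContDiff.sum fun j _ => ?_
    exact (ContinuousLinearMap.smulRightL ℝ (Space n) F
      (EuclideanSpace.proj j : Space n →L[ℝ] ℝ)).contDiff.comp (ih (hu.2.2 j))

end Smoothing

/-! ## Newtonian potentials and the Laplacian -/

section Laplacian

open LineDeriv

variable {n : ℕ} {F : Type*} [NormedAddCommGroup F] [InnerProductSpace ℝ F] {L : ℝ}

/-- The flat Laplacian `∑ᵢ ∂ᵢ ∂ᵢ f`. -/
def lap (f : Space n → F) (x : Space n) : F := ∑ i, pd i (pd i f) x

lemma contDiff_pd {f : Space n → F} (hf : ContDiff ℝ ∞ f) (i : Fin n) : ContDiff ℝ ∞ (pd i f) :=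
  (hf.fderiv_right (m := ∞) (by simp)).clm_apply contDiff_const

lemma HasCompactSupport.pd {f : Space n → F} (hf : HasCompactSupport f) (i : Fin n) :
    HasCompactSupport (pd i f) :=
  hf.fderiv_apply (𝕜 := ℝ) _

lemma pd_comm {f : Space n → F} (hf : ContDiff ℝ 2 f) (i j : Fin n) :
    pd i (pd j f) = pd j (pd i f) := by
  have hd : Differentiable ℝ (fderiv ℝ f) :=
    (hf.fderiv_right (m := 1) (by norm_num)).differentiable (by simp)
  have h : ∀ i j x, pd i (pd j f) x
      = fderiv ℝ (fderiv ℝ f) x (EuclideanSpace.single i 1) (EuclideanSpace.single j 1) := by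
    intro i j x
    have : HasFDerivAt (pd j f) ((ContinuousLinearMap.apply ℝ F (EuclideanSpace.single j (1 : ℝ)))
        ∘L fderiv ℝ (fderiv ℝ f) x) x :=
      (ContinuousLinearMap.apply ℝ F (EuclideanSpace.single j (1 : ℝ))).hasFDerivAt.comp x
        (hd x).hasFDerivAt
    rw [YangMills.pd, this.fderiv]
    rfl
  ext x
  rw [h, h]
  exact hf.contDiffAt.isSymmSndFDerivAt (by simp) _ _

lemma pd_lap {f : Space n → F} (hf : ContDiff ℝ ∞ f) (j : Fin n) :
    pd j (lap f) = lap (pd j f) := by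
  have h2 : ∀ g : Space n → F, ContDiff ℝ ∞ g → ContDiff ℝ 2 g := fun g hg => by
    exact_mod_cast contDiff_infty.1 hg 2
  unfold lap
  rw [pd_sum fun i _ => (contDiff_pd (contDiff_pd hf i) i).differentiable (by simp)]
  ext x
  refine Finset.sum_congr rfl fun i _ => ?_
  rw [pd_comm (h2 _ (contDiff_pd hf i)), pd_comm (h2 _ hf)]

lemma exists_uniform_decayBound {f : Fin n → Space n → F} (h : ∀ i, Decay (f i)) :
    ∃ M, ∀ i, DecayBound (f i) M := by
  choose M hM using h
  exact ⟨∑ i, M i, fun i => (hM i).mono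
    (Finset.single_le_sum (fun j _ => (hM j).nonneg) (Finset.mem_univ i))⟩

lemma pot_newton_lap [CompleteSpace F] (hn : n = 2 ∨ n = 3) (hL : 0 < L) {f : Space n → F}
    (hf : IterReg Decay 2 f) : pot (newton L) (lap f) = f := by
  obtain ⟨M, hM⟩ := hf.1
  obtain ⟨M', hM'⟩ := exists_uniform_decayBound fun i => (hf.2.2 i).1
  obtain ⟨M'', hM''⟩ := exists_uniform_decayBound fun i => (hf.2.2 i).2.2 i
  ext x
  exact pot_newton_laplacian hn hL hM hf.2.1 hM' (fun i => (hf.2.2 i).2.1) hM'' x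

lemma lap_pot_newton [CompleteSpace F] (hn : n = 2 ∨ n = 3) (hL : 0 < L) {f : Space n → F}
    (hf : IterReg Decay 2 f) : lap (pot (newton L) f) = f := by
  have hN := kerBound_newton (n := n) hn hL
  obtain ⟨M'', hM''⟩ := exists_uniform_decayBound fun i => (hf.2.2 i).2.2 i
  have h1 : IterReg Decay 1 f := hf.of_succ
  rw [← pot_newton_lap hn hL hf]
  ext x
  rw [pot_newton_lap hn hL hf]
  conv_rhs => rw [← pot_newton_lap hn hL hf]
  unfold lap
  rw [pot_sum hn hN fun i _ => hM'' i]
  refine Finset.sum_congr rfl fun i _ => ?_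
  rw [pd_pot hn hN h1, pd_pot hn hN (hf.2.2 i)]

lemma integral_smul_pd {η : Space n → ℝ} {f : Space n → F} (hη : ContDiff ℝ ∞ η)
    (hc : HasCompactSupport η) (hf : ContDiff ℝ ∞ f) (i : Fin n) :
    ∫ x, η x • pd i f x = -∫ x, pd i η x • f x := by
  refine integral_smul_fderiv_eq_neg_fderiv_smul_of_integrable (𝕜 := ℝ) ?_ ?_ ?_
    (fun x _ => hη.differentiable (by simp) x) (fun x _ => hf.differentiable (by simp) x)
  · exact Continuous.integrable_of_hasCompactSupport
      ((contDiff_pd hη i).continuous.smul hf.continuous) (HasCompactSupport.pd hc i).smul_right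
  · exact Continuous.integrable_of_hasCompactSupport
      (hη.continuous.smul (contDiff_pd hf i).continuous) hc.smul_right
  · exact Continuous.integrable_of_hasCompactSupport
      (hη.continuous.smul hf.continuous) hc.smul_right

lemma integral_lap_smul {η : Space n → ℝ} {f : Space n → F} (hη : ContDiff ℝ ∞ η)
    (hc : HasCompactSupport η) (hf : ContDiff ℝ ∞ f) :
    ∫ x, lap η x • f x = ∫ x, η x • lap f x := by
  have h1 : ∀ i ∈ Finset.univ, Integrable fun x => pd i (pd i η) x • f x := fun i _ =>
    Continuous.integrable_of_hasCompactSupport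
      ((contDiff_pd (contDiff_pd hη i) i).continuous.smul hf.continuous)
      (HasCompactSupport.pd (HasCompactSupport.pd hc i) i).smul_right
  have h2 : ∀ i ∈ Finset.univ, Integrable fun x => η x • pd i (pd i f) x := fun i _ =>
    Continuous.integrable_of_hasCompactSupport
      (hη.continuous.smul (contDiff_pd (contDiff_pd hf i) i).continuous) hc.smul_right
  simp only [lap, Finset.sum_smul, Finset.smul_sum]
  rw [integral_finsetSum _ h1, integral_finsetSum _ h2]
  refine Finset.sum_congr rfl fun i _ => ?_
  rw [integral_smul_pd hη hc (contDiff_pd hf i),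
    integral_smul_pd (contDiff_pd hη i) (HasCompactSupport.pd hc i) hf, neg_neg]

lemma contDiff_lap {f : Space n → F} (hf : ContDiff ℝ ∞ f) : ContDiff ℝ ∞ (lap f) :=
  ContDiff.sum fun i _ => contDiff_pd (contDiff_pd hf i) i

lemma HasCompactSupport.lap {f : Space n → ℝ} (hc : HasCompactSupport f) :
    HasCompactSupport (lap f) := by
  refine HasCompactSupport.of_support_subset_isCompact hc.isCompact fun x hx => ?_
  by_contra h
  refine hx (Finset.sum_eq_zero fun i _ => ?_)
  by_contra h2
  exact h (((tsupport_fderiv_apply_subset ℝ _).trans (tsupport_fderiv_apply_subset ℝ _))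
    (subset_tsupport _ h2))

lemma iterReg_of_hasCompactSupport {η : Space n → ℝ} (hη : ContDiff ℝ ∞ η)
    (hc : HasCompactSupport η) (k : ℕ) : IterReg Decay k η :=
  iterReg_schwartz (hc.toSchwartzMap hη) k

/-- The even kernel is transposed onto the test function, where `N * Δη = η`; no derivative of `f`
is needed. -/
lemma integral_lap_smul_pot_newton [CompleteSpace F] (hn : n = 2 ∨ n = 3) (hL : 0 < L)
    {η : Space n → ℝ} {f : Space n → F} (hη : ContDiff ℝ ∞ η) (hc : HasCompactSupport η)
    (hf : Decay f) : ∫ x, lap η x • pot (newton L) f x = ∫ x, η x • f x := by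
  obtain ⟨M, hM⟩ := hf
  obtain ⟨M', hM'⟩ := (iterReg_of_hasCompactSupport (contDiff_lap hη) (HasCompactSupport.lap hc) 0).zero
  have h := integral_bilin_pot hn (kerBound_newton hn hL) hM hM' (ContinuousLinearMap.lsmul ℝ ℝ)
  simp only [newton_neg] at h
  have e : pot (fun z => newton L z) (lap η) = η :=
    pot_newton_lap hn hL (iterReg_of_hasCompactSupport hη hc 2)
  rw [e] at h
  exact h

/-- The gradient kernel is odd, so transposition gives `-∂ᵢη`, and the sign disappears on
integrating by parts. -/
lemma integral_lap_smul_pot_newtonGrad [CompleteSpace F] (hn : n = 2 ∨ n = 3) (i : Fin n)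
    {η : Space n → ℝ} {f : Space n → F} (hη : ContDiff ℝ ∞ η) (hc : HasCompactSupport η)
    (hf : Decay f) (hfs : ContDiff ℝ ∞ f) :
    ∫ x, lap η x • pot (newtonGrad i) f x = ∫ x, η x • pd i f x := by
  obtain ⟨M, hM⟩ := hf
  have hr := iterReg_of_hasCompactSupport (contDiff_lap hη) (HasCompactSupport.lap hc) 1
  obtain ⟨M', hM'⟩ := hr.1
  obtain ⟨M'', hM''⟩ := hr.2.2 i
  have h := integral_bilin_pot hn (kerBound_newtonGrad i) hM hM' (ContinuousLinearMap.lsmul ℝ ℝ)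
  have e : pot (fun z => newtonGrad i (-z)) (lap η) = fun x => -pd i η x := by
    ext x
    -- Any reference length will do, since the gradient kernel does not depend on it.
    have h1 := pot_newton_pd hn (one_pos) i hM' hr.2.1 hM'' x
    rw [pd_lap hη, pot_newton_lap hn one_pos (iterReg_of_hasCompactSupport (contDiff_pd hη i)
      (HasCompactSupport.pd hc i) 2)] at h1
    simp only [newtonGrad_neg]
    rw [h1]
    simp only [pot, neg_smul, integral_neg]
  rw [e] at h
  refine h.trans ?_
  rw [integral_smul_pd hη hc hfs, ← integral_neg]
  simp

end Laplacian

/-! ## The covariant Laplacian as a perturbation of the flat one -/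

section Covariant

open LineDeriv BoundedContinuousFunction

variable {n : ℕ} {𝔤 : Type*} [NormedAddCommGroup 𝔤] [InnerProductSpace ℝ 𝔤]
  [AdInvariantLieAlgebra 𝔤] [FiniteDimensional ℝ 𝔤] {L : ℝ}

/-- The bracket as a continuous bilinear map. -/
def adL (𝔤 : Type*) [NormedAddCommGroup 𝔤] [InnerProductSpace ℝ 𝔤]
    [AdInvariantLieAlgebra 𝔤] [FiniteDimensional ℝ 𝔤] : 𝔤 →L[ℝ] 𝔤 →L[ℝ] 𝔤 :=
  LinearMap.toContinuousLinearMap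
    ((LinearMap.toContinuousLinearMap (𝕜 := ℝ) (E := 𝔤) (F' := 𝔤)).toLinearMap ∘ₗ
      LinearMap.mk₂ ℝ (fun x y : 𝔤 => ⁅x, y⁆) AdInvariantLieAlgebra.add_bracket
        AdInvariantLieAlgebra.smul_bracket AdInvariantLieAlgebra.bracket_add
        AdInvariantLieAlgebra.bracket_smul)

lemma adL_apply (x y : 𝔤) : adL 𝔤 x y = ⁅x, y⁆ := rfl

/-- `ad Aᵢ` as an operator-valued Schwartz function. -/
def adS (f : 𝓢(Space n, 𝔤)) : 𝓢(Space n, 𝔤 →L[ℝ] 𝔤) := SchwartzMap.postcompCLM (adL 𝔤) f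

/-- The coefficients of the first and zeroth order terms of the covariant Laplacian. -/
def lapCoef (A : Conn n 𝔤) : Option (Fin n) → 𝓢(Space n, 𝔤 →L[ℝ] 𝔤)
  | none => ∑ i, (SchwartzMap.pairing (ContinuousLinearMap.compL ℝ 𝔤 𝔤 𝔤) (adS (A i)) (adS (A i))
      - adS (∂_{(EuclideanSpace.single i 1 : Space n)} (A i)))
  | some i => (2 : ℝ) • adS (A i)

lemma lapCoef_none_apply (A : Conn n 𝔤) (x : Space n) (v : 𝔤) :
    lapCoef A none x v = ∑ i, (⁅A i x, ⁅A i x, v⁆⁆ - ⁅pd i (A i) x, v⁆) := by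
  simp only [lapCoef, _root_.sum_apply]
  rfl

/-- The first-order part is put in divergence form `∂ᵢ(2 [Aᵢ, u])`, so that convolution with `N`
moves the derivative to the kernel and the integral equation contains only `u`. The zeroth-order
coefficient compensates with `-[∂ᵢAᵢ, ·]`. -/
lemma covLap_eq (A : Conn n 𝔤) {u : Space n → 𝔤} (hu : Differentiable ℝ u)
    (hu' : ∀ i, Differentiable ℝ (pd i u)) (x : Space n) :
    covLap A u x = lap u x + ∑ i, pd i (fun y => lapCoef A (some i) y (u y)) x
      + lapCoef A none x (u x) := by
  rw [lapCoef_none_apply, lap, covLap, ← Finset.sum_add_distrib, ← Finset.sum_add_distrib]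
  refine Finset.sum_congr rfl fun i _ => ?_
  have h1 : covD A i u = fun y => pd i u y + adS (A i) y (u y) := rfl
  have h2 : pd i (covD A i u) x
      = pd i (pd i u) x + (⁅pd i (A i) x, u x⁆ + ⁅A i x, pd i u x⁆) := by
    rw [h1, pd_add (hu' i) (differentiable_mul _ hu), pd_mul _ hu]
    have : ∂_{(EuclideanSpace.single i 1 : Space n)} (adS (A i))
      = adS (∂_{(EuclideanSpace.single i 1 : Space n)} (A i)) := by
      ext1 y
      change fderiv ℝ (fun y => adL 𝔤 (A i y)) y (EuclideanSpace.single i 1) = _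
      have h : HasFDerivAt (fun y => adL 𝔤 (A i y)) (adL 𝔤 ∘L fderiv ℝ (A i) y) y :=
        (adL 𝔤).hasFDerivAt.comp y ((A i).hasFDerivAt y)
      rw [h.fderiv]
      rfl
    rw [this]
    rfl
  have h3 : pd i (fun y => lapCoef A (some i) y (u y)) x
      = (2 : ℝ) • (⁅pd i (A i) x, u x⁆ + ⁅A i x, pd i u x⁆) := by
    rw [pd_mul _ hu]
    have : ∂_{(EuclideanSpace.single i 1 : Space n)} (lapCoef A (some i))
      = (2 : ℝ) • adS (∂_{(EuclideanSpace.single i 1 : Space n)} (A i)) := by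
      ext1 y
      change fderiv ℝ (fun y => (2 : ℝ) • adL 𝔤 (A i y)) y (EuclideanSpace.single i 1) = _
      have h : HasFDerivAt (fun y => (2 : ℝ) • adL 𝔤 (A i y))
          ((2 : ℝ) • adL 𝔤 ∘L fderiv ℝ (A i) y) y :=
        ((adL 𝔤).hasFDerivAt.comp y ((A i).hasFDerivAt y)).const_smul (2 : ℝ)
      rw [h.fderiv]
      rfl
    rw [this, smul_add]
    rfl
  rw [covD, h2, h3, covD, AdInvariantLieAlgebra.bracket_add]
  module

lemma GreenAsymptotics.growth {u : Space n → 𝔤} (hL : 0 < L) (hc : Continuous u)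
    (hu : GreenAsymptotics L u) : Growth u := by
  obtain ⟨K, hK⟩ := exists_norm_le_wt_of_tendsto hc (hu.tendsto_inv_norm_smul hL)
  refine ⟨hc, |K|, fun x => (hK x).trans ?_⟩
  have := wt_pos x
  have h1 : wt x ≤ wt x ^ 6 := le_self_pow₀ (one_le_wt x) (by norm_num)
  have := le_abs_self K
  gcongr

lemma GreenAsymptotics.zero : GreenAsymptotics L fun _ : Space n => (0 : 𝔤) :=
  GreenAsymptotics.of_tendsto_zero tendsto_const_nhds

lemma GreenAsymptotics.sum {ι : Type*} {s : Finset ι} {u : ι → Space n → 𝔤}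
    (h : ∀ i ∈ s, GreenAsymptotics L (u i)) : GreenAsymptotics L fun x => ∑ i ∈ s, u i x := by
  classical
  induction s using Finset.induction_on with
  | empty => simpa using GreenAsymptotics.zero
  | insert i s hi ih =>
    simp only [Finset.sum_insert hi]
    exact (h i (Finset.mem_insert_self i s)).add
      (ih fun j hj => h j (Finset.mem_insert_of_mem hj))

lemma greenAsymptotics_potSum (hn : n = 2 ∨ n = 3) (hL : 0 < L)
    (σ : Option (Fin n) → 𝓢(Space n, 𝔤 →L[ℝ] 𝔤)) {u : Space n → 𝔤} (hu : Growth u) :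
    GreenAsymptotics L (potSum (ker L) σ u) := by
  refine GreenAsymptotics.sum fun o _ => ?_
  obtain ⟨M, hM⟩ := hu.decay_mul (σ o)
  cases o with
  | none => exact greenAsymptotics_pot_newton hn hL hM
  | some i => exact greenAsymptotics_pot_newtonGrad hn i hM

/-- Solutions of the covariant Poisson equation with the behaviour of the flat Green function at
infinity satisfy the integral equation `u + ∑ₒ kerₒ * (σₒ u) = N * h`. -/
theorem IsGreenSolution.integral_equation (hn : n = 2 ∨ n = 3) (hL : 0 < L) {A : Conn n 𝔤}
    {h u : Space n → 𝔤} (hh : Decay h) (hu : IsGreenSolution L A h u) :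
    Growth u ∧ ∀ x, u x + potSum (ker L) (lapCoef A) u x = pot (newton L) h x := by
  obtain ⟨hs, he, ha⟩ := hu
  have hg : Growth u := ha.growth hL hs.continuous
  refine ⟨hg, ?_⟩
  set f : Option (Fin n) → Space n → 𝔤 := fun o y => lapCoef A o y (u y) with hf
  have hfd : ∀ o, Decay (f o) := fun o => hg.decay_mul _
  have hfs : ∀ o, ContDiff ℝ ∞ (f o) := fun o => ((lapCoef A o).smooth ⊤).clm_apply hs
  have hpc : ∀ o, Continuous (pot (ker L o) (f o)) := fun o =>
    ((hfd o).growth_pot hn (kerBound_ker hn hL o)).cont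
  have hhc : Continuous (pot (newton L) h) := (hh.growth_pot hn (kerBound_newton hn hL)).cont
  have hhcc : Continuous h := hh.choose_spec.cont
  -- The defect of the integral equation: it is weakly harmonic and has Green asymptotics, hence is
  -- constant and then zero.
  set q : Space n → 𝔤 := fun x => u x + (∑ o, pot (ker L o) (f o) x) + -pot (newton L) h x with hq
  have hqc : Continuous q := (hs.continuous.add (continuous_finsetSum _ fun o _ => hpc o)).add hhc.neg
  have hqa : GreenAsymptotics L q := by
    obtain ⟨M, hM⟩ := hh
    exact (ha.add (greenAsymptotics_potSum hn hL (lapCoef A) hg)).add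
      (greenAsymptotics_pot_newton hn hL hM).neg
  have hw : WeaklyHarmonic q := by
    intro η hη hc
    change ∫ y, lap η y • q y = 0
    have hlc : Continuous (lap η) := (contDiff_lap hη).continuous
    have hls : HasCompactSupport (lap η) := HasCompactSupport.lap hc
    have hint : ∀ g : Space n → 𝔤, Continuous g → Integrable fun y => lap η y • g y := fun g hg =>
      Continuous.integrable_of_hasCompactSupport (hlc.smul hg) hls.smul_right
    have hint' : ∀ g : Space n → 𝔤, Continuous g → Integrable fun y => η y • g y := fun g hg =>
      Continuous.integrable_of_hasCompactSupport (hη.continuous.smul hg) hc.smul_right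
    have i1 := hint _ hs.continuous
    have i2 : Integrable fun y => ∑ o, lap η y • pot (ker L o) (f o) y :=
      integrable_finsetSum _ fun o _ => hint _ (hpc o)
    have i12 : Integrable fun y => lap η y • u y + ∑ o, lap η y • pot (ker L o) (f o) y := i1.add i2
    have i3 : Integrable fun y => -(lap η y • pot (newton L) h y) := (hint _ hhc).neg
    simp only [hq, smul_add, Finset.smul_sum, smul_neg]
    rw [integral_add i12 i3, integral_add i1 i2, integral_neg,
      integral_finsetSum _ fun o _ => hint _ (hpc o), Fintype.sum_option,
      integral_lap_smul hη hc hs, integral_lap_smul_pot_newton hn hL hη hc hh]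
    have e0 : ∫ x, lap η x • pot (ker L none) (f none) x = ∫ x, η x • f none x :=
      integral_lap_smul_pot_newton hn hL hη hc (hfd none)
    have e1 : ∀ i, ∫ x, lap η x • pot (ker L (some i)) (f (some i)) x
        = ∫ x, η x • pd i (f (some i)) x := fun i =>
      integral_lap_smul_pot_newtonGrad hn i hη hc (hfd (some i)) (hfs (some i))
    simp only [e0, e1]
    have j0 := hint' _ (hfs none).continuous
    have j1 : ∀ i ∈ Finset.univ, Integrable fun y => η y • pd i (f (some i)) y := fun i _ =>
      hint' _ (contDiff_pd (hfs (some i)) i).continuous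
    have j2 := hint' _ (contDiff_lap hs).continuous
    have j01 : Integrable fun y => η y • f none y + ∑ i, η y • pd i (f (some i)) y :=
      j0.add (integrable_finsetSum _ j1)
    rw [← integral_finsetSum _ j1, ← integral_add j0 (integrable_finsetSum _ j1),
      ← integral_add j2 j01, ← sub_eq_add_neg, sub_eq_zero]
    refine integral_congr_ae (Eventually.of_forall fun x => ?_)
    simp only [← Finset.smul_sum, ← smul_add]
    rw [← he x, covLap_eq A (hs.differentiable (by simp))
      fun i => (contDiff_pd hs i).differentiable (by simp)]
    congr 1
    abel
  have hc := hw.eq_const hn hqc (hqa.tendsto_inv_norm_smul hL)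
  have h0 : q 0 = 0 := by
    rw [funext hc] at hqa
    exact hqa.eq_zero_of_const hn hL
  intro x
  have h1 := hc x
  rw [h0, hq] at h1
  exact eq_of_sub_eq_zero (by rw [sub_eq_add_neg]; exact h1)

/-- Solutions of the integral equation solve the covariant Poisson equation; they are smooth and
Newtonian potentials of their Laplacians. -/
theorem regularity_of_integral_equation (hn : n = 2 ∨ n = 3) (hL : 0 < L) {A : Conn n 𝔤}
    {u : Space n → 𝔤} (h : 𝓢(Space n, 𝔤)) (hg : Growth u)
    (he : ∀ x, u x + potSum (ker L) (lapCoef A) u x = pot (newton L) h x) :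
    IsGreenSolution L A h u ∧ (∀ k, IterReg Growth k u) ∧ Decay (lap u) ∧
      u = pot (newton L) (lap u) := by
  have hN := kerBound_newton (n := n) hn hL
  have hr : ∀ k, IterReg Growth k u := fun k =>
    iterReg_of_integral_equation hn hL (lapCoef A) hg
      ((iterReg_schwartz h k).pot hn hN) he
  have hs : ContDiff ℝ ∞ u := contDiff_infty.2 fun k => (hr k).contDiff
  have hpot : ∃ F, IterReg Decay 2 F ∧ u = pot (newton L) F ∧ ∀ x, h x = F x +
      (lapCoef A none x (u x) + ∑ i, pd i (fun y => lapCoef A (some i) y (u y)) x) := by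
    have hf : ∀ o k, IterReg Decay k fun y => lapCoef A o y (u y) := fun o k => (hr k).mul _
    -- The value `Δu` must have; once `u = N * F` is known, `Δu = F` follows and the differential
    -- equation with it.
    set F : Space n → 𝔤 := fun y => h y + -(lapCoef A none y (u y)
      + ∑ i, pd i (fun y => lapCoef A (some i) y (u y)) y) with hF
    have hneg : ∀ u : Space n → 𝔤, Decay u → Decay fun x => -u x := fun u ⟨M, hM⟩ => ⟨M, hM.neg⟩
    have hFr : IterReg Decay 2 F :=
      (iterReg_schwartz h 2).add (fun _ _ => Decay.add) (((hf none 2).add (fun _ _ => Decay.add)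
        (IterReg.sum (fun _ _ => Decay.add) Decay.zero fun i _ => (hf (some i) 3).2.2 i)).neg hneg)
    have hu : u = pot (newton L) F := by
      ext x
      obtain ⟨M, hM⟩ := (iterReg_schwartz h 0).zero
      obtain ⟨M0, hM0⟩ := (hf none 0).zero
      choose M1 hM1 using fun i => ((hf (some i) 1).2.2 i).zero
      choose M2 hM2 using fun i => (hf (some i) 1).1
      -- With regularity established, the derivatives can be moved from the kernel back onto the
      -- densities.
      have e1 : ∀ i, pot (newton L) (pd i fun y => lapCoef A (some i) y (u y)) x
          = pot (newtonGrad i) (fun y => lapCoef A (some i) y (u y)) x := fun i =>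
        pot_newton_pd hn hL i (hM2 i) (hf (some i) 1).2.1 (hM1 i) x
      rw [hF, pot_add hn hN hM (hM0.add (DecayBound.sum fun i _ => hM1 i)).neg, pot_neg,
        pot_add hn hN hM0 (DecayBound.sum fun i _ => hM1 i), pot_sum hn hN fun i _ => hM1 i]
      simp only [e1]
      rw [← he x, potSum, Fintype.sum_option]
      simp only [ker]
      abel
    exact ⟨F, hFr, hu, fun x => (neg_add_cancel_right (h x) _).symm⟩
  obtain ⟨F, hFr, hu, hF⟩ := hpot
  have hl : lap u = F := by
    conv_lhs => rw [hu]
    exact lap_pot_newton hn hL hFr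
  refine ⟨⟨hs, fun x => ?_, ?_⟩, hr, hl ▸ hFr.zero, by rw [hl]; exact hu⟩
  · rw [covLap_eq A (hs.differentiable (by simp))
      fun i => (contDiff_pd hs i).differentiable (by simp), hl, hF x]
    abel
  · obtain ⟨M, hM⟩ := (iterReg_schwartz h 0).zero
    have : u = fun x => pot (newton L) h x + -potSum (ker L) (lapCoef A) u x := by
      ext x
      rw [← he x]
      abel
    rw [this]
    exact (greenAsymptotics_pot_newton hn hL hM).add (greenAsymptotics_potSum hn hL _ hg).neg

lemma IsGreenSolution.regularity (hn : n = 2 ∨ n = 3) (hL : 0 < L) {A : Conn n 𝔤}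
    {h : 𝓢(Space n, 𝔤)} {u : Space n → 𝔤} (hu : IsGreenSolution L A h u) :
    (∀ k, IterReg Growth k u) ∧ Decay (lap u) ∧ u = pot (newton L) (lap u) := by
  obtain ⟨hg, he⟩ := hu.integral_equation hn hL (exists_decayBound_of_schwartz h)
  exact (regularity_of_integral_equation hn hL h hg he).2

lemma IsGreenSolution.norm_le (hL : 0 < L) {A : Conn n 𝔤} {h u : Space n → 𝔤}
    (hu : IsGreenSolution L A h u) : ∃ K, ∀ x, ‖u x‖ ≤ K * wt x :=
  exists_norm_le_wt_of_tendsto hu.1.continuous (hu.2.2.tendsto_inv_norm_smul hL)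

end Covariant

/-! ## Invertibility of the covariant Laplacian -/

section Invertibility

open LineDeriv BoundedContinuousFunction

variable {n : ℕ} {𝔤 : Type*} [NormedAddCommGroup 𝔤] [InnerProductSpace ℝ 𝔤]
  [AdInvariantLieAlgebra 𝔤] [FiniteDimensional ℝ 𝔤] {L : ℝ}

/-- The weighted coefficients of the covariant Laplacian. -/
def lapWeight (A : Conn n 𝔤) : Option (Fin n) → Space n →ᵇ (𝔤 →L[ℝ] 𝔤) := fun o =>
  weightCoef n (𝔤 →L[ℝ] 𝔤) (lapCoef A o)

/-- The operator `φ ↦ wt⁻⁶ ∑ₒ kerₒ * (σₒ wt⁶ φ)`, where `σ` are the coefficients of `Δ_A`. -/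
def lapOp (hn : n = 2 ∨ n = 3) (hL : 0 < L) (A : Conn n 𝔤) :
    (Space n →ᵇ 𝔤) →L[ℝ] (Space n →ᵇ 𝔤) :=
  kerOp hn hL (lapWeight A)

lemma lapOp_apply (hn : n = 2 ∨ n = 3) (hL : 0 < L) (A : Conn n 𝔤) (φ : Space n →ᵇ 𝔤)
    (x : Space n) :
    lapOp hn hL A φ x = (wt x ^ 6)⁻¹ • potSum (ker L) (lapCoef A) (unweight φ) x := by
  rw [lapOp, kerOp_eq]
  exact potSumOp_apply hn (kerBound_ker hn hL) (lapCoef A) φ x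

/-- The Newtonian potential `h ↦ wt⁻⁶ (N * h)`. -/
def newtonOp (hn : n = 2 ∨ n = 3) (hL : 0 < L) : 𝓢(Space n, 𝔤) →L[ℝ] (Space n →ᵇ 𝔤) :=
  potOp hn (kerBound_newton hn hL) ∘L SchwartzMap.toBoundedContinuousFunctionCLM ℝ (Space n) 𝔤 ∘L
    SchwartzMap.smulLeftCLM 𝔤 fun x : Space n => wt x ^ 5

lemma newtonOp_apply (hn : n = 2 ∨ n = 3) (hL : 0 < L) (h : 𝓢(Space n, 𝔤)) (x : Space n) :
    newtonOp hn hL h x = (wt x ^ 6)⁻¹ • pot (newton L) h x := by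
  change (wt x ^ 6)⁻¹ • pot (newton L) (fun y => (wt y ^ 5)⁻¹ •
    SchwartzMap.smulLeftCLM 𝔤 (fun x : Space n => wt x ^ 5) h y) x = _
  congr 2
  ext y
  rw [SchwartzMap.smulLeftCLM_apply_apply (hasTemperateGrowth_wt_pow 5), smul_smul,
    inv_mul_cancel₀ (pow_pos (wt_pos y) 5).ne', one_smul]

lemma integral_equation_iff (hn : n = 2 ∨ n = 3) (hL : 0 < L) (A : Conn n 𝔤) (h : 𝓢(Space n, 𝔤))
    (φ : Space n →ᵇ 𝔤) :
    (∀ x, unweight φ x + potSum (ker L) (lapCoef A) (unweight φ) x = pot (newton L) h x) ↔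
      φ + lapOp hn hL A φ = newtonOp hn hL h := by
  rw [BoundedContinuousFunction.ext_iff]
  refine forall_congr' fun x => ?_
  rw [BoundedContinuousFunction.add_apply, lapOp_apply, newtonOp_apply, ← inv_smul_unweight φ,
    ← smul_add, smul_right_inj (inv_ne_zero (pow_pos (wt_pos x) 6).ne')]

lemma isGreenSolution_iff (hn : n = 2 ∨ n = 3) (hL : 0 < L) (A : Conn n 𝔤) (h : 𝓢(Space n, 𝔤))
    (u : Space n → 𝔤) : IsGreenSolution L A h u ↔
      ∃ φ : Space n →ᵇ 𝔤, u = unweight φ ∧ φ + lapOp hn hL A φ = newtonOp hn hL h := by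
  constructor
  · intro hu
    obtain ⟨hg, he⟩ := hu.integral_equation hn hL (exists_decayBound_of_schwartz h)
    refine ⟨hg.weight, hg.unweight_weight.symm, ?_⟩
    rw [← integral_equation_iff, hg.unweight_weight]
    exact he
  · rintro ⟨φ, rfl, he⟩
    exact (regularity_of_integral_equation hn hL h (growth_unweight φ)
      ((integral_equation_iff hn hL A h φ).2 he)).1

lemma unweight_injective : Function.Injective (unweight : (Space n →ᵇ 𝔤) → Space n → 𝔤) := by
  intro φ ψ h
  ext x
  rw [← inv_smul_unweight φ, ← inv_smul_unweight ψ, h]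

lemma unweight_zero : unweight (0 : Space n →ᵇ 𝔤) = 0 := by
  ext x
  simp [unweight]

lemma lapInvertible_of_injective (hn : n = 2 ∨ n = 3) (hL : 0 < L) {A : Conn n 𝔤}
    (h : ∀ u, IsGreenSolution L A (0 : 𝓢(Space n, 𝔤)) u → u = 0) :
    IsUnit (1 + lapOp hn hL A) := by
  refine isUnit_one_add_of_isCompactOperator (isCompactOperator_kerOp hn hL _) fun φ hφ => ?_
  have := h (unweight φ) ((isGreenSolution_iff hn hL A 0 _).2 ⟨φ, rfl, by rw [hφ, map_zero]⟩)
  rw [← unweight_zero] at this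
  exact unweight_injective this

/-- `Δ_A⁻¹ h = wt⁶ (1 + T_A)⁻¹ (wt⁻⁶ N * h)`. -/
lemma existsUnique_of_isUnit (hn : n = 2 ∨ n = 3) (hL : 0 < L) {A : Conn n 𝔤}
    (hu : IsUnit (1 + lapOp hn hL A)) (h : 𝓢(Space n, 𝔤)) (u : Space n → 𝔤) :
    IsGreenSolution L A h u ↔
      u = unweight (Ring.inverse (1 + lapOp hn hL A) (newtonOp hn hL h)) := by
  rw [isGreenSolution_iff hn hL]
  have h1 := Ring.inverse_mul_cancel _ hu
  have h2 := Ring.mul_inverse_cancel _ hu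
  constructor
  · rintro ⟨φ, rfl, he⟩
    rw [← he]
    have := congrArg (fun T : (Space n →ᵇ 𝔤) →L[ℝ] (Space n →ᵇ 𝔤) => T φ) h1
    exact congrArg unweight this.symm
  · rintro rfl
    refine ⟨_, rfl, ?_⟩
    exact congrArg (fun T : (Space n →ᵇ 𝔤) →L[ℝ] (Space n →ᵇ 𝔤) => T (newtonOp hn hL h)) h2

/-- Uniqueness for the zero right-hand side makes `1 + T_A` injective, and the Fredholm alternative
upgrades this to invertibility; a unit solves the equation uniquely for every Schwartz function. -/
theorem lapInvertible_iff (hn : n = 2 ∨ n = 3) (hL : 0 < L) (A : Conn n 𝔤) :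
    LapInvertible L A ↔ IsUnit (1 + lapOp hn hL A) := by
  constructor
  · intro hA
    refine lapInvertible_of_injective hn hL fun u hu => (hA 0).unique hu ?_
    rw [isGreenSolution_iff hn hL]
    exact ⟨0, unweight_zero.symm, by simp⟩
  · intro hu h
    exact ⟨_, (existsUnique_of_isUnit hn hL hu h _).2 rfl, fun v hv =>
      (existsUnique_of_isUnit hn hL hu h v).1 hv⟩

lemma invLap_eq (hn : n = 2 ∨ n = 3) (hL : 0 < L) {A : Conn n 𝔤}
    (hu : IsUnit (1 + lapOp hn hL A)) (h : 𝓢(Space n, 𝔤)) :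
    invLap L A h = unweight (Ring.inverse (1 + lapOp hn hL A) (newtonOp hn hL h)) := by
  have hex : ∃ u, IsGreenSolution L A h u := ⟨_, (existsUnique_of_isUnit hn hL hu h _).2 rfl⟩
  rw [invLap, dif_pos hex]
  exact (existsUnique_of_isUnit hn hL hu h _).1 hex.choose_spec

lemma isGreenSolution_invLap {A : Conn n 𝔤} (hA : LapInvertible L A) (h : 𝓢(Space n, 𝔤)) :
    IsGreenSolution L A h (invLap L A h) := by
  have hex := (hA h).exists
  rw [invLap, dif_pos hex]
  exact hex.choose_spec

/-! ### Dependence on the connection -/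

/-- `A ↦ wt¹¹ ad Aᵢ`. -/
def weightAd (i : Fin n) : Conn n 𝔤 →L[ℝ] (Space n →ᵇ (𝔤 →L[ℝ] 𝔤)) :=
  weightCoef n (𝔤 →L[ℝ] 𝔤) ∘L SchwartzMap.postcompCLM (adL 𝔤) ∘L ContinuousLinearMap.proj i

/-- `A ↦ ad Aᵢ`. -/
def boundedAd (i : Fin n) : Conn n 𝔤 →L[ℝ] (Space n →ᵇ (𝔤 →L[ℝ] 𝔤)) :=
  SchwartzMap.toBoundedContinuousFunctionCLM ℝ (Space n) (𝔤 →L[ℝ] 𝔤) ∘L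
    SchwartzMap.postcompCLM (adL 𝔤) ∘L ContinuousLinearMap.proj i

/-- `A ↦ wt¹¹ ad ∂ᵢAᵢ`. -/
def weightDivAd (i : Fin n) : Conn n 𝔤 →L[ℝ] (Space n →ᵇ (𝔤 →L[ℝ] 𝔤)) :=
  weightCoef n (𝔤 →L[ℝ] 𝔤) ∘L SchwartzMap.postcompCLM (adL 𝔤) ∘L
    lineDerivOpCLM ℝ 𝓢(Space n, 𝔤) (EuclideanSpace.single i 1 : Space n) ∘L
    ContinuousLinearMap.proj i

/-- Pointwise composition of operator-valued functions. -/
def coefMul (n : ℕ) (F : Type*) [NormedAddCommGroup F] [NormedSpace ℝ F] :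
    (Space n →ᵇ (F →L[ℝ] F)) →L[ℝ] (Space n →ᵇ (F →L[ℝ] F)) →L[ℝ] (Space n →ᵇ (F →L[ℝ] F)) :=
  ContinuousLinearMap.mul ℝ (Space n →ᵇ (F →L[ℝ] F))

lemma coefMul_apply {F : Type*} [NormedAddCommGroup F] [NormedSpace ℝ F]
    (a c : Space n →ᵇ (F →L[ℝ] F)) (x : Space n) : coefMul n F a c x = a x * c x := rfl

lemma lapWeight_some (A : Conn n 𝔤) (i : Fin n) :
    lapWeight A (some i) = ((2 : ℝ) • weightAd i) A := by
  change weightCoef n (𝔤 →L[ℝ] 𝔤) ((2 : ℝ) • adS (A i)) = _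
  rw [map_smul]
  rfl

/-- In the quadratic term one factor carries the whole weight and the other is merely bounded, which
exhibits the coefficient as a continuous polynomial in `A`. -/
lemma lapWeight_none (A : Conn n 𝔤) :
    lapWeight A none
      = ∑ i, (coefMul n 𝔤 (weightAd i A) (boundedAd i A) - weightDivAd i A) := by
  change weightCoef n (𝔤 →L[ℝ] 𝔤) (lapCoef A none) = _
  rw [lapCoef, map_sum]
  refine Finset.sum_congr rfl fun i _ => ?_
  rw [map_sub]
  refine congrArg₂ (· - ·) ?_ rfl
  ext1 x
  rw [weightCoef_apply, coefMul_apply]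
  change _ = weightCoef n (𝔤 →L[ℝ] 𝔤) (adS (A i)) x * adS (A i) x
  rw [weightCoef_apply, smul_mul_assoc]
  rfl

section Polynomial

variable {T X : Type*} [AddCommGroup T] [Module ℝ T] [TopologicalSpace T]
  [NormedAddCommGroup X] [NormedSpace ℝ X]

lemma contDiff_linear_plane (l : T →L[ℝ] X) (A P Q : T) :
    ContDiff ℝ 2 fun s : ℝ × ℝ => l (A + (s.1 • P + s.2 • Q)) := by
  simp only [map_add, map_smul]
  fun_prop

lemma contDiff_quadratic_plane {ι : Type*} [Fintype ι] (B : X →L[ℝ] X →L[ℝ] X)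
    (l₁ l₂ l₃ : ι → T →L[ℝ] X) (A P Q : T) :
    ContDiff ℝ 2 fun s : ℝ × ℝ => ∑ i, (B (l₁ i (A + (s.1 • P + s.2 • Q)))
      (l₂ i (A + (s.1 • P + s.2 • Q))) - l₃ i (A + (s.1 • P + s.2 • Q))) :=
  ContDiff.sum fun i _ => ((B.contDiff.comp (contDiff_linear_plane (l₁ i) A P Q)).clm_apply
    (contDiff_linear_plane (l₂ i) A P Q)).sub (contDiff_linear_plane (l₃ i) A P Q)

lemma continuous_quadratic {ι : Type*} [Fintype ι] (B : X →L[ℝ] X →L[ℝ] X)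
    (l₁ l₂ l₃ : ι → T →L[ℝ] X) :
    Continuous fun A => ∑ i, (B (l₁ i A) (l₂ i A) - l₃ i A) := by
  fun_prop

lemma quadratic_zero {ι : Type*} [Fintype ι] (B : X →L[ℝ] X →L[ℝ] X)
    (l₁ l₂ l₃ : ι → T →L[ℝ] X) : ∑ i, (B (l₁ i 0) (l₂ i 0) - l₃ i 0) = 0 := by
  simp

end Polynomial

lemma continuous_lapWeight : Continuous (lapWeight : Conn n 𝔤 → _) := by
  refine continuous_pi fun o => ?_
  cases o with
  | none =>
    simp only [lapWeight_none]
    exact continuous_quadratic (coefMul n 𝔤) weightAd boundedAd weightDivAd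
  | some i =>
    simp only [lapWeight_some]
    exact ((2 : ℝ) • weightAd i).continuous

lemma contDiff_lapWeight (A P Q : Conn n 𝔤) :
    ContDiff ℝ 2 fun s : ℝ × ℝ => lapWeight (A + (s.1 • P + s.2 • Q)) := by
  refine contDiff_pi.2 fun o => ?_
  cases o with
  | none =>
    simp only [lapWeight_none]
    exact contDiff_quadratic_plane (coefMul n 𝔤) weightAd boundedAd weightDivAd A P Q
  | some i =>
    simp only [lapWeight_some]
    exact contDiff_linear_plane ((2 : ℝ) • weightAd i) A P Q

/-- `A ↦ 1 + T_A` is continuous in the Schwartz topology and the units of a Banach algebra are open.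
-/
lemma eventually_lapInvertible (hn : n = 2 ∨ n = 3) (hL : 0 < L) {A : Conn n 𝔤}
    (hA : LapInvertible L A) : ∀ᶠ B in 𝓝 A, LapInvertible L B := by
  simp only [lapInvertible_iff hn hL] at hA ⊢
  have hc : Continuous fun B : Conn n 𝔤 => 1 + lapOp hn hL B :=
    continuous_const.add ((kerOp hn hL).continuous.comp continuous_lapWeight)
  have ho : IsOpen {T : (Space n →ᵇ 𝔤) →L[ℝ] (Space n →ᵇ 𝔤) | IsUnit T} := Units.isOpen
  exact (ho.preimage hc).mem_nhds (show A ∈ _ from hA)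

/-! ### The flat connection -/

lemma lapWeight_zero : lapWeight (0 : Conn n 𝔤) = 0 := by
  ext1 o
  cases o with
  | none =>
    rw [lapWeight_none]
    exact quadratic_zero (coefMul n 𝔤) (T := Conn n 𝔤) weightAd boundedAd weightDivAd
  | some i =>
    rw [lapWeight_some]
    exact map_zero _

lemma lapOp_zero (hn : n = 2 ∨ n = 3) (hL : 0 < L) : lapOp hn hL (0 : Conn n 𝔤) = 0 := by
  rw [lapOp, lapWeight_zero, map_zero]

lemma lapInvertible_zero (hn : n = 2 ∨ n = 3) (hL : 0 < L) : LapInvertible L (0 : Conn n 𝔤) := by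
  rw [lapInvertible_iff hn hL, lapOp_zero, add_zero]
  exact isUnit_one

lemma invLap_zero_apply (hn : n = 2 ∨ n = 3) (hL : 0 < L) (h : 𝓢(Space n, 𝔤)) (x : Space n) :
    invLap L (0 : Conn n 𝔤) h x = ∫ y, newton L (x - y) • h y := by
  rw [invLap_eq hn hL ((lapInvertible_iff hn hL _).1 (lapInvertible_zero hn hL)), lapOp_zero,
    add_zero, Ring.inverse_one, ← pot_eq_integral_sub]
  change wt x ^ 6 • newtonOp hn hL h x = _
  rw [newtonOp_apply, smul_smul, mul_inv_cancel₀ (pow_pos (wt_pos x) 6).ne', one_smul]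

/-! ### The maximum principle in three dimensions -/

/-- Were the second derivative positive, the restriction to the line would also have a local minimum
there and be locally constant, with vanishing second derivative. -/
lemma pd_pd_nonpos_of_isLocalMax {v : Space n → ℝ} (hv : ContDiff ℝ ∞ v) {y : Space n}
    (hmax : IsLocalMax v y) (i : Fin n) : pd i (pd i v) y ≤ 0 := by
  by_contra! hpos
  set e : Space n := EuclideanSpace.single i 1
  have hline : ∀ g : Space n → ℝ, Differentiable ℝ g → ∀ t : ℝ,
      HasDerivAt (fun t : ℝ => g (y + t • e)) (pd i g (y + t • e)) t := by
    intro g hg t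
    have h1 : HasDerivAt (fun t : ℝ => y + t • e) e t := by
      simpa using ((hasDerivAt_id t).smul_const e).const_add y
    exact (hg _).hasFDerivAt.comp_hasDerivAt t h1
  have hd : Differentiable ℝ v := hv.differentiable (by simp)
  have hd' : Differentiable ℝ (pd i v) := (contDiff_pd hv i).differentiable (by simp)
  set f : ℝ → ℝ := fun t => v (y + t • e) with hf
  have hcl : Continuous fun t : ℝ => y + t • e := by fun_prop
  have h1 : deriv f = fun t => pd i v (y + t • e) := funext fun t => (hline v hd t).deriv
  have h2 : deriv (deriv f) 0 = pd i (pd i v) y := by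
    rw [h1, (hline _ hd' 0).deriv]
    simp
  have hfmax : IsLocalMax f 0 := by
    have h3 : Tendsto (fun t : ℝ => y + t • e) (𝓝 0) (𝓝 y) := by
      simpa using hcl.tendsto 0
    have := h3.eventually hmax
    filter_upwards [this] with t ht
    simpa [hf] using ht
  have hfmin : IsLocalMin f 0 :=
    isLocalMin_of_deriv_deriv_pos (by rw [h2]; exact hpos) hfmax.deriv_eq_zero
      (hv.continuous.comp hcl).continuousAt
  have hconst : f =ᶠ[𝓝 0] fun _ => f 0 := by
    filter_upwards [hfmax, hfmin] with t h3 h4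
    exact le_antisymm h3 h4
  have h5 : deriv f =ᶠ[𝓝 0] fun _ => 0 := by
    simpa using hconst.deriv
  have h6 : deriv (deriv f) 0 = 0 := by
    rw [h5.deriv_eq]
    simp
  rw [h2] at h6
  exact hpos.ne' h6

lemma pd_norm_sq (i : Fin n) : pd i (fun x : Space n => ‖x‖ ^ 2) = fun x => 2 * x i := by
  ext x
  rw [pd, (hasStrictFDerivAt_norm_sq x).hasFDerivAt.fderiv]
  simp [EuclideanSpace.inner_single_right]

lemma pd_pd_norm_sq (i : Fin n) (x : Space n) : pd i (pd i (fun x : Space n => ‖x‖ ^ 2)) x = 2 := by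
  rw [pd_norm_sq, pd, ((hasFDerivAt_coord i x).const_mul 2).fderiv]
  simp

/-- Weak maximum principle: adding `δ |x|²` makes the Laplacian strictly positive, which is
impossible at an interior maximum. -/
lemma nonpos_of_lap_nonneg (hn : 0 < n) {w : Space n → ℝ} (hw : ContDiff ℝ ∞ w)
    (hl : ∀ x, 0 ≤ lap w x) (h0 : Tendsto w (cocompact (Space n)) (𝓝 0)) (x : Space n) :
    w x ≤ 0 := by
  by_contra! hx
  have hb : ∀ᶠ z in cocompact (Space n), w z < w x / 2 := h0.eventually (gt_mem_nhds (by linarith))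
  rw [← Metric.cobounded_eq_cocompact, ← comap_norm_atTop, eventually_comap, eventually_atTop] at hb
  obtain ⟨R₀, hR₀⟩ := hb
  set R := max (max R₀ (‖x‖ + 1)) 1
  have hRx : ‖x‖ < R := lt_of_lt_of_le (by linarith) ((le_max_right R₀ _).trans (le_max_left _ _))
  have hR0 : R₀ ≤ R := (le_max_left _ _).trans (le_max_left _ _)
  have hRpos : 0 < R := one_pos.trans_le (le_max_right _ _)
  -- On the sphere of radius `R` the perturbed function is below `w x / 2 + w x / 4 < w x`, so its
  -- maximum is interior.
  set δ := w x / (4 * R ^ 2) with hδ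
  have hδ0 : 0 < δ := by positivity
  have hδR : δ * R ^ 2 = w x / 4 := by rw [hδ]; field_simp
  have hsq : ContDiff ℝ ∞ fun z : Space n => δ * ‖z‖ ^ 2 := contDiff_const.mul (contDiff_norm_sq ℝ)
  set v : Space n → ℝ := fun z => w z + δ * ‖z‖ ^ 2 with hv
  have hvs : ContDiff ℝ ∞ v := hw.add hsq
  obtain ⟨y, hy, hmax⟩ := (isCompact_closedBall (0 : Space n) R).exists_isMaxOn
    ⟨x, by simpa using hRx.le⟩ hvs.continuous.continuousOn
  have hvy : w x ≤ v y := by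
    have h1 : v x ≤ v y := hmax (by simpa using hRx.le)
    have h2 : 0 ≤ δ * ‖x‖ ^ 2 := by positivity
    simp only [hv] at h1 ⊢
    linarith
  have hyR : ‖y‖ < R := by
    refine lt_of_le_of_ne (by simpa using hy) fun h => ?_
    have h1 := hR₀ ‖y‖ (h ▸ hR0) y rfl
    simp only [hv, h] at hvy
    linarith
  have hloc : IsLocalMax v y := hmax.isLocalMax
    (mem_of_superset (Metric.isOpen_ball.mem_nhds (by simpa using hyR)) Metric.ball_subset_closedBall)
  have h1 : lap v y ≤ 0 := Finset.sum_nonpos fun i _ => pd_pd_nonpos_of_isLocalMax hvs hloc i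
  have h2 : ∀ i, pd i (pd i v) y = pd i (pd i w) y + δ * 2 := by
    intro i
    have e1 : pd i (fun z : Space n => δ * ‖z‖ ^ 2) = fun z => δ * pd i (fun x : Space n => ‖x‖ ^ 2) z := by
      ext z
      rw [pd, fderiv_const_mul ((contDiff_norm_sq ℝ (n := ∞)).differentiable (by simp) z)]
      rfl
    have hsd : ContDiff ℝ ∞ (pd i fun x : Space n => ‖x‖ ^ 2) := contDiff_pd (contDiff_norm_sq ℝ) i
    have e2 : pd i (fun z => δ * pd i (fun x : Space n => ‖x‖ ^ 2) z) y = δ * 2 := by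
      rw [pd, fderiv_const_mul (hsd.differentiable (by simp) y), ← pd_pd_norm_sq i y]
      rfl
    rw [hv, pd_add (hw.differentiable (by simp)) (hsq.differentiable (by simp)),
      pd_add ((contDiff_pd hw i).differentiable (by simp))
        ((contDiff_pd hsq i).differentiable (by simp)), e1]
    beta_reduce
    rw [e2]
  simp only [lap, h2, Finset.sum_add_distrib] at h1
  have h3 := hl y
  simp only [lap] at h3
  simp only [Finset.sum_const, Finset.card_univ, Fintype.card_fin, nsmul_eq_mul] at h1
  have : (0 : ℝ) < n := by exact_mod_cast hn
  nlinarith [mul_pos this hδ0]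

lemma bracket_skew (x y : 𝔤) : ⁅x, y⁆ = -⁅y, x⁆ := by
  have h := AdInvariantLieAlgebra.bracket_self (x + y)
  rw [AdInvariantLieAlgebra.add_bracket, AdInvariantLieAlgebra.bracket_add,
    AdInvariantLieAlgebra.bracket_add, AdInvariantLieAlgebra.bracket_self,
    AdInvariantLieAlgebra.bracket_self, zero_add, add_zero] at h
  exact eq_neg_of_add_eq_zero_left h

lemma inner_ad_skew (a x y : 𝔤) : inner ℝ ⁅a, x⁆ y = -inner ℝ x ⁅a, y⁆ := by
  rw [bracket_skew, inner_neg_left, AdInvariantLieAlgebra.inner_bracket]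

lemma contDiff_covD (A : Conn n 𝔤) (i : Fin n) {u : Space n → 𝔤} (hu : ContDiff ℝ ∞ u) :
    ContDiff ℝ ∞ (covD A i u) :=
  (contDiff_pd hu i).add (((adS (A i)).smooth ⊤).clm_apply hu)

/-- `∂ᵢ⟨u, v⟩ = ⟨∇̂ᵢu, v⟩ + ⟨u, ∇̂ᵢv⟩`. -/
lemma pd_inner_covD (A : Conn n 𝔤) (i : Fin n) {u v : Space n → 𝔤} (hu : Differentiable ℝ u)
    (hv : Differentiable ℝ v) (x : Space n) :
    pd i (fun x => inner ℝ (u x) (v x)) x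
      = inner ℝ (covD A i u x) (v x) + inner ℝ (u x) (covD A i v x) := by
  rw [pd, ((hu x).hasFDerivAt.inner ℝ (hv x).hasFDerivAt).fderiv, covD, covD, inner_add_left,
    inner_add_right, inner_ad_skew]
  simp [pd]
  ring

/-- Invariance of the scalar product makes the covariant derivative metric, so no terms in `A`
survive outside the covariant derivatives. For `Δ_A u = 0` the function `|u|²` is subharmonic. -/
lemma lap_norm_sq (A : Conn n 𝔤) {u : Space n → 𝔤} (hu : ContDiff ℝ ∞ u) (x : Space n) :
    lap (fun x => inner ℝ (u x) (u x)) x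
      = 2 * (∑ i, ‖covD A i u x‖ ^ 2 + inner ℝ (u x) (covLap A u x)) := by
  have hd : Differentiable ℝ u := hu.differentiable (by simp)
  rw [lap, covLap, inner_sum, ← Finset.sum_add_distrib, Finset.mul_sum]
  refine Finset.sum_congr rfl fun i _ => ?_
  have hdc : Differentiable ℝ (covD A i u) := (contDiff_covD A i hu).differentiable (by simp)
  have e : pd i (fun x => inner ℝ (u x) (u x))
      = fun x => inner ℝ (covD A i u x) (u x) + inner ℝ (u x) (covD A i u x) :=
    funext fun x => pd_inner_covD A i hd hd x
  rw [e, pd_add (hdc.inner ℝ hd) (hd.inner ℝ hdc)]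
  beta_reduce
  rw [pd_inner_covD A i hdc hd, pd_inner_covD A i hd hdc, real_inner_self_eq_norm_sq,
    real_inner_comm (u x)]
  ring

/-- For `n = 3` homogeneous solutions tend to `0` at infinity, so the maximum principle for `|u|²`
gives injectivity. In the plane solutions may grow logarithmically and this argument is not
available. -/
lemma lapInvertible_of_three (hL : 0 < L) (hn3 : n = 3) (A : Conn n 𝔤) : LapInvertible L A := by
  rw [lapInvertible_iff (Or.inr hn3) hL]
  refine lapInvertible_of_injective _ hL fun u hu => ?_
  obtain ⟨hs, he, ha⟩ := hu
  rw [GreenAsymptotics, if_neg (by omega)] at ha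
  have h1 : ∀ x, inner ℝ (u x) (u x) ≤ (0 : ℝ) := by
    refine nonpos_of_lap_nonneg (by omega) (hs.inner ℝ hs) (fun x => ?_) ?_
    · rw [lap_norm_sq A hs, he]
      simp only [zero_apply, inner_zero_right, add_zero]
      positivity
    · simpa using ha.inner ha (𝕜 := ℝ)
  ext x
  exact inner_self_eq_zero.1 (le_antisymm (h1 x) real_inner_self_nonneg)

end Invertibility

/-! ## The pairing `⟨f, Δ_A⁻¹ h⟩` -/

section Pairing

open LineDeriv BoundedContinuousFunction

variable {n : ℕ} {𝔤 : Type*} [NormedAddCommGroup 𝔤] [InnerProductSpace ℝ 𝔤]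
  [AdInvariantLieAlgebra 𝔤] [FiniteDimensional ℝ 𝔤] {L : ℝ}

lemma integrable_inner_of_decay (hn : n = 2 ∨ n = 3) {f u : Space n → 𝔤} (hf : Decay f)
    (hu : Continuous u) (hK : ∃ K, ∀ x, ‖u x‖ ≤ K * wt x) :
    Integrable fun x => (inner ℝ (f x) (u x) : ℝ) := by
  obtain ⟨M, hM⟩ := hf
  obtain ⟨K, hK⟩ := hK
  refine Integrable.mono' ((hM.integrable_wt_mul hn).const_mul K)
    (hM.cont.inner hu).aestronglyMeasurable (Eventually.of_forall fun x => ?_)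
  calc ‖(inner ℝ (f x) (u x) : ℝ)‖ ≤ ‖f x‖ * ‖u x‖ := norm_inner_le_norm _ _
    _ ≤ ‖f x‖ * (K * wt x) := by gcongr; exact hK x
    _ = _ := by ring

lemma integral_pd_eq_zero {f : Space n → ℝ} (i : Fin n) (hd : Differentiable ℝ f)
    (hf : Integrable f) (hf' : Integrable (pd i f)) : ∫ x, pd i f x = 0 := by
  have h := integral_smul_fderiv_eq_neg_fderiv_smul_of_integrable (𝕜 := ℝ) (μ := volume)
    (f := fun _ : Space n => (1 : ℝ)) (g := f) (v := EuclideanSpace.single i 1)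
    (by simp) (by simpa [pd] using! hf') (by simpa using hf)
    (fun x _ => differentiableAt_const _) (fun x _ => hd x)
  simpa [pd] using h

/-- Green's identity for `Δ_A`, relative to the one for `Δ`. -/
lemma inner_covLap_sub (A : Conn n 𝔤) {u v : Space n → 𝔤} (hu : ContDiff ℝ ∞ u)
    (hv : ContDiff ℝ ∞ v) (x : Space n) :
    inner ℝ (covLap A u x) (v x) - inner ℝ (u x) (covLap A v x)
      = inner ℝ (lap u x) (v x) - inner ℝ (u x) (lap v x)
        + ∑ i, 2 * pd i (fun x => inner ℝ ⁅A i x, u x⁆ (v x)) x := by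
  have hud : Differentiable ℝ u := hu.differentiable (by simp)
  have hvd : Differentiable ℝ v := hv.differentiable (by simp)
  rw [covLap, covLap, lap, lap, sum_inner, sum_inner, inner_sum, inner_sum,
    ← Finset.sum_sub_distrib, ← Finset.sum_sub_distrib, ← Finset.sum_add_distrib]
  refine Finset.sum_congr rfl fun i _ => ?_
  have hcu : Differentiable ℝ (covD A i u) := (contDiff_covD A i hu).differentiable (by simp)
  have hcv : Differentiable ℝ (covD A i v) := (contDiff_covD A i hv).differentiable (by simp)
  have hpu : Differentiable ℝ (pd i u) := (contDiff_pd hu i).differentiable (by simp)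
  have hpv : Differentiable ℝ (pd i v) := (contDiff_pd hv i).differentiable (by simp)
  have hau : Differentiable ℝ fun x => ⁅A i x, u x⁆ := differentiable_mul (adS (A i)) hud
  have hinner : ∀ {f g : Space n → 𝔤}, Differentiable ℝ f → Differentiable ℝ g → ∀ x,
      pd i (fun x => inner ℝ (f x) (g x)) x
        = inner ℝ (pd i f x) (g x) + inner ℝ (f x) (pd i g x) := by
    intro f g hf hg x
    rw [pd, ((hf x).hasFDerivAt.inner ℝ (hg x).hasFDerivAt).fderiv]
    simp [pd]
    ring
  have e1 := pd_inner_covD A i hcu hvd x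
  have e2 := pd_inner_covD A i hud hcv x
  have e3 := hinner hpu hvd x
  have e4 := hinner hud hpv x
  have e5 : (fun x => (inner ℝ (covD A i u x) (v x) : ℝ))
      = fun x => inner ℝ (pd i u x) (v x) + inner ℝ ⁅A i x, u x⁆ (v x) := by
    ext x
    rw [covD, inner_add_left]
  have e6 : (fun x => (inner ℝ (u x) (covD A i v x) : ℝ))
      = fun x => inner ℝ (u x) (pd i v x) - inner ℝ ⁅A i x, u x⁆ (v x) := by
    ext x
    rw [covD, inner_add_right, inner_ad_skew, sub_neg_eq_add]
  rw [e5, pd_add (hpu.inner ℝ hvd) (hau.inner ℝ hvd)] at e1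
  rw [e6, pd_sub (hud.inner ℝ hpv) (hau.inner ℝ hvd)] at e2
  beta_reduce at e1 e2
  linarith

/-- Both functions are Newtonian potentials of their Laplacians, so this is Fubini with an even
kernel. Integration by parts would leave boundary terms, delicate in the plane where `u` and `v` may
grow logarithmically. -/
lemma integral_inner_lap_symm (hn : n = 2 ∨ n = 3) (hL : 0 < L) {u v : Space n → 𝔤}
    (hu : Decay (lap u)) (hu' : u = pot (newton L) (lap u)) (hv : Decay (lap v))
    (hv' : v = pot (newton L) (lap v)) :
    ∫ x, (inner ℝ (lap u x) (v x) : ℝ) = ∫ x, (inner ℝ (u x) (lap v x) : ℝ) := by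
  obtain ⟨M, hM⟩ := hu
  obtain ⟨M', hM'⟩ := hv
  have h := integral_bilin_pot hn (kerBound_newton hn hL) hM' hM (innerSL ℝ : 𝔤 →L[ℝ] 𝔤 →L[ℝ] ℝ)
  simp only [newton_neg] at h
  rw [← hu', ← hv'] at h
  exact h

/-- `⟨f, Δ_A⁻¹ h⟩` is symmetric. -/
theorem greenPairing_symm (hn : n = 2 ∨ n = 3) (hL : 0 < L) {A : Conn n 𝔤}
    (hA : LapInvertible L A) (f h : 𝓢(Space n, 𝔤)) :
    greenPairing L A f h = greenPairing L A h f := by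
  have hu := isGreenSolution_invLap hA f
  have hv := isGreenSolution_invLap hA h
  rw [greenPairing, greenPairing]
  set u := invLap L A f
  set v := invLap L A h
  obtain ⟨hur, hul, hup⟩ := hu.regularity hn hL
  obtain ⟨hvr, hvl, hvp⟩ := hv.regularity hn hL
  have huK := hu.norm_le hL
  have hvK := hv.norm_le hL
  have hud : Differentiable ℝ u := hu.1.differentiable (by simp)
  have hvd : Differentiable ℝ v := hv.1.differentiable (by simp)
  have hsymm := integral_inner_lap_symm hn hL hul hup hvl hvp
  have i1 : Integrable fun x => (inner ℝ (lap u x) (v x) : ℝ) :=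
    integrable_inner_of_decay hn hul hv.1.continuous hvK
  have i2 : Integrable fun x => (inner ℝ (u x) (lap v x) : ℝ) :=
    (integrable_inner_of_decay hn hvl hu.1.continuous huK).congr
      (Eventually.of_forall fun x => real_inner_comm _ _)
  have i3 : Integrable fun x => (inner ℝ (f x) (v x) : ℝ) :=
    integrable_inner_of_decay hn (exists_decayBound_of_schwartz f) hv.1.continuous hvK
  have i4 : Integrable fun x => (inner ℝ (u x) (h x) : ℝ) :=
    (integrable_inner_of_decay hn (exists_decayBound_of_schwartz h) hu.1.continuous huK).congr
      (Eventually.of_forall fun x => real_inner_comm _ _)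
  have hb : ∀ i, Differentiable ℝ fun x => (inner ℝ ⁅A i x, u x⁆ (v x) : ℝ) := fun i =>
    (differentiable_mul (adS (A i)) hud).inner ℝ hvd
  have j1 : ∀ i, Integrable fun x => (inner ℝ ⁅A i x, u x⁆ (v x) : ℝ) := fun i =>
    integrable_inner_of_decay hn ((hur 0).mul (adS (A i))).zero hv.1.continuous hvK
  -- Skewness moves `ad Aᵢ` onto `∂ᵢv`, whose growth is then absorbed by a Schwartz coefficient;
  -- each term is integrable separately.
  have hbd : ∀ i, pd i (fun x => (inner ℝ ⁅A i x, u x⁆ (v x) : ℝ)) = fun x =>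
      inner ℝ (pd i (fun x => adS (A i) x (u x)) x) (v x)
        - inner ℝ (adS (A i) x (pd i v x)) (u x) := by
    intro i
    ext x
    have h1 : Differentiable ℝ fun x => adS (A i) x (u x) := differentiable_mul (adS (A i)) hud
    change pd i (fun x => (inner ℝ (adS (A i) x (u x)) (v x) : ℝ)) x = _
    rw [pd, ((h1 x).hasFDerivAt.inner ℝ (hvd x).hasFDerivAt).fderiv]
    have h2 : (inner ℝ (adS (A i) x (u x)) (pd i v x) : ℝ)
        = - inner ℝ (adS (A i) x (pd i v x)) (u x) := by
      refine (inner_ad_skew _ _ _).trans ?_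
      rw [real_inner_comm]
      rfl
    rw [sub_eq_add_neg, ← h2]
    simp [pd]
    ring
  have j2 : ∀ i, Integrable (pd i fun x => (inner ℝ ⁅A i x, u x⁆ (v x) : ℝ)) := by
    intro i
    rw [hbd]
    exact (integrable_inner_of_decay hn (((hur 1).mul (adS (A i))).2.2 i).zero hv.1.continuous
      hvK).sub (integrable_inner_of_decay hn (((hvr 1).2.2 i).mul (adS (A i))).zero
        hu.1.continuous huK)
  have key : ∀ x, (inner ℝ (f x) (v x) : ℝ) - inner ℝ (u x) (h x)
      = inner ℝ (lap u x) (v x) - inner ℝ (u x) (lap v x)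
        + ∑ i, 2 * pd i (fun x => inner ℝ ⁅A i x, u x⁆ (v x)) x := by
    intro x
    rw [← hu.2.1, ← hv.2.1]
    exact inner_covLap_sub A hu.1 hv.1 x
  have h1 : ∫ x, ((inner ℝ (f x) (v x) : ℝ) - inner ℝ (u x) (h x)) = 0 := by
    simp only [key]
    have i12 : Integrable fun x => (inner ℝ (lap u x) (v x) : ℝ) - inner ℝ (u x) (lap v x) :=
      i1.sub i2
    have i5 : ∀ i ∈ Finset.univ, Integrable fun x =>
      2 * pd i (fun x => (inner ℝ ⁅A i x, u x⁆ (v x) : ℝ)) x := fun i _ => (j2 i).const_mul 2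
    rw [integral_add i12 (integrable_finsetSum _ i5), integral_sub i1 i2, hsymm, sub_self,
      zero_add, integral_finsetSum _ i5]
    refine Finset.sum_eq_zero fun i _ => ?_
    rw [integral_const_mul, integral_pd_eq_zero i (hb i) (j1 i) (j2 i), mul_zero]
  rw [integral_sub i3 i4, sub_eq_zero] at h1
  rw [h1]
  exact integral_congr_ae (Eventually.of_forall fun x => real_inner_comm _ _)

lemma norm_inner_unweight_le (f : 𝓢(Space n, 𝔤)) (φ : Space n →ᵇ 𝔤) (x : Space n) :
    ‖(inner ℝ (f x) (unweight φ x) : ℝ)‖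
      ≤ ‖φ‖ * ‖SchwartzMap.smulLeftCLM 𝔤 (fun x : Space n => wt x ^ 6) f x‖ := by
  rw [SchwartzMap.smulLeftCLM_apply_apply (hasTemperateGrowth_wt_pow 6), unweight,
    inner_smul_right, ← real_inner_smul_left]
  refine (norm_inner_le_norm _ _).trans ?_
  rw [mul_comm]
  gcongr
  exact φ.norm_coe_le_norm x

lemma integrable_inner_unweight (f : 𝓢(Space n, 𝔤)) (φ : Space n →ᵇ 𝔤) :
    Integrable fun x => (inner ℝ (f x) (unweight φ x) : ℝ) :=
  Integrable.mono' ((SchwartzMap.integrable (μ := volume) _).norm.const_mul ‖φ‖)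
    (f.continuous.inner (growth_unweight φ).cont).aestronglyMeasurable
    (Eventually.of_forall (norm_inner_unweight_le f φ))

/-- The functional `φ ↦ ⟨f, wt⁶ φ⟩`. -/
def pairOp (f : 𝓢(Space n, 𝔤)) : (Space n →ᵇ 𝔤) →L[ℝ] ℝ :=
  LinearMap.mkContinuous
    { toFun := fun φ => ∫ x, inner ℝ (f x) (unweight φ x)
      map_add' := fun φ ψ => by
        rw [← integral_add (integrable_inner_unweight f φ) (integrable_inner_unweight f ψ)]
        simp only [unweight, BoundedContinuousFunction.add_apply, smul_add, inner_add_right]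
      map_smul' := fun c φ => by
        rw [RingHom.id_apply, smul_eq_mul, ← integral_const_mul]
        refine integral_congr_ae (Eventually.of_forall fun x => ?_)
        simp only [unweight, BoundedContinuousFunction.smul_apply, smul_comm _ c,
          inner_smul_right] }
    (∫ x, ‖SchwartzMap.smulLeftCLM 𝔤 (fun x : Space n => wt x ^ 6) f x‖) fun φ => by
      rw [mul_comm, ← integral_const_mul]
      exact norm_integral_le_of_norm_le ((SchwartzMap.integrable (μ := volume) _).norm.const_mul ‖φ‖)
        (Eventually.of_forall (norm_inner_unweight_le f φ))

lemma greenPairing_eq (hn : n = 2 ∨ n = 3) (hL : 0 < L) {A : Conn n 𝔤} (hA : LapInvertible L A)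
    (f h : 𝓢(Space n, 𝔤)) : greenPairing L A f h
      = pairOp f (Ring.inverse (1 + lapOp hn hL A) (newtonOp hn hL h)) := by
  rw [greenPairing, invLap_eq hn hL ((lapInvertible_iff hn hL A).1 hA)]
  rfl

lemma pairOp_add (f f' : 𝓢(Space n, 𝔤)) (φ : Space n →ᵇ 𝔤) :
    pairOp (f + f') φ = pairOp f φ + pairOp f' φ := by
  change ∫ x, (inner ℝ ((f + f') x) (unweight φ x) : ℝ)
    = (∫ x, (inner ℝ (f x) (unweight φ x) : ℝ)) + ∫ x, (inner ℝ (f' x) (unweight φ x) : ℝ)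
  rw [← integral_add (integrable_inner_unweight f φ) (integrable_inner_unweight f' φ)]
  simp only [_root_.add_apply, inner_add_left]

lemma pairOp_smul (c : ℝ) (f : 𝓢(Space n, 𝔤)) (φ : Space n →ᵇ 𝔤) :
    pairOp (c • f) φ = c * pairOp f φ := by
  change ∫ x, (inner ℝ ((c • f) x) (unweight φ x) : ℝ)
    = c * ∫ x, (inner ℝ (f x) (unweight φ x) : ℝ)
  rw [← integral_const_mul]
  simp only [_root_.smul_apply, real_inner_smul_left]

/-- The pairing `⟨f, Δ_A⁻¹ h⟩` as a bilinear form. -/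
def greenForm (hn : n = 2 ∨ n = 3) (hL : 0 < L) (A : Conn n 𝔤) :
    𝓢(Space n, 𝔤) →ₗ[ℝ] 𝓢(Space n, 𝔤) →ₗ[ℝ] ℝ :=
  LinearMap.mk₂ ℝ
    (fun f h => pairOp f (Ring.inverse (1 + lapOp hn hL A) (newtonOp hn hL h)))
    (fun f f' h => pairOp_add f f' _) (fun c f h => pairOp_smul c f _)
    (fun f h h' => by simp only [map_add]) (fun c f h => by simp only [map_smul])

/-- The form is bilinear at every connection because `Ring.inverse` is total; it is identified with
the pairing here under the assumption of invertibility, which holds near the base point along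
planes. -/
lemma greenForm_apply (hn : n = 2 ∨ n = 3) (hL : 0 < L) {A : Conn n 𝔤} (hA : LapInvertible L A)
    (f h : 𝓢(Space n, 𝔤)) : greenForm hn hL A f h = greenPairing L A f h :=
  (greenPairing_eq hn hL hA f h).symm

/-- `1 + T_A` is polynomial along a plane, inversion is smooth at a unit, and the rest is linear. -/
lemma contDiffAt_greenForm (hn : n = 2 ∨ n = 3) (hL : 0 < L) {A : Conn n 𝔤}
    (hA : LapInvertible L A) (P Q : Conn n 𝔤) (f h : 𝓢(Space n, 𝔤)) :
    ContDiffAt ℝ 2 (fun s : ℝ × ℝ => greenForm hn hL (A + (s.1 • P + s.2 • Q)) f h) 0 := by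
  have h1 : ContDiff ℝ 2 fun s : ℝ × ℝ => 1 + lapOp hn hL (A + (s.1 • P + s.2 • Q)) :=
    contDiff_const.add (ContDiff.continuousLinearMap_comp (kerOp hn hL) (contDiff_lapWeight A P Q))
  obtain ⟨U, hU⟩ := (lapInvertible_iff hn hL A).1 hA
  have h0 : 1 + lapOp hn hL (A + ((0 : ℝ × ℝ).1 • P + (0 : ℝ × ℝ).2 • Q)) = U := by
    rw [hU]
    simp
  have h2 : ContDiffAt ℝ 2 (fun s : ℝ × ℝ =>
      Ring.inverse (1 + lapOp hn hL (A + (s.1 • P + s.2 • Q)))) 0 := by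
    have := contDiffAt_ringInverse ℝ (n := 2) U
    rw [← h0] at this
    exact this.comp (0 : ℝ × ℝ) h1.contDiffAt
  exact (pairOp f).contDiff.contDiffAt.comp (0 : ℝ × ℝ) (h2.clm_apply contDiffAt_const)

lemma eventually_lapInvertible_plane (hn : n = 2 ∨ n = 3) (hL : 0 < L) {A : Conn n 𝔤}
    (hA : LapInvertible L A) (P Q : Conn n 𝔤) :
    ∀ᶠ s : ℝ × ℝ in 𝓝 0, LapInvertible L (A + (s.1 • P + s.2 • Q)) := by
  have h : Tendsto (fun s : ℝ × ℝ => A + (s.1 • P + s.2 • Q)) (𝓝 0) (𝓝 A) := by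
    have hc : Continuous fun s : ℝ × ℝ => A + (s.1 • P + s.2 • Q) := by fun_prop
    simpa using hc.tendsto 0
  exact h.eventually (eventually_lapInvertible hn hL hA)

end Pairing

/-! ## Curvature of metrics that are constant to first order -/

section Curvature

/-- The difference quotient is `φ` itself, so continuity is enough. -/
lemma hasDerivAt_mul_self {φ : ℝ → ℝ} (hφ : ContinuousAt φ 0) :
    HasDerivAt (fun t => t * φ t) (φ 0) 0 := by
  rw [hasDerivAt_iff_tendsto_slope]
  refine (hφ.tendsto.mono_left nhdsWithin_le_nhds).congr' ?_
  filter_upwards [self_mem_nhdsWithin] with t ht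
  have : t ≠ 0 := ht
  simp [slope_def_field]
  field_simp

/-- The inner derivative at `r = 0` is `t (t ∂a(t, 0) + b(t, 0))`, with `∂` in the second variable.
The pure squares do not contribute to the mixed derivative, and derivatives of the coefficients come
with a vanishing factor. -/
lemma hasDerivAt_deriv_of_quadratic {F a b e : ℝ × ℝ → ℝ} {c : ℝ} (ha : ContDiffAt ℝ 2 a 0)
    (hb : ContDiffAt ℝ 2 b 0) (he : ContDiffAt ℝ 2 e 0)
    (hF : ∀ᶠ s in 𝓝 0, F s = c + (s.1 ^ 2 * a s + s.1 * s.2 * b s + s.2 ^ 2 * e s)) :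
    deriv (fun r => F (0, r)) 0 = 0 ∧
      HasDerivAt (fun t => deriv (fun r => F (t, r)) 0) (b 0) 0 := by
  have hι : Tendsto (fun t : ℝ => ((t, 0) : ℝ × ℝ)) (𝓝 0) (𝓝 0) := by
    have : Continuous fun t : ℝ => ((t, 0) : ℝ × ℝ) := by fun_prop
    exact this.tendsto 0
  have hd : ∀ {f : ℝ × ℝ → ℝ}, ContDiffAt ℝ 2 f 0 → ∀ᶠ s in 𝓝 0, DifferentiableAt ℝ f s := by
    intro f hf
    filter_upwards [hf.eventually (by simp)] with s hs
    exact hs.differentiableAt (by simp)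
  have hev : ∀ᶠ t : ℝ in 𝓝 0, deriv (fun r => F (t, r)) 0
      = t * (t * fderiv ℝ a (t, 0) (0, 1) + b (t, 0)) := by
    filter_upwards [hι.eventually hF.eventually_nhds, hι.eventually (hd ha),
      hι.eventually (hd hb), hι.eventually (hd he)] with t h1 h2 h3 h4
    have hγ : HasDerivAt (fun r : ℝ => ((t, r) : ℝ × ℝ)) (0, 1) 0 :=
      (hasDerivAt_const 0 t).prodMk (hasDerivAt_id 0)
    have h5 : (fun r => F (t, r)) =ᶠ[𝓝 0] fun r =>
        c + (t ^ 2 * a (t, r) + t * r * b (t, r) + r ^ 2 * e (t, r)) := by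
      have : Tendsto (fun r : ℝ => ((t, r) : ℝ × ℝ)) (𝓝 0) (𝓝 (t, 0)) := hγ.continuousAt
      exact this.eventually h1
    have da := h2.hasFDerivAt.comp_hasDerivAt (0 : ℝ) hγ
    have db := h3.hasFDerivAt.comp_hasDerivAt (0 : ℝ) hγ
    have de := h4.hasFDerivAt.comp_hasDerivAt (0 : ℝ) hγ
    rw [h5.deriv_eq]
    have := (((da.const_mul (t ^ 2)).add (((hasDerivAt_id (0 : ℝ)).const_mul t).mul db)).add
      (((hasDerivAt_id (0 : ℝ)).pow 2).mul de)).const_add c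
    refine (HasDerivAt.deriv this).trans ?_
    simp
    ring
  refine ⟨by rw [hev.self_of_nhds]; simp, ?_⟩
  have hcb : ContinuousAt (fun t : ℝ => b (t, 0)) 0 :=
    ContinuousAt.comp (f := fun t : ℝ => ((t, 0) : ℝ × ℝ)) hb.continuousAt hι
  have hca : ContinuousAt (fun t : ℝ => fderiv ℝ a (t, 0) (0, 1)) 0 := by
    have h1 : ContinuousAt (fderiv ℝ a) 0 := (ha.fderiv_right (m := 1) (by norm_num)).continuousAt
    have h2 : ContinuousAt (fun t : ℝ => fderiv ℝ a (t, 0)) 0 :=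
      ContinuousAt.comp (f := fun t : ℝ => ((t, 0) : ℝ × ℝ)) h1 hι
    exact h2.clm_apply continuousAt_const
  have h := hasDerivAt_mul_self ((continuousAt_id.mul hca).add hcb)
  refine (h.congr_of_eventuallyEq hev).congr_deriv ?_
  simp
  rfl

variable {V S : Type*} [AddCommGroup V] [Module ℝ V] [AddCommGroup S] [Module ℝ S]

/-- A metric of the form `g_q(X, Y) = ⟨X, Y⟩ + K_q([q, X], [q, Y])` near `0`. -/
structure IsBracketMetric (g : V → V → V → ℝ) (ip : V → V → ℝ) (K : V → S →ₗ[ℝ] S →ₗ[ℝ] ℝ)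
    (β : V →ₗ[ℝ] V →ₗ[ℝ] S) : Prop where
  eq_near : ∀ P Q X Y : V, ∀ᶠ s : ℝ × ℝ in 𝓝 0, g (s.1 • P + s.2 • Q) X Y
    = ip X Y + K (s.1 • P + s.2 • Q) (β (s.1 • P + s.2 • Q) X) (β (s.1 • P + s.2 • Q) Y)
  smooth : ∀ (P Q : V) (f h : S), ContDiffAt ℝ 2 (fun s : ℝ × ℝ => K (s.1 • P + s.2 • Q) f h) 0
  symm : ∀ f h, K 0 f h = K 0 h f
  skew : ∀ X Y, β X Y = -β Y X

variable {g : V → V → V → ℝ} {ip : V → V → ℝ} {K : V → S →ₗ[ℝ] S →ₗ[ℝ] ℝ}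
  {β : V →ₗ[ℝ] V →ₗ[ℝ] S}

namespace IsBracketMetric

lemma contDiffAt (hg : IsBracketMetric g ip K β) (P Q X Y : V) :
    ContDiffAt ℝ 2 (fun s : ℝ × ℝ => g (s.1 • P + s.2 • Q) X Y) 0 := by
  refine ContDiffAt.congr_of_eventuallyEq ?_ (hg.eq_near P Q X Y)
  have h1 : ContDiffAt ℝ 2 (fun s : ℝ × ℝ => s.1) 0 := contDiff_fst.contDiffAt
  have h2 : ContDiffAt ℝ 2 (fun s : ℝ × ℝ => s.2) 0 := contDiff_snd.contDiffAt
  have h := hg.smooth P Q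
  have e : ∀ s : ℝ × ℝ, K (s.1 • P + s.2 • Q) (β (s.1 • P + s.2 • Q) X)
      (β (s.1 • P + s.2 • Q) Y)
      = s.1 * (s.1 * K (s.1 • P + s.2 • Q) (β P X) (β P Y)
          + s.2 * K (s.1 • P + s.2 • Q) (β P X) (β Q Y))
        + s.2 * (s.1 * K (s.1 • P + s.2 • Q) (β Q X) (β P Y)
          + s.2 * K (s.1 • P + s.2 • Q) (β Q X) (β Q Y)) := by
    intro s
    generalize K (s.1 • P + s.2 • Q) = k
    simp only [map_add, map_smul, LinearMap.add_apply, LinearMap.smul_apply, smul_eq_mul]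
    ring
  simp only [e]
  exact contDiffAt_const.add ((h1.mul ((h1.mul (h _ _)).add (h2.mul (h _ _)))).add
    (h2.mul ((h1.mul (h _ _)).add (h2.mul (h _ _)))))

/-- Bilinear expansion of the correction at `s₁ Z + s₂ P`; the value is the coefficient of `s₁ s₂`
at the origin. -/
lemma dirDeriv_eq (hg : IsBracketMetric g ip K β) (Z P X Y : V) :
    dirDeriv (fun q => g q X Y) 0 P = 0 ∧
      HasDerivAt (fun t : ℝ => dirDeriv (fun q => g q X Y) (0 + t • Z) P)
        (K 0 (β Z X) (β P Y) + K 0 (β P X) (β Z Y)) 0 := by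
  have h := hg.smooth Z P
  have key := hasDerivAt_deriv_of_quadratic (F := fun s : ℝ × ℝ => g (s.1 • Z + s.2 • P) X Y)
    (c := ip X Y) (h (β Z X) (β Z Y)) ((h (β Z X) (β P Y)).add (h (β P X) (β Z Y)))
    (h (β P X) (β P Y)) ?_
  · simpa [dirDeriv] using key
  · filter_upwards [hg.eq_near Z P X Y] with s hs
    rw [hs]
    congr 1
    change _ = s.1 ^ 2 * _ + s.1 * s.2 * (K _ _ _ + K _ _ _) + s.2 ^ 2 * _
    generalize K (s.1 • Z + s.2 • P) = k
    simp only [map_add, map_smul, LinearMap.add_apply, LinearMap.smul_apply, smul_eq_mul]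
    ring

lemma koszul_zero (hg : IsBracketMetric g ip K β) (X Y : V) : koszul g 0 X Y = 0 := by
  ext Z
  rw [koszul, (hg.dirDeriv_eq 0 _ _ _).1, (hg.dirDeriv_eq 0 _ _ _).1, (hg.dirDeriv_eq 0 _ _ _).1]
  simp

/-- Both covectors are zero, so the two dual norms in the polarization are the same number and
cancel. -/
lemma cometric_koszul_zero (hg : IsBracketMetric g ip K β) (X Y Z W : V) :
    cometric g 0 (koszul g 0 X Y) (koszul g 0 Z W) = 0 := by
  rw [hg.koszul_zero, hg.koszul_zero]
  simp [cometric]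

/-- Of the six terms, the two containing `β Z W` cancel by skewness; skewness and symmetry match the
other four in equal pairs, which absorbs the factor `1/2`. -/
lemma dirDeriv_koszul (hg : IsBracketMetric g ip K β) (X Y Z W : V) :
    dirDeriv (fun q => koszul g q X Y W) 0 Z
      = K 0 (β X W) (β Z Y) + K 0 (β Y W) (β Z X) := by
  have h1 := (hg.dirDeriv_eq Z X W Y).2
  have h2 := (hg.dirDeriv_eq Z Y W X).2
  have h3 := (hg.dirDeriv_eq Z W X Y).2
  have h := ((h1.add h2).sub h3).div_const 2
  refine (HasDerivAt.deriv h).trans ?_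
  have s1 : K 0 (β Z W) (β Y X) = -K 0 (β Z W) (β X Y) := by rw [hg.skew Y X, map_neg]
  have s2 : K 0 (β W X) (β Z Y) = -K 0 (β X W) (β Z Y) := by
    rw [hg.skew W X, map_neg, LinearMap.neg_apply]
  have s3 : K 0 (β Z X) (β W Y) = -K 0 (β Y W) (β Z X) := by
    rw [hg.skew W Y, map_neg, hg.symm]
  rw [s1, s2, s3]
  ring

/-- Antisymmetrizing `dirDeriv_koszul` in `Z` and `X`, the two terms with `β Y W` coincide, whence
the factor `2`. -/
theorem riemann_eq (hg : IsBracketMetric g ip K β) (W Z X Y : V) :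
    riemann g 0 W Z X Y = -2 * K 0 (β Y W) (β X Z) - K 0 (β Z W) (β X Y)
      + K 0 (β X W) (β Z Y) := by
  rw [riemann, hg.cometric_koszul_zero, hg.cometric_koszul_zero, hg.dirDeriv_koszul,
    hg.dirDeriv_koszul, hg.skew Z X, map_neg]
  ring

/-- The term with `β e e` vanishes by skewness, and the other two become equal up to their
coefficients, `2 + 1 = 3`. -/
theorem ricciTrace_eq (hg : IsBracketMetric g ip K β) {m : ℕ} (c : Fin m → ℝ) (e : Fin m → V)
    (X Y : V) : ricciTrace g 0 c e X Y = 3 * ∑ k, c k * K 0 (β X (e k)) (β Y (e k)) := by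
  rw [ricciTrace, Finset.mul_sum]
  refine Finset.sum_congr rfl fun k _ => ?_
  have h0 : K 0 (β (e k) (e k)) (β X Y) = 0 := by
    have : K 0 (β (e k) (e k)) (β X Y) = -K 0 (β (e k) (e k)) (β X Y) := by
      conv_lhs => rw [hg.skew (e k) (e k), map_neg, LinearMap.neg_apply]
    linarith
  rw [hg.riemann_eq, h0, hg.skew (e k) X, hg.skew (e k) Y, map_neg, map_neg,
    hg.symm (β Y (e k))]
  ring

theorem sectional_eq (hg : IsBracketMetric g ip K β) (X Y : V) :
    sectional g 0 X Y = -3 * K 0 (β X Y) (β X Y) := by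
  have h0 : K 0 (β X X) (β Y Y) = 0 := by
    have : K 0 (β X X) (β Y Y) = -K 0 (β X X) (β Y Y) := by
      conv_lhs => rw [hg.skew X X, map_neg, LinearMap.neg_apply]
    linarith
  rw [sectional, hg.riemann_eq, h0, hg.skew Y X]
  simp only [map_neg, LinearMap.neg_apply]
  ring

end IsBracketMetric

end Curvature

/-! ## The metric of the orbit space -/

section OrbitSpace

variable {n : ℕ} {𝔤 : Type*} [NormedAddCommGroup 𝔤] [InnerProductSpace ℝ 𝔤]
  [AdInvariantLieAlgebra 𝔤] [FiniteDimensional ℝ 𝔤] {L : ℝ}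

/-- The contracted bracket as a bilinear map into Schwartz functions. -/
def brkForm (n : ℕ) (𝔤 : Type*) [NormedAddCommGroup 𝔤] [InnerProductSpace ℝ 𝔤]
    [AdInvariantLieAlgebra 𝔤] [FiniteDimensional ℝ 𝔤] :
    Conn n 𝔤 →ₗ[ℝ] Conn n 𝔤 →ₗ[ℝ] 𝓢(Space n, 𝔤) :=
  LinearMap.mk₂ ℝ (fun X Y => ∑ i, SchwartzMap.pairing (adL 𝔤) (X i) (Y i))
    (fun X X' Y => by
      simp only [Pi.add_apply, map_add, _root_.add_apply, Finset.sum_add_distrib])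
    (fun c X Y => by simp only [Pi.smul_apply, map_smul, _root_.smul_apply, Finset.smul_sum])
    (fun X Y Y' => by simp only [Pi.add_apply, map_add, Finset.sum_add_distrib])
    (fun c X Y => by simp only [Pi.smul_apply, map_smul, Finset.smul_sum])

lemma coe_brkForm (X Y : Conn n 𝔤) : ⇑(brkForm n 𝔤 X Y) = brk X Y := by
  ext x
  change (∑ i, SchwartzMap.pairing (adL 𝔤) (X i) (Y i)) x = _
  rw [_root_.sum_apply]
  rfl

lemma brkForm_skew (X Y : Conn n 𝔤) : brkForm n 𝔤 X Y = -brkForm n 𝔤 Y X := by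
  ext x
  rw [_root_.neg_apply, coe_brkForm, coe_brkForm, brk, brk, ← Finset.sum_neg_distrib]
  exact Finset.sum_congr rfl fun i _ => bracket_skew _ _

/-- This is where the analysis enters the curvature computation: stability of invertibility, smooth
dependence and symmetry of the Green pairing. -/
theorem isBracketMetric_coulombMetric (hn : n = 2 ∨ n = 3) (hL : 0 < L) {A₀ : Conn n 𝔤}
    (hA : LapInvertible L A₀) :
    IsBracketMetric (coulombMetric L A₀) (fun X Y => innerL2 (X : Conn n 𝔤) Y)
      (fun q => greenForm hn hL (A₀ + (q : Conn n 𝔤)))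
      ((brkForm n 𝔤).domRestrict₁₂ (coulombSlice A₀) (coulombSlice A₀)) where
  eq_near P Q X Y := by
    filter_upwards [eventually_lapInvertible_plane hn hL hA (P : Conn n 𝔤) Q] with s hs
    rw [orbitMetric_eq_of_coulomb, ← coe_brkForm, ← coe_brkForm]
    congr 1
    exact (greenForm_apply hn hL hs _ _).symm
  smooth P Q f h := contDiffAt_greenForm hn hL hA (P : Conn n 𝔤) Q f h
  symm f h := by
    have h0 : LapInvertible L (A₀ + ((0 : coulombSlice A₀) : Conn n 𝔤)) := by simpa using hA
    rw [greenForm_apply hn hL h0, greenForm_apply hn hL h0, greenPairing_symm hn hL h0]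
  skew X Y := brkForm_skew _ _

lemma greenForm_brkForm (hn : n = 2 ∨ n = 3) (hL : 0 < L) {A₀ : Conn n 𝔤}
    (hA : LapInvertible L A₀) (X Y Z W : coulombSlice A₀) :
    greenForm hn hL (A₀ + ((0 : coulombSlice A₀) : Conn n 𝔤))
      ((brkForm n 𝔤).domRestrict₁₂ (coulombSlice A₀) (coulombSlice A₀) X Y)
      ((brkForm n 𝔤).domRestrict₁₂ (coulombSlice A₀) (coulombSlice A₀) Z W)
      = greenPairing L A₀ (brk (X : Conn n 𝔤) Y) (brk (Z : Conn n 𝔤) W) := by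
  rw [ZeroMemClass.coe_zero, add_zero, greenForm_apply hn hL hA, ← coe_brkForm, ← coe_brkForm]
  rfl

end OrbitSpace

/-! ## Components -/

section Components

variable {n : ℕ} {𝔤 : Type*} [NormedAddCommGroup 𝔤] [InnerProductSpace ℝ 𝔤]
  [AdInvariantLieAlgebra 𝔤] [FiniteDimensional ℝ 𝔤] {L : ℝ} {d : ℕ}

lemma inner_bracket_eq_sum (b : OrthonormalBasis (Fin d) ℝ 𝔤) (V : Fin d) (v w : 𝔤) :
    inner ℝ (b V) ⁅v, w⁆
      = ∑ P, ∑ R, structConst b V P R * inner ℝ (b P) v * inner ℝ (b R) w := by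
  conv_lhs => rw [← adL_apply, ← b.sum_repr' v, ← b.sum_repr' w]
  simp only [map_sum, map_smul, _root_.sum_apply, _root_.smul_apply, inner_sum,
    real_inner_smul_right, structConst, adL_apply, Finset.mul_sum]
  rw [Finset.sum_comm]
  refine Finset.sum_congr rfl fun P _ => Finset.sum_congr rfl fun R _ => ?_
  ring

lemma inner_brk_eq_sum (b : OrthonormalBasis (Fin d) ℝ 𝔤) (V : Fin d) (X Y : Conn n 𝔤)
    (x : Space n) : inner ℝ (b V) (brk X Y x)
      = ∑ P, ∑ R, ∑ i, structConst b V P R * comp b X P i x * comp b Y R i x := by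
  simp only [brk, inner_sum, inner_bracket_eq_sum]
  rw [Finset.sum_comm]
  refine Finset.sum_congr rfl fun P _ => ?_
  rw [Finset.sum_comm]
  rfl

lemma triple_sum_mul_triple_sum {α β γ : Type*} [Fintype α] [Fintype β] [Fintype γ]
    (p q : α → β → γ → ℝ) : (∑ P, ∑ R, ∑ i, p P R i) * (∑ Q, ∑ U, ∑ j, q Q U j)
      = ∑ P, ∑ R, ∑ Q, ∑ U, ∑ i, ∑ j, p P R i * q Q U j := by
  rw [Finset.sum_mul]
  refine Finset.sum_congr rfl fun P _ => ?_
  rw [Finset.sum_mul]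
  refine Finset.sum_congr rfl fun R _ => ?_
  rw [Finset.mul_sum]
  refine Finset.sum_congr rfl fun Q _ => ?_
  rw [Finset.mul_sum]
  exact Finset.sum_congr rfl fun U _ => Finset.sum_mul_sum _ _ _ _

/-- Parseval in the index `V`, then expansion of both brackets in components; carrying the sum over
`k` innermost assembles the kernel of the tensor. -/
lemma sum_inner_brk_eq (b : OrthonormalBasis (Fin d) ℝ 𝔤) {m : ℕ} (c : Fin m → ℝ)
    (e : Fin m → Conn n 𝔤) (X Y : Conn n 𝔤) (x y : Space n) :
    ∑ k, c k * (newton L (x - y) * inner ℝ (brk (e k) X x) (brk (e k) Y y))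
      = ∑ V, ∑ P, ∑ R, ∑ Q, ∑ U, ∑ i, ∑ j, structConst b V P R * comp b X R i x
          * (newton L (x - y) * tensorKernel b c e P Q i j x y)
          * (structConst b V Q U * comp b Y U j y) := by
  have h : ∀ k, c k * (newton L (x - y) * inner ℝ (brk (e k) X x) (brk (e k) Y y))
      = ∑ V, ∑ P, ∑ R, ∑ Q, ∑ U, ∑ i, ∑ j, c k * (newton L (x - y) *
          (structConst b V P R * comp b (e k) P i x * comp b X R i x
            * (structConst b V Q U * comp b (e k) Q j y * comp b Y U j y))) := by
    intro k
    rw [← b.sum_inner_mul_inner]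
    simp only [real_inner_comm (b _) (brk (e k) X x), inner_brk_eq_sum,
      triple_sum_mul_triple_sum]
    simp only [Finset.mul_sum]
  simp only [h]
  refine Finset.sum_comm.trans (Finset.sum_congr rfl fun V _ => ?_)
  refine Finset.sum_comm.trans (Finset.sum_congr rfl fun P _ => ?_)
  refine Finset.sum_comm.trans (Finset.sum_congr rfl fun R _ => ?_)
  refine Finset.sum_comm.trans (Finset.sum_congr rfl fun Q _ => ?_)
  refine Finset.sum_comm.trans (Finset.sum_congr rfl fun U _ => ?_)
  refine Finset.sum_comm.trans (Finset.sum_congr rfl fun i _ => ?_)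
  refine Finset.sum_comm.trans (Finset.sum_congr rfl fun j _ => ?_)
  rw [tensorKernel, Finset.mul_sum, Finset.mul_sum, Finset.sum_mul]
  exact Finset.sum_congr rfl fun k _ => by ring

lemma brk_skew (X Y : Conn n 𝔤) (x : Space n) : brk X Y x = -brk Y X x := by
  rw [brk, brk, ← Finset.sum_neg_distrib]
  exact Finset.sum_congr rfl fun i _ => bracket_skew _ _

/-- The finite sum is kept under both integrals so that the integrand can be rewritten pointwise by
`sum_inner_brk_eq`. -/
lemma sum_greenPairing_zero_eq (hn : n = 2 ∨ n = 3) (hL : 0 < L) {m : ℕ} (c : Fin m → ℝ)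
    (f h : Fin m → 𝓢(Space n, 𝔤)) :
    ∑ k, c k * greenPairing L (0 : Conn n 𝔤) (f k) (h k)
      = ∫ x, ∫ y, ∑ k, c k * (newton L (x - y) * inner ℝ (f k x) (h k y)) := by
  have h0 := lapInvertible_zero (𝔤 := 𝔤) hn hL
  have e1 : ∀ x, ∫ y, ∑ k, c k * (newton L (x - y) * inner ℝ (f k x) (h k y))
      = ∑ k, c k * inner ℝ (f k x) (invLap L (0 : Conn n 𝔤) (h k) x) := by
    intro x
    have hi : ∀ k, Integrable fun y => newton L (x - y) • h k y := fun k =>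
      integrable_pot' hn (kerBound_newton hn hL) (exists_decayBound_of_schwartz (h k)).choose_spec x
    have hi' : ∀ k ∈ Finset.univ, Integrable fun y =>
        c k * (newton L (x - y) * inner ℝ (f k x) (h k y)) := by
      intro k _
      have := ((innerSL ℝ (f k x)).integrable_comp (hi k)).const_mul (c k)
      simpa [inner_smul_right] using this
    rw [integral_finsetSum _ hi']
    refine Finset.sum_congr rfl fun k _ => ?_
    rw [integral_const_mul, invLap_zero_apply hn hL, ← integral_inner (hi k)]
    simp only [inner_smul_right]
  simp only [e1]
  have hj : ∀ k ∈ Finset.univ, Integrable fun x =>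
      c k * (inner ℝ (f k x) (invLap L (0 : Conn n 𝔤) (h k) x) : ℝ) := fun k _ =>
    (integrable_inner_of_decay hn (exists_decayBound_of_schwartz (f k))
      (isGreenSolution_invLap h0 (h k)).1.continuous
      ((isGreenSolution_invLap h0 (h k)).norm_le hL)).const_mul (c k)
  rw [integral_finsetSum _ hj]
  exact Finset.sum_congr rfl fun k _ => (integral_const_mul _ _).symm

end Components

end YangMills

end

/-! ### The theorem assembled -/

open YangMills
theorem lemma2p3 {n : ℕ} (hn : n = 2 ∨ n = 3) {L : ℝ} (hL : 0 < L)
    {𝔤 : Type*} [NormedAddCommGroup 𝔤] [InnerProductSpace ℝ 𝔤] [AdInvariantLieAlgebra 𝔤]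
    {d : ℕ} (b : OrthonormalBasis (Fin d) ℝ 𝔤) :
    -- the inverse Laplacian at the flat connection, and covariant Laplacians for `n = 3`
    LapInvertible L (0 : Conn n 𝔤) ∧
    (∀ (f : 𝓢(Space n, 𝔤)) (x : Space n),
      invLap L (0 : Conn n 𝔤) f x = ∫ y, newton L (x - y) • f y) ∧
    (n = 3 → ∀ A₀ : Conn n 𝔤, LapInvertible L A₀) ∧
    -- curvature at an arbitrary point at which the covariant Laplacian is invertible
    (∀ A₀ : Conn n 𝔤, LapInvertible L A₀ →
      (∀ᶠ A in 𝓝 A₀, LapInvertible L A) ∧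
      (∀ P Q X Y : coulombSlice A₀,
        ContDiffAt ℝ 2 (fun s : ℝ × ℝ => coulombMetric L A₀ (s.1 • P + s.2 • Q) X Y) 0) ∧
      (∀ W Z X Y : coulombSlice A₀,
        riemann (coulombMetric L A₀) 0 W Z X Y
          = -2 * greenPairing L A₀ (brk (Y : Conn n 𝔤) W) (brk (X : Conn n 𝔤) Z)
            - greenPairing L A₀ (brk (Z : Conn n 𝔤) W) (brk (X : Conn n 𝔤) Y)
            + greenPairing L A₀ (brk (X : Conn n 𝔤) W) (brk (Z : Conn n 𝔤) Y)) ∧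
      (∀ (m : ℕ) (c : Fin m → ℝ) (e : Fin m → coulombSlice A₀) (X Y : coulombSlice A₀),
        ricciTrace (coulombMetric L A₀) 0 c e X Y
          = 3 * ∑ k, c k * greenPairing L A₀ (brk (X : Conn n 𝔤) (e k))
              (brk (Y : Conn n 𝔤) (e k))) ∧
      (∀ X Y : coulombSlice A₀, coulombMetric L A₀ 0 X X = 1 → coulombMetric L A₀ 0 Y Y = 1 →
        coulombMetric L A₀ 0 X Y = 0 →
        sectional (coulombMetric L A₀) 0 X Y
          = -3 * greenPairing L A₀ (brk (X : Conn n 𝔤) Y) (brk (X : Conn n 𝔤) Y))) ∧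
    -- the formal Ricci curvature at the flat connection, in components
    (∀ (m : ℕ) (c : Fin m → ℝ) (e : Fin m → coulombSlice (0 : Conn n 𝔤))
        (X Y : coulombSlice (0 : Conn n 𝔤)),
      ricciTrace (coulombMetric L (0 : Conn n 𝔤)) 0 c e X Y
        = 3 * ∫ x, ∫ y, ∑ V, ∑ P, ∑ R, ∑ Q, ∑ U, ∑ i, ∑ j,
            structConst b V P R * comp b (X : Conn n 𝔤) R i x
              * (newton L (x - y) * tensorKernel b c (fun k => (e k : Conn n 𝔤)) P Q i j x y)
              * (structConst b V Q U * comp b (Y : Conn n 𝔤) U j y)) := by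
  have : FiniteDimensional ℝ 𝔤 := b.toBasis.finiteDimensional_of_finite
  refine ⟨lapInvertible_zero hn hL, invLap_zero_apply hn hL,
    fun h3 A₀ => lapInvertible_of_three hL h3 A₀, fun A₀ hA => ?_, fun m c e X Y => ?_⟩
  · have hg := isBracketMetric_coulombMetric hn hL hA
    refine ⟨eventually_lapInvertible hn hL hA, hg.contDiffAt, fun W Z X Y => ?_,
      fun m c e X Y => ?_, fun X Y _ _ _ => ?_⟩
    · rw [hg.riemann_eq]
      simp only [greenForm_brkForm hn hL hA]
    · rw [hg.ricciTrace_eq]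
      simp only [greenForm_brkForm hn hL hA]
    · rw [hg.sectional_eq]
      simp only [greenForm_brkForm hn hL hA]
  · have hA := lapInvertible_zero (𝔤 := 𝔤) hn hL
    rw [(isBracketMetric_coulombMetric hn hL hA).ricciTrace_eq]
    simp only [greenForm_brkForm hn hL hA, ← sum_inner_brk_eq b c]
    have h := sum_greenPairing_zero_eq hn hL c
      (fun k => brkForm n 𝔤 (X : Conn n 𝔤) (e k)) (fun k => brkForm n 𝔤 (Y : Conn n 𝔤) (e k))
    simp only [coe_brkForm] at h
    rw [h]
    -- Reversing both brackets costs two signs that cancel, and puts `e k` in the slot of the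
    -- structure constants that is contracted with the tensor kernel.
    have e1 : ∀ (k : Fin m) (x y : Space n),
        (inner ℝ (brk (X : Conn n 𝔤) (e k) x) (brk (Y : Conn n 𝔤) (e k) y) : ℝ)
          = inner ℝ (brk (e k : Conn n 𝔤) X x) (brk (e k : Conn n 𝔤) Y y) := by
      intro k x y
      rw [brk_skew, brk_skew (Y : Conn n 𝔤), inner_neg_neg]
    simp only [e1]
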